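/- Let $(A,\mathfrak m,k)$ be a commutative Noetherian local ring and let $M$ be a finitely generated $A$-module of G-dimension zero; that is, with $(-)^*=\operatorname{Hom}_A(-,A)$, the canonical map $M\to M^{**}$ is an isomorphism and $\operatorname{Ext}^n_A(M,A)=0=\operatorname{Ext}^n_A(M^*,A)$ for all $n\ge 1$. Let $D^b(A)$ be the bounded derived category of finitely generated $A$-modules, with suspension $\Sigma$; put $\operatorname{Ext}^n_A(X,Y)=\operatorname{Hom}_{D^b(A)}(X,\Sigma^nY)$ for $n\in\mathbb Z$, $\operatorname{Ext}_A(X,Y)=\bigoplus_{n\in\mathbb Z}\operatorname{Ext}^n_A(X,Y)$ and $\operatorname{Ext}^{\ge n_0}_A(X,Y)=\bigoplus_{n\ge n_0}\operatorname{Ext}^n_A(X,Y)$. Let $H=\bigoplus_{n\ge 0}H_n$ be a graded-commutative ring ($\eta\theta=(-1)^{|\eta||\theta|}\theta\eta$ for homogeneous $\eta,\theta$) acting centrally on $D^b(A)$: there is given a homomorphism of graded rings from $H$ to the graded center of $D^b(A)$, whose degree $n$ component consists of the natural transformations $f\colon\mathrm{Id}\to\Sigma^n$ with $f_{\Sigma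 X}=(-1)^n\Sigma f_X$. Denote by $\varphi_X\colon H\to\operatorname{Ext}_A(X,X)$ the induced ring homomorphisms; $H$ acts on $\operatorname{Ext}_A(X,Y)$ by $\eta\cdot\theta=\varphi_Y(\eta)\circ\theta$. Assume: (1) $\operatorname{Ext}_A(M\oplus M^*,k)$ is an eventually Noetherian $H$-module of finite length: there is an integer $n_0$ such that the $H$-module $\operatorname{Ext}_A^{\ge n_0}(M\oplus M^*,k)$ is Noetherian and the $H_0$-module $\operatorname{Ext}_A^{n}(M\oplus M^*,k)$ has finite length for every $n\ge n_0$. (2) The action of $H$ commutes with dualization of $M$: $\mathcal D(\varphi_M(\eta))=\varphi_{M^*}(\eta)$ for every homogeneous $\eta\in H$. Here, for $n\ge 0$, $\mathcal D\colon\operatorname{Ext}^n_A(M,M)\to\operatorname{Ext}^n_A(M^*,M^*)$ is defined as follows: an element $\theta$ corresponds to a chain map $C\to\Sigma^nC$ on a complete resolution $C$ of $M$ (a complex of finitely generated free modules such that $C$ and $\operatorname{Hom}_A(C,A)$ are exact, with $M\cong\operatorname{Im}(C_0\to C_{-1})$), and $\mathcal D(\theta)$ is the class of the dual chain map $C^*\to\Sigma^n(C^*)$.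 Sign conventions in this construction change $\mathcal D$ in degree $n$ by a sign $\sigma(n)\in\{\pm1\}$ depending only on $n$; the statement is asserted for every such choice. Let $C$ be a complete resolution of $M$ which is almost minimal, meaning that $\operatorname{Im}(C_{n+1}\to C_n)\subseteq\mathfrak mC_n$ for all $n\ne-1$; it is unique up to isomorphism. Put $\beta_n(M)=\operatorname{rank}C_n$ for $n\in\mathbb Z$, and $$\operatorname{cx}^+_AM=\inf\{t\in\mathbb Z_{\ge0}\mid\exists\,a\in\mathbb R:\ \beta_n(M)\le a\,n^{t-1}\text{ for }n\gg0\},$$ $$\operatorname{cx}^-_AM=\inf\{t\in\mathbb Z_{\ge0}\mid\exists\,a\in\mathbb R:\ \beta_n(M)\le a\,(-n)^{t-1}\text{ for }n\ll0\},$$ with values in $\mathbb Z_{\ge0}\cup\{\infty\}$, and define $\operatorname{cx}^{\pm}_AM^*$ in the same way from a complete resolution of $M^*$. Then $$\operatorname{cx}^+_AM=\operatorname{cx}^-_AM=\operatorname{cx}^+_AM^*=\operatorname{cx}^-_AM^*.$$ -/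

import Mathlib

universe w v u

noncomputable section

open CategoryTheory

namespace SymGrowth

/-! ### Central ring actions on a category with shift -/

section Center

variable (C : Type*) [Category* C] [Preadditive C] [HasShift C ℤ]
  [∀ n : ℤ, (shiftFunctor C n).Additive]

/-- The degree `n` component of the graded center: natural transformations `f : Id ⟶ Σⁿ` with
`f_{ΣX} = (-1)ⁿ Σ f_X`, where `Σ Σⁿ X` and `Σⁿ Σ X` are identified in the canonical way. -/
def gradedCenter (n : ℤ) : AddSubgroup (𝟭 C ⟶ shiftFunctor C n) where
  carrier := {f | ∀ X : C, f.app (X⟦(1 : ℤ)⟧) =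
    n.negOnePow • ((f.app X)⟦(1 : ℤ)⟧' ≫ (shiftFunctorComm C n 1).hom.app X)}
  zero_mem' := by
    intro X
    simp
  add_mem' := by
    intro f g hf hg X
    have hf' := hf X
    have hg' := hg X
    simp only [NatTrans.app_add, Functor.map_add, Preadditive.add_comp, smul_add, hf', hg']
  neg_mem' := by
    intro f hf X
    have hf' := hf X
    simp only [NatTrans.app_neg, Functor.map_neg, Preadditive.neg_comp, smul_neg, hf']

variable {C}

/-- The component at `X` of an element of the graded center, an element of `Extⁿ(X, X)`. -/
def centerApp {n : ℤ} (f : gradedCenter C n) (X : C) : ShiftedHom X X n := f.1.app X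

variable {H : Type*} [Ring H] (𝓗 : ℕ → AddSubgroup H) [GradedRing 𝓗] (C)

/-- A central action of the graded ring `H = ⨁_{n ≥ 0} 𝓗 n` on `C`: a homomorphism of graded
rings from `H` to the graded center of `C`, given by its homogeneous components. The product
`η θ` is sent to the composite `(Σⁿ η_X) ∘ θ_X` for `θ` of degree `n`. -/
structure CentralAction where
  /-- The degree `n` component of the homomorphism. -/
  hom (n : ℕ) : 𝓗 n →+ gradedCenter C (n : ℤ)
  map_one (X : C) : centerApp (hom 0 ⟨1, SetLike.one_mem_graded 𝓗⟩) X =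
    ShiftedHom.mk₀ ((0 : ℕ) : ℤ) Nat.cast_zero (𝟙 X)
  map_mul (m n : ℕ) (η : 𝓗 m) (θ : 𝓗 n) (X : C) :
    centerApp (hom (m + n) ⟨η * θ, SetLike.mul_mem_graded η.2 θ.2⟩) X =
      (centerApp (hom n θ) X).comp (centerApp (hom m η) X) (Nat.cast_add m n).symm

variable {C} {𝓗}

namespace CentralAction

/-- The ring homomorphism `φ_X : H ⟶ Ext(X, X)` in degree `n`. -/
def φ (ζ : CentralAction C 𝓗) (X : C) {n : ℕ} (η : 𝓗 n) : ShiftedHom X X (n : ℤ) :=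
  centerApp (ζ.hom n η) X

lemma φ_add (ζ : CentralAction C 𝓗) (X : C) {n : ℕ} (η θ : 𝓗 n) :
    ζ.φ X (η + θ) = ζ.φ X η + ζ.φ X θ := by
  simp [φ, centerApp]

lemma φ_zero (ζ : CentralAction C 𝓗) (X : C) {n : ℕ} : ζ.φ X (0 : 𝓗 n) = 0 := by
  simp [φ, centerApp]

/-- `Extⁿ(X, Y) = Hom(X, Σⁿ Y)`, as a module over `H₀` through `φ_Y`. -/
@[nolint unusedArguments]
def ExtDeg (_ζ : CentralAction C 𝓗) (X Y : C) (n : ℤ) : Type _ := ShiftedHom X Y n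

instance (ζ : CentralAction C 𝓗) (X Y : C) (n : ℤ) : AddCommGroup (ζ.ExtDeg X Y n) :=
  inferInstanceAs (AddCommGroup (ShiftedHom X Y n))

/-- Left multiplication `θ ↦ φ_Y(η) ∘ θ`, from `Extⁿ(X, Y)` to `Ext^{m+n}(X, Y)`, where `η` has
degree `m`. It is additive in `η` and in `θ`. -/
def mulLeft (ζ : CentralAction C 𝓗) (X Y : C) (m : ℕ) (n k : ℤ) (h : (m : ℤ) + n = k) :
    𝓗 m →+ ζ.ExtDeg X Y n →+ ζ.ExtDeg X Y k :=
  AddMonoidHom.mk' (fun η => AddMonoidHom.mk'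
      (fun θ => ShiftedHom.comp (show ShiftedHom X Y n from θ) (ζ.φ Y η) h)
      (fun _ _ => ShiftedHom.add_comp _ _ _ h))
    (fun η η' => by
      ext θ
      exact (congrArg (fun t => ShiftedHom.comp (show ShiftedHom X Y n from θ) t h)
        (ζ.φ_add Y η η')).trans (ShiftedHom.comp_add _ _ _ h))

lemma mulLeft_one (ζ : CentralAction C 𝓗) (X Y : C) (n : ℤ) (h : ((0 : ℕ) : ℤ) + n = n)
    (θ : ζ.ExtDeg X Y n) :
    ζ.mulLeft X Y 0 n n h ⟨1, SetLike.one_mem_graded 𝓗⟩ θ = θ := by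
  change ShiftedHom.comp (show ShiftedHom X Y n from θ) (centerApp (ζ.hom 0 ⟨1, _⟩) Y) h = θ
  rw [ζ.map_one]
  exact ShiftedHom.comp_mk₀_id _ _ _

lemma mulLeft_mul (ζ : CentralAction C 𝓗) (X Y : C) (m m' : ℕ) (n k l : ℤ)
    (h : (m' : ℤ) + n = k) (h' : (m : ℤ) + k = l) (h'' : ((m + m' : ℕ) : ℤ) + n = l)
    (η : 𝓗 m) (η' : 𝓗 m') (θ : ζ.ExtDeg X Y n) :
    ζ.mulLeft X Y (m + m') n l h'' ⟨η * η', SetLike.mul_mem_graded η.2 η'.2⟩ θ =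
      ζ.mulLeft X Y m k l h' η (ζ.mulLeft X Y m' n k h η' θ) := by
  change ShiftedHom.comp (show ShiftedHom X Y n from θ) (centerApp (ζ.hom _ ⟨η * η', _⟩) Y) h'' =
    ShiftedHom.comp (ShiftedHom.comp (show ShiftedHom X Y n from θ) (centerApp (ζ.hom _ η') Y) h)
      (centerApp (ζ.hom _ η) Y) h'
  rw [ζ.map_mul, ShiftedHom.comp_assoc]
  rw [add_assoc, h, h']

instance (ζ : CentralAction C 𝓗) (X Y : C) (n : ℤ) : Module (𝓗 0) (ζ.ExtDeg X Y n) where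
  smul η θ := ζ.mulLeft X Y 0 n n (by simp) η θ
  one_smul θ := ζ.mulLeft_one X Y n _ θ
  mul_smul η η' θ := ζ.mulLeft_mul X Y 0 0 n n n (by simp) (by simp) (by simp) η η' θ
  smul_zero η := map_zero _
  smul_add η := map_add _
  add_smul η η' θ := by
    change ζ.mulLeft X Y 0 n n _ (η + η') θ = _
    rw [map_add]
    rfl
  zero_smul θ := by
    change ζ.mulLeft X Y 0 n n _ 0 θ = _
    rw [map_zero]
    rfl

open scoped DirectSum

/-- The graded module `Ext(X, Y) = ⨁_{n ∈ ℤ} Extⁿ(X, Y)`. -/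
def ExtTotal (ζ : CentralAction C 𝓗) (X Y : C) : Type _ := ⨁ n : ℤ, ζ.ExtDeg X Y n

instance (ζ : CentralAction C 𝓗) (X Y : C) : AddCommGroup (ζ.ExtTotal X Y) :=
  inferInstanceAs (AddCommGroup (⨁ n : ℤ, ζ.ExtDeg X Y n))

/-- The inclusion of `Extⁿ(X, Y)` in `Ext(X, Y)`. -/
def extOf (ζ : CentralAction C 𝓗) (X Y : C) (n : ℤ) : ζ.ExtDeg X Y n →+ ζ.ExtTotal X Y :=
  DirectSum.of (fun n => ζ.ExtDeg X Y n) n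

/-- The component of degree `n` of an element of `Ext(X, Y)`. -/
def extComponent (ζ : CentralAction C 𝓗) (X Y : C) (n : ℤ) :
    ζ.ExtTotal X Y →+ ζ.ExtDeg X Y n :=
  DFinsupp.evalAddMonoidHom (β := fun n => ζ.ExtDeg X Y n) n

/-- The action on `Ext(X, Y)` of the homogeneous elements of `H` of degree `m`. -/
def actDeg (ζ : CentralAction C 𝓗) (X Y : C) (m : ℕ) :
    𝓗 m →+ AddMonoid.End (ζ.ExtTotal X Y) :=
  AddMonoidHom.mk' (fun η => DirectSum.toAddMonoid
      (fun n => (ζ.extOf X Y (m + n)).comp (ζ.mulLeft X Y m n (m + n) rfl η)))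
    (fun η η' => by
      refine DirectSum.addHom_ext' (fun n => ?_)
      ext θ
      have key (ξ : 𝓗 m) : DirectSum.toAddMonoid
          (fun n : ℤ => (ζ.extOf X Y (m + n)).comp (ζ.mulLeft X Y m n (m + n) rfl ξ))
          (DirectSum.of (ζ.ExtDeg X Y) n θ) =
          ζ.extOf X Y (m + n) (ζ.mulLeft X Y m n (m + n) rfl ξ θ) :=
        DirectSum.toAddMonoid_of _ _ _
      refine (key (η + η')).trans (Eq.trans ?_ (congrArg₂ (· + ·) (key η) (key η')).symm)
      rw [map_add, AddMonoidHom.add_apply, map_add])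

lemma actDeg_extOf (ζ : CentralAction C 𝓗) (X Y : C) (m : ℕ) (η : 𝓗 m) (n k : ℤ)
    (h : (m : ℤ) + n = k) (θ : ζ.ExtDeg X Y n) :
    ζ.actDeg X Y m η (ζ.extOf X Y n θ) = ζ.extOf X Y k (ζ.mulLeft X Y m n k h η θ) := by
  subst h
  exact DirectSum.toAddMonoid_of (fun n : ℤ =>
    (ζ.extOf X Y (m + n)).comp (ζ.mulLeft X Y m n (m + n) rfl η)) n θ

lemma extTotal_hom_ext (ζ : CentralAction C 𝓗) (X Y : C) {f g : AddMonoid.End (ζ.ExtTotal X Y)}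
    (h : ∀ (n : ℤ) (θ : ζ.ExtDeg X Y n), f (ζ.extOf X Y n θ) = g (ζ.extOf X Y n θ)) : f = g :=
  DirectSum.addHom_ext h

/-- The action of `H` on `Ext(X, Y)`, as an additive map. -/
def actAdd (ζ : CentralAction C 𝓗) (X Y : C) : H →+ AddMonoid.End (ζ.ExtTotal X Y) :=
  (DirectSum.toAddMonoid (ζ.actDeg X Y)).comp (DirectSum.decomposeAddEquiv 𝓗).toAddMonoidHom

lemma actAdd_coe (ζ : CentralAction C 𝓗) (X Y : C) {m : ℕ} (η : 𝓗 m) :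
    ζ.actAdd X Y (η : H) = ζ.actDeg X Y m η := by
  change DirectSum.toAddMonoid (ζ.actDeg X Y) (DirectSum.decompose 𝓗 (η : H)) = _
  rw [DirectSum.decompose_coe, DirectSum.toAddMonoid_of]

lemma actAdd_one (ζ : CentralAction C 𝓗) (X Y : C) : ζ.actAdd X Y 1 = 1 := by
  have := ζ.actAdd_coe X Y ⟨1, SetLike.one_mem_graded 𝓗⟩
  refine this.trans (ζ.extTotal_hom_ext X Y (fun n θ => ?_))
  rw [ζ.actDeg_extOf X Y 0 _ n n (by simp), mulLeft_one]
  rfl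

lemma actAdd_mul (ζ : CentralAction C 𝓗) (X Y : C) (a b : H) :
    ζ.actAdd X Y (a * b) = ζ.actAdd X Y a * ζ.actAdd X Y b := by
  induction a using DirectSum.Decomposition.inductionOn 𝓗 with
  | zero => simp
  | add a a' ha ha' => rw [add_mul, map_add, map_add, ha, ha', add_mul]
  | homogeneous a =>
    induction b using DirectSum.Decomposition.inductionOn 𝓗 with
    | zero => simp
    | add b b' hb hb' => rw [mul_add, map_add, map_add, hb, hb', mul_add]
    | homogeneous b =>
      rename_i m n
      rw [actAdd_coe, actAdd_coe]
      have := ζ.actAdd_coe X Y ⟨(a : H) * b, SetLike.mul_mem_graded a.2 b.2⟩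
      refine this.trans (ζ.extTotal_hom_ext X Y (fun k θ => ?_))
      refine Eq.trans ?_ (show ζ.actDeg X Y m a (ζ.actDeg X Y n b (ζ.extOf X Y k θ)) = _ from rfl)
      rw [ζ.actDeg_extOf X Y (m + n) _ k (m + (n + k)) (by push_cast; ring),
        ζ.actDeg_extOf X Y n b k _ rfl, ζ.actDeg_extOf X Y m a _ _ rfl,
        ζ.mulLeft_mul X Y m n k (n + k) _ rfl rfl]

/-- `Ext(X, Y)` as an `H`-module: `η • θ = φ_Y(η) ∘ θ`. -/
instance (ζ : CentralAction C 𝓗) (X Y : C) : Module H (ζ.ExtTotal X Y) :=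
  Module.compHom _ ((RingHom.mk' (⟨⟨ζ.actAdd X Y, ζ.actAdd_one X Y⟩, ζ.actAdd_mul X Y⟩ :
    H →* AddMonoid.End (ζ.ExtTotal X Y)) (map_add (ζ.actAdd X Y))))

lemma smul_extOf (ζ : CentralAction C 𝓗) (X Y : C) {m : ℕ} (η : 𝓗 m) (n k : ℤ)
    (h : (m : ℤ) + n = k) (θ : ζ.ExtDeg X Y n) :
    (η : H) • ζ.extOf X Y n θ = ζ.extOf X Y k (ζ.mulLeft X Y m n k h η θ) := by
  change ζ.actAdd X Y (η : H) _ = _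
  rw [actAdd_coe, ζ.actDeg_extOf X Y m η n k h]

lemma extComponent_extOf_self (ζ : CentralAction C 𝓗) (X Y : C) (n : ℤ) (θ : ζ.ExtDeg X Y n) :
    ζ.extComponent X Y n (ζ.extOf X Y n θ) = θ :=
  DirectSum.of_eq_same n θ

lemma extComponent_extOf_ne (ζ : CentralAction C 𝓗) (X Y : C) (n k : ℤ) (h : n ≠ k)
    (θ : ζ.ExtDeg X Y n) : ζ.extComponent X Y k (ζ.extOf X Y n θ) = 0 :=
  DirectSum.of_eq_of_ne n k θ h.symm

lemma extComponent_actDeg (ζ : CentralAction C 𝓗) (X Y : C) (m : ℕ) (η : 𝓗 m) (n k : ℤ)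
    (h : (m : ℤ) + n = k) (x : ζ.ExtTotal X Y) :
    ζ.extComponent X Y k (ζ.actDeg X Y m η x) =
      ζ.mulLeft X Y m n k h η (ζ.extComponent X Y n x) := by
  suffices h' : (ζ.extComponent X Y k).comp (ζ.actDeg X Y m η) =
      (ζ.mulLeft X Y m n k h η).comp (ζ.extComponent X Y n) from DFunLike.congr_fun h' x
  refine DirectSum.addHom_ext (fun l θ => ?_)
  change ζ.extComponent X Y k (ζ.actDeg X Y m η (ζ.extOf X Y l θ)) =
    ζ.mulLeft X Y m n k h η (ζ.extComponent X Y n (ζ.extOf X Y l θ))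
  by_cases hl : l = n
  · subst hl
    rw [ζ.actDeg_extOf X Y m η l k h, extComponent_extOf_self, extComponent_extOf_self]
  · rw [ζ.actDeg_extOf X Y m η l _ rfl, extComponent_extOf_ne _ _ _ _ _ hl,
      extComponent_extOf_ne _ _ _ _ _ (by lia), map_zero]

/-- The `H`-submodule `Ext^{≥ n₀}(X, Y) = ⨁_{n ≥ n₀} Extⁿ(X, Y)` of `Ext(X, Y)`. -/
def extGE (ζ : CentralAction C 𝓗) (X Y : C) (n₀ : ℤ) : Submodule H (ζ.ExtTotal X Y) where
  carrier := {x | ∀ n < n₀, ζ.extComponent X Y n x = 0}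
  zero_mem' := fun n _ => map_zero _
  add_mem' := fun {x y} hx hy n hn => by rw [map_add, hx n hn, hy n hn, add_zero]
  smul_mem' := by
    intro a x hx
    induction a using DirectSum.Decomposition.inductionOn 𝓗 with
    | zero =>
      intro n _
      rw [zero_smul, map_zero]
    | add a b ha hb =>
      intro n hn
      rw [add_smul, map_add, ha n hn, hb n hn, add_zero]
    | homogeneous a =>
      rename_i m
      intro n hn
      change ζ.extComponent X Y n (ζ.actAdd X Y (a : H) x) = 0
      rw [actAdd_coe, ζ.extComponent_actDeg X Y m a (n - m) n (by lia), hx _ (by lia), map_zero]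

/-- `Ext(X, Y)` is an eventually Noetherian `H`-module of finite length. -/
def IsNoethFL (ζ : CentralAction C 𝓗) (X Y : C) : Prop :=
  ∃ n₀ : ℤ, IsNoetherian H (ζ.extGE X Y n₀) ∧
    ∀ n ≥ n₀, IsFiniteLength (𝓗 0) (ζ.ExtDeg X Y n)

end CentralAction

end Center

/-! ### The bounded derived category -/

section Derived

variable (A : Type u) [CommRing A] [HasDerivedCategory.{w} (ModuleCat.{u} A)]

/-- The complexes of `A`-modules with bounded cohomology (with respect to the canonical
t-structure) all of whose cohomology modules are finitely generated. -/
def boundedFG : ObjectProperty (DerivedCategory (ModuleCat.{u} A)) :=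
  DerivedCategory.TStructure.t.bounded ⊓
    fun X => ∀ n : ℤ, Module.Finite A ((DerivedCategory.homologyFunctor (ModuleCat.{u} A) n).obj X)

instance : (boundedFG A).IsStableUnderShift ℤ where
  isStableUnderShiftBy a :=
    { le_shift := by
        rintro X ⟨hX, hX'⟩
        refine ⟨DerivedCategory.TStructure.t.bounded.le_shift a X hX, fun n => ?_⟩
        have : Module.Finite A (((DerivedCategory.homologyFunctor (ModuleCat.{u} A) 0).shift
          (a + n)).obj X) := hX' (a + n)
        let e := ((DerivedCategory.homologyFunctor (ModuleCat.{u} A) 0).shiftIso a n (a + n)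
          rfl).app X
        exact Module.Finite.equiv (Iso.toLinearEquiv e).symm }

/-- The bounded derived category `D^b(A)` of finitely generated `A`-modules (`A` Noetherian), as
the full subcategory of the derived category of all `A`-modules on the complexes with bounded
finitely generated cohomology. -/
abbrev Db := (boundedFG A).FullSubcategory

variable (M : Type u) [AddCommGroup M] [Module A M]

/-- The module `M`, as a complex concentrated in degree `0`, in the derived category. -/
abbrev single : DerivedCategory (ModuleCat.{u} A) :=
  (DerivedCategory.singleFunctor (ModuleCat.{u} A) 0).obj (ModuleCat.of A M)

lemma boundedFG_single [Module.Finite A M] : boundedFG A (single A M) := by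
  refine ⟨⟨⟨0, inferInstance⟩, ⟨0, inferInstance⟩⟩, fun n => ?_⟩
  let e := (DerivedCategory.homologyFunctorFactors (ModuleCat.{u} A) n).app
    ((HomologicalComplex.single (ModuleCat.{u} A) (ComplexShape.up ℤ) 0).obj (ModuleCat.of A M))
  by_cases hn : n = 0
  · subst hn
    let e' := e ≪≫ HomologicalComplex.singleObjHomologySelfIso (ComplexShape.up ℤ) 0
      (ModuleCat.of A M)
    exact Module.Finite.equiv (M := M) (Iso.toLinearEquiv e').symm
  · change Module.Finite A ((DerivedCategory.homologyFunctor (ModuleCat.{u} A) n).obj (single A M))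
    have h := (HomologicalComplex.isZero_single_obj_homology (ComplexShape.up ℤ) 0
      (ModuleCat.of A M) n hn).of_iso e
    have : Subsingleton ((DerivedCategory.homologyFunctor (ModuleCat.{u} A) n).obj
      (single A M)) := ModuleCat.subsingleton_of_isZero h
    infer_instance

/-- A finitely generated module, as an object of `D^b(A)`. -/
def dbOf [Module.Finite A M] : Db A := ⟨single A M, boundedFG_single A M⟩

end Derived

/-! ### G-dimension zero and complete resolutions -/

section GDim

variable (A : Type u) [CommRing A] (M : Type u) [AddCommGroup M] [Module A M]

/-- `M` has G-dimension zero (for `M` finitely generated): it is reflexive and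
`Extⁿ(M, A) = 0 = Extⁿ(M*, A)` for all `n ≥ 1`. -/
structure IsGDimZero : Prop where
  reflexive : Module.IsReflexive A M
  ext_eq_zero (n : ℕ) (hn : 1 ≤ n) :
    Subsingleton (Abelian.Ext (ModuleCat.of A M) (ModuleCat.of A A) n)
  ext_dual_eq_zero (n : ℕ) (hn : 1 ≤ n) :
    Subsingleton (Abelian.Ext (ModuleCat.of A (Module.Dual A M)) (ModuleCat.of A A) n)

/-- A complete resolution of `M`: a totally acyclic complex `C` of finitely generated free modules
with `M ≅ Im (C₀ ⟶ C₋₁)`. It is written as a cochain complex: `Cₙ` is `cx.X (-n)`. -/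
structure CompleteResolution where
  /-- The complex; `cx.X i` is the module of homological degree `-i`. -/
  cx : CochainComplex (ModuleCat.{u} A) ℤ
  free (i : ℤ) : Module.Free A (cx.X i)
  finite (i : ℤ) : Module.Finite A (cx.X i)
  exact (i : ℤ) : Function.Exact (cx.d (i - 1) i).hom (cx.d i (i + 1)).hom
  exact_dual (i : ℤ) :
    Function.Exact (cx.d i (i + 1)).hom.dualMap (cx.d (i - 1) i).hom.dualMap
  /-- The surjection `C₀ ⟶ M`. -/
  proj : cx.X 0 →ₗ[A] M
  /-- The injection `M ⟶ C₋₁`. -/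
  incl : M →ₗ[A] cx.X 1
  proj_surjective : Function.Surjective proj
  incl_injective : Function.Injective incl
  fac : (cx.d 0 1).hom = incl ∘ₗ proj

variable {A M}

/-- The complete resolution `C` is almost minimal: the image of `Cₙ₊₁ ⟶ Cₙ` is contained in
`𝔪 Cₙ` for all `n ≠ -1`. -/
def CompleteResolution.IsAlmostMinimal [IsLocalRing A] (R : CompleteResolution A M) : Prop :=
  ∀ n : ℤ, n ≠ -1 →
    LinearMap.range (R.cx.d (-(n + 1)) (-n)).hom ≤ IsLocalRing.maximalIdeal A • ⊤

variable (A M)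

open Classical in
/-- The `n`-th Betti number `βₙ(M) = rank Cₙ`, `n ∈ ℤ`, for an almost minimal complete
resolution `C` of `M`. Every finitely generated module of G-dimension zero over a Noetherian local
ring has one, and it is unique up to isomorphism; the value is `0` if there is none. -/
def bettiNumber [IsLocalRing A] (n : ℤ) : ℕ :=
  if h : ∃ R : CompleteResolution A M, R.IsAlmostMinimal then
    Module.finrank A (h.choose.cx.X (-n))
  else 0

/-- The positive complexity `cx⁺ M`; the infimum of the empty set is `∞`. -/
def posComplexity [IsLocalRing A] : ℕ∞ :=
  ⨅ t ∈ {t : ℕ | ∃ a : ℝ, ∀ᶠ n : ℤ in Filter.atTop,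
    (bettiNumber A M n : ℝ) ≤ a * (n : ℝ) ^ ((t : ℤ) - 1)}, (t : ℕ∞)

/-- The negative complexity `cx⁻ M`; the infimum of the empty set is `∞`. -/
def negComplexity [IsLocalRing A] : ℕ∞ :=
  ⨅ t ∈ {t : ℕ | ∃ a : ℝ, ∀ᶠ n : ℤ in Filter.atBot,
    (bettiNumber A M n : ℝ) ≤ a * (-(n : ℝ)) ^ ((t : ℤ) - 1)}, (t : ℕ∞)

end GDim

/-! ### Dualization of extensions -/

section Dualization

variable {A : Type u} [CommRing A]

/-- The dual of a complex `C`, indexed so that a complete resolution of `M` becomes one of `M*`: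
its module in homological degree `n` is `(C₋₁₋ₙ)*`, and its differentials are the transposes of
those of `C`. -/
def dualCx (K : CochainComplex (ModuleCat.{u} A) ℤ) : CochainComplex (ModuleCat.{u} A) ℤ where
  X i := ModuleCat.of A (Module.Dual A (K.X (1 - i)))
  d i j := ModuleCat.ofHom (K.d (1 - j) (1 - i)).hom.dualMap
  shape i j hij := by
    rw [K.shape (1 - j) (1 - i) (by simp only [ComplexShape.up_Rel] at hij ⊢; lia)]
    ext
    simp
  d_comp_d' i j k _ _ := by
    have h : (K.d (1 - j) (1 - i)).hom ∘ₗ (K.d (1 - k) (1 - j)).hom = 0 := by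
      rw [← ModuleCat.hom_comp, K.d_comp_d, ModuleCat.hom_zero]
    ext φ x
    exact (congrArg φ (LinearMap.congr_fun h x)).trans (map_zero φ)

/-- The component `Kᵖ ⟶ K^q`, `q = p + n`, of a chain map `f : K ⟶ Σⁿ K`. -/
def shiftComponent {K : CochainComplex (ModuleCat.{u} A) ℤ} {n : ℤ} (f : K ⟶ K⟦n⟧) (p q : ℤ)
    (h : p + n = q) : K.X p ⟶ K.X q :=
  (show K.X p ⟶ K.X (p + n) from f.f p) ≫ (K.XIsoOfEq h).hom

lemma shiftComponent_comp_d {K : CochainComplex (ModuleCat.{u} A) ℤ} {n : ℤ} (f : K ⟶ K⟦n⟧)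
    (p q p' q' : ℤ) (h : p + n = q) (h' : p' + n = q') :
    shiftComponent f p q h ≫ K.d q q' =
      n.negOnePow • (K.d p p' ≫ shiftComponent f p' q' h') := by
  subst h h'
  have e (r : ℤ) : shiftComponent f r (r + n) rfl = f.f r := Category.comp_id _
  rw [e, e]
  have hf : f.f p ≫ (n.negOnePow • K.d (p + n) (p' + n)) = K.d p p' ≫ f.f p' := f.comm p p'
  refine Eq.trans ?_ (congrArg (fun t => n.negOnePow • t) hf)
  refine Eq.trans ?_ (congrArg (fun t => n.negOnePow • t) (Linear.comp_units_smul (f.f p)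
    n.negOnePow (K.d (p + n) (p' + n)))).symm
  rw [smul_smul, Int.units_mul_self, one_smul]
  rfl

/-- The dual of a chain map `f : C ⟶ Σⁿ C`, as a chain map `C* ⟶ Σⁿ (C*)`: its components are
the transposes of the components of `f`. -/
def dualMap {K : CochainComplex (ModuleCat.{u} A) ℤ} {n : ℤ} (f : K ⟶ K⟦n⟧) :
    dualCx K ⟶ (dualCx K)⟦n⟧ where
  f i := ModuleCat.ofHom (shiftComponent f (1 - (i + n)) (1 - i) (by lia)).hom.dualMap
  comm' i j hij := by
    have h := congrArg (fun t => ModuleCat.ofHom t.hom.dualMap)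
      (shiftComponent_comp_d f (1 - (j + n)) (1 - j) (1 - (i + n)) (1 - i) (by lia) (by lia))
    have key (ε : ℤˣ) {X Y Z : ModuleCat.{u} A} (g : X ⟶ Y) (g' : Y ⟶ Z) :
        ModuleCat.ofHom g'.hom.dualMap ≫ (ε • ModuleCat.ofHom g.hom.dualMap) =
          ModuleCat.ofHom (ε • (g ≫ g')).hom.dualMap := by
      obtain rfl | rfl := Int.units_eq_one_or ε
      · rw [one_smul, one_smul]
        rfl
      · rw [Units.neg_smul, Units.neg_smul, one_smul, one_smul, Preadditive.comp_neg]
        ext φ x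
        have e (ψ : Module.Dual A Z) :
            -(ψ ∘ₗ (g ≫ g').hom) = ψ ∘ₗ (-(g ≫ g')).hom :=
          LinearMap.ext fun x => (map_neg ψ ((g ≫ g').hom x)).symm
        exact LinearMap.congr_fun (e φ) x
    exact (key n.negOnePow _ _).trans h.symm

variable [HasDerivedCategory.{w} (ModuleCat.{u} A)]

/-- Let `K` be a complex with a map `proj : K⁰ ⟶ N` whose part `F` in cohomological degrees `≤ 0`
(the quotient of `K` by its part in degrees `≥ 1`) is a resolution of `N` through `proj`. The chain
map `f : K ⟶ Σⁿ K` corresponds to `θ ∈ Extⁿ(N, N)` if the chain map `g : F ⟶ Σⁿ F` which it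
induces represents `θ`, under the isomorphism `F ≅ N` of the derived category. -/
def Corresponds (K : CochainComplex (ModuleCat.{u} A) ℤ) (N : Type u) [AddCommGroup N]
    [Module A N] (proj : K.X 0 →ₗ[A] N) (n : ℤ) (f : K ⟶ K⟦n⟧)
    (θ : ShiftedHom (single A N) (single A N) n) : Prop :=
  ∃ (F : CochainComplex (ModuleCat.{u} A) ℤ) (q : K ⟶ F)
    (p : F ⟶ (HomologicalComplex.single (ModuleCat.{u} A) (ComplexShape.up ℤ) 0).obj
      (ModuleCat.of A N)) (g : F ⟶ F⟦n⟧),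
    (∀ i ≤ 0, IsIso (q.f i)) ∧ (∀ i > 0, Limits.IsZero (F.X i)) ∧
    q.f 0 ≫ p.f 0 ≫ (HomologicalComplex.singleObjXSelf (ComplexShape.up ℤ) 0
      (ModuleCat.of A N)).hom = ModuleCat.ofHom proj ∧
    QuasiIso p ∧
    q ≫ g = f ≫ q⟦n⟧' ∧
    DerivedCategory.Q.map p ≫ θ =
      ShiftedHom.map g DerivedCategory.Q ≫ (DerivedCategory.Q.map p)⟦n⟧'

variable (M : Type u) [AddCommGroup M] [Module A M]

/-- The graph of the anti-isomorphism `𝒟 : Extⁿ(M, M) ⟶ Extⁿ(M*, M*)`, for `M` of G-dimension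
zero: `θ' = 𝒟 θ` if `θ` corresponds to a chain map `C ⟶ Σⁿ C` on a complete resolution of `M`
whose dual `C* ⟶ Σⁿ (C*)` corresponds to `θ'`. -/
def IsDualExt {n : ℤ} (θ : ShiftedHom (single A M) (single A M) n)
    (θ' : ShiftedHom (single A (Module.Dual A M)) (single A (Module.Dual A M)) n) : Prop :=
  ∃ (R : CompleteResolution A M) (f : R.cx ⟶ R.cx⟦n⟧),
    Corresponds R.cx M R.proj n f θ ∧
    Corresponds (dualCx R.cx) (Module.Dual A M) R.incl.dualMap n (dualMap f) θ'

variable {H : Type v} [Ring H] {𝓗 : ℕ → AddSubgroup H} [GradedRing 𝓗]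

/-- The action of `H` on `D^b(A)` commutes with dualization of `M`: `𝒟 (φ_M η) = φ_{M*} η` for
every homogeneous `η ∈ H`. The identifications of shifts and of duals of complexes which enter `𝒟`
are subject to sign conventions, which change `𝒟` by a sign depending on the degree only; the sign
is `σ n` in degree `n`, and `σ = 1` if no signs are introduced. -/
def CommutesWithDualization [IsNoetherianRing A] [Module.Finite A M]
    (ζ : CentralAction (Db A) 𝓗) (σ : ℕ → ℤˣ) : Prop :=
  ∀ (n : ℕ) (η : 𝓗 n),
    IsDualExt M ((ζ.φ (dbOf A M) η).map (boundedFG A).ι)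
      (σ n • (ζ.φ (dbOf A (Module.Dual A M)) η).map (boundedFG A).ι)

end Dualization

end SymGrowth

end

noncomputable section

open CategoryTheory

namespace SymGrowth

/-! ### Sign-free chain maps and null-homotopies in totally acyclic complexes. -/

section Elementary

variable {A : Type u} [CommRing A]

/-! Let `C` be an almost minimal complete resolution of `M`, with place `i` holding the module of
homological degree `-i`, and let `V` be the cohomology of `Hom(C, k)` at all places. Away from two
places the length of `V` is the rank of `C`, and dualizing `C` reverses the order of the places. So
everything reduces to comparing the growth of `V` far to the left (ordinary `Ext`) with its growth
far to the right (negative Tate cohomology).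

Noetherianity of `Ext(M ⊕ M*, k)` produces finitely many elements of `H` of positive even degree
which generate the high degrees from lower ones (`exists_even_generators`). Even degree makes them
commute and removes signs. They are realized by endomorphisms of `C` commuting up to homotopy, whose
transposes realize the action on `M*` because the action commutes with dualization
(`exists_commSys`). Hence the cohomology of `Hom(C, N)` is, for every `N`, a module over the
polynomial ring `P` in these endomorphisms. For `V` there are two finiteness facts: the far left is
generated by the endomorphisms, and no nonzero class on the far right is killed by all of them. The
second is generation for `C*`, transposed by means of minimality (`eq_zero_of_dual_generation`).

The core is `growth_comparison`: the right half of `V` grows no faster than the left half. Let `J`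
be the ideal generated by the homogeneous elements of `P` killing the left half. A class at place
`i` killed by `J` is determined by its multiples in a window of fixed width, and there only
polynomials of degree about `i` modulo `J` matter. Evaluated on generators of the left half, these
embed into finitely many components of `V` near place `-i`. So the `J`-torsion grows at most like
the left half (`growth_torsion`).

It remains to see that a homogeneous `q` in `J` is nilpotent on all of `V`. Dévissage carries the
situation from `k` to the coefficients `M`: some `q ^ n` is congruent modulo the maximal ideal to an
`s` killing the left half of the cohomology with values in `M` (`noetherian_and_nilpotent`). Then
`s` kills the class of `C₀ → M`, that is, of the identity of `M`, so its homogeneous components are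
null-homotopic and `s` kills the cohomology with any coefficients, at every place
(`smul_eq_zero_of_smul_proj`). As the maximal ideal kills `V`, so does `q ^ n`. Removing finitely
many generators of `J` one at a time by `growth_of_nilpotent` gives the bound.

Applied to `C` and to `C*`, this bounds each direction by the other (`growth_symmetry`), and
reindexing gives all the equalities (`complexity_eq_of_growth`). -/

/-- A family of linear maps of degree `n` between two complexes, commuting with the
differentials without signs. -/
@[ext]
structure StrictMap (K L : CochainComplex (ModuleCat.{u} A) ℤ) (n : ℤ) where
  /-- The component `Kᵖ ⟶ L^q`, `q = p + n`. -/
  app (p q : ℤ) (h : p + n = q) : K.X p →ₗ[A] L.X q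
  comm (p q p' q' : ℤ) (h : p + n = q) (h' : p' + n = q') (hp : p + 1 = p') (x : K.X p) :
    (L.d q q').hom (app p q h x) = app p' q' h' ((K.d p p').hom x)

namespace StrictMap

variable {K L L' : CochainComplex (ModuleCat.{u} A) ℤ} {n m : ℤ}

/-- The identity. -/
def id (K : CochainComplex (ModuleCat.{u} A) ℤ) : StrictMap K K 0 where
  app p q h := (K.XIsoOfEq (show p = q by lia)).hom.hom
  comm p q p' q' h h' hp x := by
    obtain rfl : p = q := by lia
    obtain rfl : p' = q' := by lia
    rfl

/-- The composite of strict maps. -/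
def comp (f : StrictMap K L n) (g : StrictMap L L' m) (k : ℤ) (hk : n + m = k) :
    StrictMap K L' k where
  app p q h := g.app (p + n) q (by lia) ∘ₗ f.app p (p + n) rfl
  comm p q p' q' h h' hp x := by
    simp only [LinearMap.comp_apply]
    rw [g.comm (p + n) q (p' + n) q' (by lia) (by lia) (by lia),
      f.comm p (p + n) p' (p' + n) rfl rfl hp]

lemma comp_app (f : StrictMap K L n) (g : StrictMap L L' m) (k : ℤ) (hk : n + m = k)
    (p q r : ℤ) (h : p + n = q) (h' : q + m = r) (h'' : p + k = r) :
    (f.comp g k hk).app p r h'' = g.app q r h' ∘ₗ f.app p q h := by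
  subst h
  rfl

instance : Add (StrictMap K L n) where
  add f g :=
    { app p q h := f.app p q h + g.app p q h
      comm p q p' q' h h' hp x := by
        simp [f.comm p q p' q' h h' hp, g.comm p q p' q' h h' hp] }

instance : Zero (StrictMap K L n) where
  zero := { app p q h := 0, comm p q p' q' h h' hp x := by simp }

instance : SMul A (StrictMap K L n) where
  smul a f :=
    { app p q h := a • f.app p q h
      comm p q p' q' h h' hp x := by simp [f.comm p q p' q' h h' hp] }

@[simp] lemma add_app (f g : StrictMap K L n) (p q : ℤ) (h : p + n = q) :
    (f + g).app p q h = f.app p q h + g.app p q h := rfl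

@[simp] lemma zero_app (p q : ℤ) (h : p + n = q) :
    (0 : StrictMap K L n).app p q h = 0 := rfl

@[simp] lemma smul_app (a : A) (f : StrictMap K L n) (p q : ℤ) (h : p + n = q) :
    (a • f).app p q h = a • f.app p q h := rfl

/-- The condition of being null-homotopic at one place. -/
def NullAt (f : StrictMap K L n) (p : ℤ) : Prop :=
  ∃ (s : K.X p →ₗ[A] L.X (p + n - 1)) (t : K.X (p + 1) →ₗ[A] L.X (p + n)),
    f.app p (p + n) rfl = (L.d (p + n - 1) (p + n)).hom ∘ₗ s + t ∘ₗ (K.d p (p + 1)).hom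

lemma NullAt.exists {f : StrictMap K L n} {p : ℤ} (hf : f.NullAt p) (q q' p' : ℤ) (h : p + n = q)
    (hq : q' + 1 = q) (hp : p + 1 = p') :
    ∃ (s : K.X p →ₗ[A] L.X q') (t : K.X p' →ₗ[A] L.X q),
      f.app p q h = (L.d q' q).hom ∘ₗ s + t ∘ₗ (K.d p p').hom := by
  subst h hp
  obtain rfl : q' = p + n - 1 := by lia
  exact hf

lemma nullAt_of {f : StrictMap K L n} {p : ℤ} (q q' p' : ℤ) (h : p + n = q)
    (hq : q' + 1 = q) (hp : p + 1 = p') (s : K.X p →ₗ[A] L.X q') (t : K.X p' →ₗ[A] L.X q)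
    (e : f.app p q h = (L.d q' q).hom ∘ₗ s + t ∘ₗ (K.d p p').hom) : f.NullAt p := by
  subst h hp
  obtain rfl : q' = p + n - 1 := by lia
  exact ⟨s, t, e⟩

end StrictMap

/-- An exact complex of finitely generated free modules whose dual is exact. -/
structure TotallyAcyclic (K : CochainComplex (ModuleCat.{u} A) ℤ) : Prop where
  free (i : ℤ) : Module.Free A (K.X i)
  finite (i : ℤ) : Module.Finite A (K.X i)
  exact (i : ℤ) : Function.Exact (K.d (i - 1) i).hom (K.d i (i + 1)).hom
  exact_dual (i : ℤ) :
    Function.Exact (K.d i (i + 1)).hom.dualMap (K.d (i - 1) i).hom.dualMap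

lemma CompleteResolution.totallyAcyclic {M : Type u} [AddCommGroup M] [Module A M]
    (R : CompleteResolution A M) : TotallyAcyclic R.cx :=
  ⟨R.free, R.finite, R.exact, R.exact_dual⟩

lemma d_comp_d_apply (K : CochainComplex (ModuleCat.{u} A) ℤ) (i j k : ℤ) (x : K.X i) :
    (K.d j k).hom ((K.d i j).hom x) = 0 := by
  have := K.d_comp_d i j k
  exact LinearMap.congr_fun (congrArg ModuleCat.Hom.hom this) x

namespace TotallyAcyclic

variable {K : CochainComplex (ModuleCat.{u} A) ℤ} (hK : TotallyAcyclic K)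
include hK

lemma exact' (i j k : ℤ) (hij : i + 1 = j) (hjk : j + 1 = k) :
    Function.Exact (K.d i j).hom (K.d j k).hom := by
  subst hjk
  obtain rfl : i = j - 1 := by lia
  exact hK.exact j

/-- Maps with values in cycles lift along the differential, from a projective module. -/
lemma exists_lift {N : Type*} [AddCommGroup N] [Module A N] [Module.Projective A N]
    (i j k : ℤ) (hij : i + 1 = j) (hjk : j + 1 = k) (g : N →ₗ[A] K.X j)
    (hg : ∀ x, (K.d j k).hom (g x) = 0) :
    ∃ s : N →ₗ[A] K.X i, (K.d i j).hom ∘ₗ s = g := by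
  have hr : LinearMap.range g ≤ LinearMap.range (K.d i j).hom := by
    rintro _ ⟨x, rfl⟩
    exact (hK.exact' i j k hij hjk _).1 (hg x)
  obtain ⟨s, hs⟩ := Module.projective_lifting_property (K.d i j).hom.rangeRestrict
    (g.codRestrict (LinearMap.range (K.d i j).hom) (fun x => hr ⟨x, rfl⟩))
    (LinearMap.surjective_rangeRestrict _)
  refine ⟨s, LinearMap.ext fun x => ?_⟩
  exact congrArg Subtype.val (LinearMap.congr_fun hs x)

/-- Maps to a finitely generated free module which vanish on boundaries extend along the
differential. -/
lemma exists_extend {F : Type*} [AddCommGroup F] [Module A F] [Module.Free A F]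
    [Module.Finite A F] (i j k : ℤ) (hij : i + 1 = j) (hjk : j + 1 = k) (g : K.X j →ₗ[A] F)
    (hg : ∀ x, g ((K.d i j).hom x) = 0) :
    ∃ s : K.X k →ₗ[A] F, s ∘ₗ (K.d j k).hom = g := by
  subst hjk
  obtain rfl : i = j - 1 := by lia
  let b := Module.Free.chooseBasis A F
  have h (c) : ∃ s : Module.Dual A (K.X (j + 1)), (K.d j (j + 1)).hom.dualMap s = b.coord c ∘ₗ g := by
    refine (hK.exact_dual j _).1 ?_
    ext x
    simp [hg]
  choose s hs using h
  refine ⟨∑ c, (s c).smulRight (b c), LinearMap.ext fun x => ?_⟩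
  have h' (c) : s c ((K.d j (j + 1)).hom x) = b.coord c (g x) := LinearMap.congr_fun (hs c) x
  simp only [LinearMap.comp_apply, LinearMap.sum_apply, LinearMap.smulRight_apply, h']
  exact b.sum_repr (g x)

end TotallyAcyclic

namespace StrictMap

variable {K L : CochainComplex (ModuleCat.{u} A) ℤ} {n : ℤ}

/-- If `f = ds + td` at `p`, then `f - sd` at the previous place has values in cycles, since `d(f -
sd) = (f - ds)d = tdd = 0`. It lifts along the differential of `L` because its source is projective.
-/
lemma NullAt.pred (hK : TotallyAcyclic K) (hL : TotallyAcyclic L) {f : StrictMap K L n} {p p' : ℤ}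
    (hp : p' + 1 = p) (hf : f.NullAt p) : f.NullAt p' := by
  obtain ⟨s, t, e⟩ := hf.exists (p + n) (p + n - 1) (p + 1) rfl (by lia) rfl
  have := hK.free p'
  obtain ⟨r, hr⟩ := hL.exists_lift (p + n - 2) (p + n - 1) (p + n) (by lia) (by lia)
    (f.app p' (p + n - 1) (by lia) - s ∘ₗ (K.d p' p).hom) (fun x => by
      have h1 := f.comm p' (p + n - 1) p (p + n) (by lia) rfl hp x
      rw [LinearMap.sub_apply, map_sub, h1, e]
      simp [d_comp_d_apply])
  refine nullAt_of (p + n - 1) (p + n - 2) p (by lia) (by lia) hp r s ?_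
  rw [hr]
  abel

/-- Dually, `f - dt` vanishes on boundaries. It extends along the differential of `K` because maps
from `K` to a finite free module form an exact complex; this is where exactness of the dual enters.
-/
lemma NullAt.succ (hK : TotallyAcyclic K) (hL : TotallyAcyclic L) {f : StrictMap K L n} {p p' : ℤ}
    (hp : p + 1 = p') (hf : f.NullAt p) : f.NullAt p' := by
  obtain ⟨s, t, e⟩ := hf.exists (p + n) (p + n - 1) p' rfl (by lia) hp
  have := hL.free (p' + n)
  have := hL.finite (p' + n)
  obtain ⟨r, hr⟩ := hK.exists_extend p p' (p' + 1) hp rfl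
    (f.app p' (p' + n) rfl - (L.d (p + n) (p' + n)).hom ∘ₗ t) (fun x => by
      have h1 := f.comm p (p + n) p' (p' + n) rfl rfl hp x
      rw [LinearMap.sub_apply, ← h1, e]
      simp [d_comp_d_apply])
  refine nullAt_of (p' + n) (p + n) (p' + 1) rfl (by lia) rfl t r ?_
  rw [hr]
  abel

lemma NullAt.all (hK : TotallyAcyclic K) (hL : TotallyAcyclic L) {f : StrictMap K L n} {p : ℤ}
    (hf : f.NullAt p) (q : ℤ) : f.NullAt q := by
  induction q using Int.inductionOn' (b := p) with
  | zero => exact hf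
  | succ k hk ih => exact ih.succ hK hL rfl
  | pred k hk ih => exact ih.pred hK hL (by lia)

end StrictMap

end Elementary

end SymGrowth

end

noncomputable section

open CategoryTheory

namespace SymGrowth

/-! ### Comparison maps between complete resolutions. -/

section Comparison

lemma exists_int_family {X : ℤ → Type*} (r : ∀ i j, i + 1 = j → X i → X j → Prop) (x₀ : X 0)
    (fwd : ∀ i j h x, ∃ y, r i j h x y) (bwd : ∀ i j h y, ∃ x, r i j h x y) :
    ∃ s : ∀ i, X i, s 0 = x₀ ∧ ∀ i j h, r i j h (s i) (s j) := by
  choose F hF using fwd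
  choose G hG using bwd
  let sP : ∀ n : ℕ, X n := fun n => Nat.rec (motive := fun n => X (n : ℤ)) x₀
    (fun n x => F n ((n + 1 : ℕ) : ℤ) (by simp) x) n
  let sN : ∀ n : ℕ, X (-(n : ℤ)) := fun n => Nat.rec (motive := fun n => X (-(n : ℤ))) x₀
    (fun n x => G (-((n + 1 : ℕ) : ℤ)) (-(n : ℤ)) (by lia) x) n
  let s : ∀ i, X i := fun i => match i with
    | Int.ofNat n => sP n
    | Int.negSucc n => sN (n + 1)
  refine ⟨s, rfl, fun i j h => ?_⟩
  match i, j, h with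
  | Int.ofNat n, Int.ofNat m, h =>
    obtain rfl : m = n + 1 := by have : (n : ℤ) + 1 = m := h; lia
    exact hF _ _ h _
  | Int.ofNat n, Int.negSucc m, h => exact absurd h (by simp only [Int.ofNat_eq_natCast]; lia)
  | Int.negSucc 0, Int.ofNat m, h =>
    obtain rfl : m = 0 := by have : Int.negSucc 0 + 1 = (m : ℤ) := h; lia
    exact hG _ _ h _
  | Int.negSucc (n + 1), Int.ofNat m, h =>
    exact absurd h (by simp only [Int.ofNat_eq_natCast]; lia)
  | Int.negSucc 0, Int.negSucc m, h => exact absurd h (by lia)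
  | Int.negSucc (n + 1), Int.negSucc m, h =>
    obtain rfl : n = m := by lia
    exact hG _ _ h _

variable {A : Type u} [CommRing A] {M N : Type u} [AddCommGroup M] [Module A M]
  [AddCommGroup N] [Module A N]

namespace CompleteResolution

lemma d_eq_zero_iff (R : CompleteResolution A M) (x : R.cx.X 0) :
    (R.cx.d 0 1).hom x = 0 ↔ R.proj x = 0 := by
  rw [R.fac, LinearMap.comp_apply, map_eq_zero_iff _ R.incl_injective]

lemma proj_d (R : CompleteResolution A M) (x : R.cx.X (-1)) :
    R.proj ((R.cx.d (-1) 0).hom x) = 0 := by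
  rw [← R.d_eq_zero_iff, d_comp_d_apply]

lemma exists_lift_proj (R : CompleteResolution A M) {F : Type*} [AddCommGroup F] [Module A F]
    [Module.Projective A F] (g : F →ₗ[A] M) :
    ∃ s : F →ₗ[A] R.cx.X 0, ∀ x, R.proj (s x) = g x := by
  obtain ⟨s, hs⟩ := Module.projective_lifting_property R.proj g R.proj_surjective
  exact ⟨s, fun x => LinearMap.congr_fun hs x⟩

/-- A map of modules lifts to a map of complete resolutions. -/
lemma exists_strictMap (R : CompleteResolution A M) (S : CompleteResolution A N) (φ : M →ₗ[A] N) :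
    ∃ f : StrictMap R.cx S.cx 0, ∀ x, S.proj (f.app 0 0 rfl x) = φ (R.proj x) := by
  -- The recursion runs in both directions. The condition that `dg` kills boundaries is what allows
  -- `g` both to be extended to the right and to be lifted to the left.
  let X : ℤ → Type u := fun i => {g : R.cx.X i →ₗ[A] S.cx.X i //
    ∀ x, (S.cx.d i (i + 1)).hom (g ((R.cx.d (i - 1) i).hom x)) = 0}
  let r : ∀ i j, i + 1 = j → X i → X j → Prop := fun i j _ g g' =>
    ∀ x, (S.cx.d i j).hom (g.1 x) = g'.1 ((R.cx.d i j).hom x)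
  have := R.free 0
  obtain ⟨g₀, hg₀⟩ := S.exists_lift_proj (φ ∘ₗ R.proj)
  obtain ⟨s, hs, hs'⟩ := exists_int_family (X := X) r
    ⟨g₀, fun x => by
      change (S.cx.d 0 1).hom _ = 0
      rw [d_eq_zero_iff, hg₀, LinearMap.comp_apply]
      erw [R.proj_d x]
      rw [map_zero]⟩
    (fun i j h g => by
      subst h
      have := S.free (i + 1)
      have := S.finite (i + 1)
      obtain ⟨t, ht⟩ := R.totallyAcyclic.exists_extend (i - 1) i (i + 1) (by lia) rfl
        ((S.cx.d i (i + 1)).hom ∘ₗ g.1) (fun x => g.2 x)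
      have ht' (x) : t ((R.cx.d i (i + 1)).hom x) = (S.cx.d i (i + 1)).hom (g.1 x) :=
        LinearMap.congr_fun ht x
      refine ⟨⟨t, fun x => ?_⟩, fun x => (ht' x).symm⟩
      have key (k : ℤ) (hk : k = i) (x : R.cx.X k) :
          (S.cx.d (i + 1) (i + 1 + 1)).hom (t ((R.cx.d k (i + 1)).hom x)) = 0 := by
        subst hk
        rw [ht', d_comp_d_apply]
      exact key (i + 1 - 1) (by lia) x)
    (fun i j h g => by
      have := R.free i
      obtain ⟨t, ht⟩ := S.totallyAcyclic.exists_lift i j (j + 1) h rfl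
        (g.1 ∘ₗ (R.cx.d i j).hom) (fun x => by
          obtain rfl : i = j - 1 := by lia
          exact g.2 x)
      have ht' (x) : (S.cx.d i j).hom (t x) = g.1 ((R.cx.d i j).hom x) := LinearMap.congr_fun ht x
      refine ⟨⟨t, fun x => ?_⟩, ht'⟩
      subst h
      rw [ht', d_comp_d_apply, map_zero])
  refine ⟨⟨fun p q h => (S.cx.XIsoOfEq (show p = q by lia)).hom.hom ∘ₗ (s p).1, ?_⟩, ?_⟩
  · intro p q p' q' h h' hp x
    obtain rfl : p = q := by lia
    obtain rfl : p' = q' := by lia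
    exact hs' p p' hp x
  · intro x
    have : (s 0).1 = g₀ := by rw [hs]
    refine Eq.trans ?_ (hg₀ x)
    rw [← this]
    rfl

/-- A map of complete resolutions of degree `n` is null-homotopic if its part with values in the
module which is resolved is. -/
lemma nullAt_of_proj (S : CompleteResolution A N) {K : CochainComplex (ModuleCat.{u} A) ℤ}
    (hK : TotallyAcyclic K) {n : ℤ} (f : StrictMap K S.cx n) (p p' : ℤ) (h : p + n = 0)
    (hp : p + 1 = p') (t : K.X p' →ₗ[A] N)
    (ht : ∀ x, S.proj (f.app p 0 h x) = t ((K.d p p').hom x)) (q : ℤ) : f.NullAt q := by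
  have := hK.free p'
  have := hK.free p
  -- With `t'` a lift of `t` through `proj`, the map `f - t'd` lands in the kernel of `proj`, which
  -- is the kernel of the differential, hence lifts. A homotopy at this one place propagates to all
  -- others.
  obtain ⟨t', ht'⟩ := S.exists_lift_proj t
  obtain ⟨s, hs⟩ := S.totallyAcyclic.exists_lift (-1) 0 1 rfl rfl
    (f.app p 0 h - t' ∘ₗ (K.d p p').hom) (fun x => by
      rw [d_eq_zero_iff, LinearMap.sub_apply, map_sub, ht, LinearMap.comp_apply, ht', sub_self])
  refine (StrictMap.nullAt_of (p := p) 0 (-1) p' h rfl hp s t' ?_).all hK S.totallyAcyclic q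
  rw [hs]
  abel

end CompleteResolution

end Comparison

/-! ### Duals of strict maps and of complete resolutions. -/

section Dual

variable {A : Type u} [CommRing A] {M N : Type u} [AddCommGroup M] [Module A M]
  [AddCommGroup N] [Module A N]

/-- The transpose of a strict map. -/
def StrictMap.dual {K L : CochainComplex (ModuleCat.{u} A) ℤ} {n : ℤ} (f : StrictMap K L n) :
    StrictMap (dualCx L) (dualCx K) n where
  app p q h := (f.app (1 - q) (1 - p) (by lia)).dualMap
  comm p q p' q' h h' hp x := by
    refine LinearMap.ext fun y => ?_
    exact (congrArg (show Module.Dual A (L.X (1 - p)) from x)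
      (f.comm (1 - q') (1 - p') (1 - q) (1 - p) (by lia) (by lia) (by lia) y)).symm

lemma exact_dualMap_dualMap {X Y Z : Type u} [AddCommGroup X] [Module A X] [AddCommGroup Y]
    [Module A Y] [AddCommGroup Z] [Module A Z] [Module.Free A X] [Module.Finite A X]
    [Module.Free A Y] [Module.Finite A Y] [Module.Free A Z] [Module.Finite A Z]
    {f : X →ₗ[A] Y} {g : Y →ₗ[A] Z} (h : Function.Exact f g) :
    Function.Exact f.dualMap.dualMap g.dualMap.dualMap := by
  intro y
  obtain ⟨y, rfl⟩ := (Module.evalEquiv A Y).surjective y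
  have e1 (x) : f.dualMap.dualMap (Module.evalEquiv A X x) = Module.evalEquiv A Y (f x) := rfl
  have e2 : g.dualMap.dualMap (Module.evalEquiv A Y y) = Module.evalEquiv A Z (g y) := rfl
  rw [e2, EmbeddingLike.map_eq_zero_iff, h y]
  constructor
  · rintro ⟨x, rfl⟩
    exact ⟨_, e1 x⟩
  · rintro ⟨x, hx⟩
    obtain ⟨x, rfl⟩ := (Module.evalEquiv A X).surjective x
    exact ⟨x, (Module.evalEquiv A Y).injective ((e1 x).symm.trans hx)⟩

lemma TotallyAcyclic.exact_dual' {K : CochainComplex (ModuleCat.{u} A) ℤ} (hK : TotallyAcyclic K)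
    (i j k : ℤ) (hij : i + 1 = j) (hjk : j + 1 = k) :
    Function.Exact (K.d j k).hom.dualMap (K.d i j).hom.dualMap := by
  subst hjk
  obtain rfl : i = j - 1 := by lia
  exact hK.exact_dual j

/-- The dual of a complete resolution of `M`, as a complete resolution of `M*`. -/
def CompleteResolution.dual (R : CompleteResolution A M) :
    CompleteResolution A (Module.Dual A M) where
  cx := dualCx R.cx
  free i := by
    have := R.free (1 - i)
    have := R.finite (1 - i)
    exact inferInstanceAs (Module.Free A (Module.Dual A (R.cx.X (1 - i))))
  finite i := by
    have := R.free (1 - i)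
    have := R.finite (1 - i)
    exact inferInstanceAs (Module.Finite A (Module.Dual A (R.cx.X (1 - i))))
  exact i := R.totallyAcyclic.exact_dual' (1 - (i + 1)) (1 - i) (1 - (i - 1)) (by lia) (by lia)
  exact_dual i := by
    have := R.free
    have := R.finite
    exact exact_dualMap_dualMap
      (R.totallyAcyclic.exact' (1 - (i + 1)) (1 - i) (1 - (i - 1)) (by lia) (by lia))
  proj := R.incl.dualMap
  incl := R.proj.dualMap
  proj_surjective φ := by
    -- Since `φ ∘ proj` vanishes on boundaries, dual exactness writes it as `ψ ∘ d = ψ ∘ incl ∘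
    -- proj`; cancelling the surjection `proj` shows that `ψ` restricts to `φ`.
    have := (R.totallyAcyclic.exact_dual' (-1) 0 1 rfl rfl (φ ∘ₗ R.proj)).1 (by
      refine LinearMap.ext fun x => ?_
      exact (congrArg φ (R.proj_d x)).trans (map_zero φ))
    obtain ⟨ψ, hψ⟩ := this
    refine ⟨ψ, LinearMap.ext fun y => ?_⟩
    obtain ⟨x, rfl⟩ := R.proj_surjective y
    have := LinearMap.congr_fun hψ x
    rw [LinearMap.dualMap_apply, R.fac] at this
    exact this
  incl_injective φ ψ h := by
    refine LinearMap.ext fun y => ?_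
    obtain ⟨x, rfl⟩ := R.proj_surjective y
    exact LinearMap.congr_fun h x
  fac := by
    refine LinearMap.ext fun φ => LinearMap.ext fun x => ?_
    exact congrArg (show Module.Dual A (R.cx.X 1) from φ) (LinearMap.congr_fun R.fac x)

/-- Transport of a complete resolution along an isomorphism. -/
def CompleteResolution.ofEquiv (R : CompleteResolution A M) (e : M ≃ₗ[A] N) :
    CompleteResolution A N where
  cx := R.cx
  free := R.free
  finite := R.finite
  exact := R.exact
  exact_dual := R.exact_dual
  proj := e.toLinearMap ∘ₗ R.proj
  incl := R.incl ∘ₗ e.symm.toLinearMap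
  proj_surjective := e.surjective.comp R.proj_surjective
  incl_injective := R.incl_injective.comp e.symm.injective
  fac := by
    rw [R.fac]
    ext x
    simp

/-- The square from place `0` to place `1` forces `f` to be compatible with the inclusions of `M` at
place `1` as well, and those inclusions are the projections of the duals. -/
lemma StrictMap.dual_proj {R S : CompleteResolution A M} (f : StrictMap R.cx S.cx 0)
    (hf : ∀ x, S.proj (f.app 0 0 rfl x) = R.proj x) (φ : S.dual.cx.X 0) :
    R.dual.proj (f.dual.app 0 0 rfl φ) = S.dual.proj φ := by
  refine LinearMap.ext fun y => ?_
  obtain ⟨x, rfl⟩ := R.proj_surjective y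
  have h := f.comm 0 0 1 1 rfl rfl rfl x
  rw [S.fac, R.fac, LinearMap.comp_apply, LinearMap.comp_apply, hf] at h
  exact (congrArg (show Module.Dual A (S.cx.X 1) from φ) h).symm

/-- Coordinates with respect to a basis are functionals. The basis-free form is convenient because
it behaves well under transposition. -/
lemma mem_ideal_smul_top_iff {F : Type*} [AddCommGroup F] [Module A F]
    [Module.Free A F] [Module.Finite A F] (I : Ideal A) (x : F) :
    x ∈ (I • ⊤ : Submodule A F) ↔ ∀ φ : Module.Dual A F, φ x ∈ I := by
  constructor
  · intro hx φ
    have : (I • ⊤ : Submodule A F).map φ ≤ I := by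
      rw [Submodule.map_smul'']
      exact Submodule.smul_le.2 (fun r hr n _ => Ideal.mul_mem_right _ _ hr)
    exact this ⟨x, hx, rfl⟩
  · intro h
    let b := Module.Free.chooseBasis A F
    rw [← b.sum_repr x]
    exact Submodule.sum_mem _ (fun i _ => Submodule.smul_mem_smul (h (b.coord i)) trivial)

lemma CompleteResolution.IsAlmostMinimal.dual [IsLocalRing A] {R : CompleteResolution A M}
    (hR : R.IsAlmostMinimal) : R.dual.IsAlmostMinimal := by
  rintro n hn _ ⟨φ, rfl⟩
  -- The dual differential from homological degree `n + 1` to `n` is the transpose of the one from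
  -- `-n - 1` to `-n - 2`, so the exceptional index `-1` corresponds to itself.
  have h := hR (-n - 2) (by lia)
  have := R.free
  have := R.finite
  have := R.dual.free
  have := R.dual.finite
  rw [mem_ideal_smul_top_iff]
  intro Φ
  obtain ⟨x, rfl⟩ := (Module.evalEquiv A (R.cx.X (1 - -n))).surjective Φ
  change (show Module.Dual A (R.cx.X (1 - -(n + 1))) from φ)
    ((R.cx.d (1 - -n) (1 - -(n + 1))).hom x) ∈ _
  have h' : ∀ i j, i = -(-n - 2 + 1) → j = -(-n - 2) → ∀ x, (R.cx.d i j).hom x ∈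
      (IsLocalRing.maximalIdeal A • ⊤ : Submodule A (R.cx.X j)) := by
    rintro i j rfl rfl x
    exact h ⟨x, rfl⟩
  exact (mem_ideal_smul_top_iff _ _).1 (h' _ _ (by lia) (by lia) x) φ

end Dual

end SymGrowth

end

noncomputable section

open CategoryTheory

namespace SymGrowth

/-! ### Cohomology of `Hom(K, N)` and its functoriality. -/

section Cohomology

variable {A : Type u} [CommRing A] (K : CochainComplex (ModuleCat.{u} A) ℤ)
  (N : Type u) [AddCommGroup N] [Module A N]

/-- The maps `Kⁱ ⟶ N` which vanish on boundaries. -/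
def cocycles (i : ℤ) : Submodule A (K.X i →ₗ[A] N) :=
  LinearMap.ker (LinearMap.lcomp A N (K.d (i - 1) i).hom)

/-- The maps `Kⁱ ⟶ N` which factor through the differential. -/
def coboundaries (i : ℤ) : Submodule A (K.X i →ₗ[A] N) :=
  LinearMap.range (LinearMap.lcomp A N (K.d i (i + 1)).hom)

/-- The cohomology of `Hom(K, N)` at the place `Kⁱ`. -/
def Coh (i : ℤ) : Type u :=
  cocycles K N i ⧸ (coboundaries K N i).comap (cocycles K N i).subtype

instance (i : ℤ) : AddCommGroup (Coh K N i) :=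
  inferInstanceAs (AddCommGroup
    (cocycles K N i ⧸ (coboundaries K N i).comap (cocycles K N i).subtype))

instance (i : ℤ) : Module A (Coh K N i) :=
  inferInstanceAs (Module A
    (cocycles K N i ⧸ (coboundaries K N i).comap (cocycles K N i).subtype))

variable {K N}

lemma mem_cocycles (i j : ℤ) (h : j + 1 = i) (a : K.X i →ₗ[A] N) :
    a ∈ cocycles K N i ↔ ∀ x, a ((K.d j i).hom x) = 0 := by
  obtain rfl : j = i - 1 := by lia
  exact LinearMap.ext_iff

namespace Coh

/-- The class of a cocycle. -/
def mk (i : ℤ) : cocycles K N i →ₗ[A] Coh K N i :=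
  Submodule.mkQ ((coboundaries K N i).comap (cocycles K N i).subtype)

lemma mk_surjective (i : ℤ) : Function.Surjective (mk (K := K) (N := N) i) :=
  Submodule.mkQ_surjective ((coboundaries K N i).comap (cocycles K N i).subtype)

lemma mk_eq_zero_iff (i j : ℤ) (h : i + 1 = j) (a : cocycles K N i) :
    mk i a = 0 ↔ ∃ t : K.X j →ₗ[A] N, ∀ x, a.1 x = t ((K.d i j).hom x) := by
  subst h
  refine (Submodule.Quotient.mk_eq_zero _).trans ?_
  exact exists_congr fun t => eq_comm.trans LinearMap.ext_iff

variable {N' : Type u} [AddCommGroup N'] [Module A N'] {L : CochainComplex (ModuleCat.{u} A) ℤ}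

/-- Functoriality in the coefficients. -/
def map (g : N →ₗ[A] N') (i : ℤ) : Coh K N i →ₗ[A] Coh K N' i :=
  Submodule.mapQ _ _ (((LinearMap.compRight A g).comp (cocycles K N i).subtype).codRestrict
      (cocycles K N' i) (fun a => (mem_cocycles i (i - 1) (by lia) _).2 fun x => by
        have := (mem_cocycles i (i - 1) (by lia) _).1 a.2 x
        simp [this])) (by
    rintro a ⟨t, ht⟩
    refine ⟨g ∘ₗ t, LinearMap.ext fun x => ?_⟩
    exact congrArg g (LinearMap.congr_fun ht x))

lemma map_mk (g : N →ₗ[A] N') (i : ℤ) (a : cocycles K N i) (b : cocycles K N' i)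
    (h : ∀ x, b.1 x = g (a.1 x)) : map g i (mk i a) = mk i b :=
  congrArg (mk i) (Subtype.ext (LinearMap.ext fun x => (h x).symm))

/-- The map induced by a strict map of complexes. -/
def precomp {n : ℤ} (f : StrictMap K L n) (p q : ℤ) (h : p + n = q) :
    Coh L N q →ₗ[A] Coh K N p :=
  Submodule.mapQ _ _ (((LinearMap.lcomp A N (f.app p q h)).comp
      (cocycles L N q).subtype).codRestrict (cocycles K N p)
      (fun a => (mem_cocycles p (p - 1) (by lia) _).2 fun x => by
        have := (mem_cocycles q (q - 1) (by lia) _).1 a.2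
          (f.app (p - 1) (q - 1) (by lia) x)
        rwa [f.comm (p - 1) (q - 1) p q (by lia) h (by lia)] at this)) (by
    rintro a ⟨t, ht⟩
    refine ⟨t ∘ₗ f.app (p + 1) (q + 1) (by lia), LinearMap.ext fun x => ?_⟩
    have := LinearMap.congr_fun ht (f.app p q h x)
    refine Eq.trans ?_ this
    exact congrArg t (f.comm p q (p + 1) (q + 1) h (by lia) rfl x).symm)

lemma precomp_mk {n : ℤ} (f : StrictMap K L n) (p q : ℤ) (h : p + n = q) (a : cocycles L N q)
    (b : cocycles K N p) (hb : ∀ x, b.1 x = a.1 (f.app p q h x)) :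
    precomp f p q h (mk q a) = mk p b :=
  congrArg (mk p) (Subtype.ext (LinearMap.ext fun x => (hb x).symm))

lemma precomp_mk' {n : ℤ} (f : StrictMap K L n) (p q : ℤ) (h : p + n = q) (a : cocycles L N q) :
    ∃ b : cocycles K N p, (∀ x, b.1 x = a.1 (f.app p q h x)) ∧
      precomp f p q h (mk q a) = mk p b :=
  ⟨_, fun _ => rfl, rfl⟩

lemma map_mk' (g : N →ₗ[A] N') (i : ℤ) (a : cocycles K N i) :
    ∃ b : cocycles K N' i, (∀ x, b.1 x = g (a.1 x)) ∧ map g i (mk i a) = mk i b :=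
  ⟨_, fun _ => rfl, rfl⟩

lemma map_precomp {n : ℤ} (f : StrictMap K L n) (p q : ℤ) (h : p + n = q) (g : N →ₗ[A] N')
    (x : Coh L N q) : map g p (precomp f p q h x) = precomp f p q h (map g q x) := by
  obtain ⟨a, rfl⟩ := mk_surjective q x
  rfl

lemma precomp_precomp {L' : CochainComplex (ModuleCat.{u} A) ℤ} {n m k : ℤ} (f : StrictMap K L n)
    (g : StrictMap L L' m) (hk : n + m = k)
    (p q r : ℤ) (h : p + n = q) (h' : q + m = r) (h'' : p + k = r) (x : Coh L' N r) :
    precomp f p q h (precomp g q r h' x) = precomp (f.comp g k hk) p r h'' x := by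
  subst h
  obtain ⟨a, rfl⟩ := mk_surjective r x
  rfl

lemma precomp_add {n : ℤ} (f g : StrictMap K L n) (p q : ℤ) (h : p + n = q) (x : Coh L N q) :
    precomp (f + g) p q h x = precomp f p q h x + precomp g p q h x := by
  obtain ⟨a, rfl⟩ := mk_surjective q x
  obtain ⟨b, hb, e⟩ := precomp_mk' f p q h a
  obtain ⟨b', hb', e'⟩ := precomp_mk' g p q h a
  rw [e, e', ← map_add]
  exact precomp_mk _ _ _ _ _ _ fun x => by simp [hb, hb']

lemma precomp_smul {n : ℤ} (r : A) (f : StrictMap K L n) (p q : ℤ) (h : p + n = q)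
    (x : Coh L N q) : precomp (r • f) p q h x = r • precomp f p q h x := by
  obtain ⟨a, rfl⟩ := mk_surjective q x
  obtain ⟨b, hb, e⟩ := precomp_mk' f p q h a
  rw [e, ← map_smul]
  exact precomp_mk _ _ _ _ _ _ fun x => by simp [hb]

lemma precomp_zero {n : ℤ} (p q : ℤ) (h : p + n = q) (x : Coh L N q) :
    precomp (0 : StrictMap K L n) p q h x = 0 := by
  obtain ⟨a, rfl⟩ := mk_surjective q x
  rw [← map_zero (mk p)]
  exact precomp_mk _ _ _ _ _ _ fun x => by simp

lemma precomp_id (p : ℤ) (x : Coh K N p) :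
    precomp (StrictMap.id K) p p (by lia) x = x := by
  obtain ⟨a, rfl⟩ := mk_surjective p x
  exact precomp_mk _ _ _ _ _ _ fun x => rfl

/-- A map which is null-homotopic at one place induces zero there. -/
lemma precomp_eq_zero {n : ℤ} {f : StrictMap K L n} {p : ℤ} (hf : f.NullAt p) (q : ℤ)
    (h : p + n = q) (x : Coh L N q) : precomp f p q h x = 0 := by
  obtain ⟨a, rfl⟩ := mk_surjective q x
  obtain ⟨b, hb, e⟩ := precomp_mk' f p q h a
  obtain ⟨s, t, hst⟩ := hf.exists q (q - 1) (p + 1) h (by lia) rfl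
  rw [e, mk_eq_zero_iff p (p + 1) rfl]
  refine ⟨a.1 ∘ₗ t, fun x => ?_⟩
  rw [hb, hst]
  have := (mem_cocycles q (q - 1) (by lia) _).1 a.2 (s x)
  simp [this]

/-- Maps which are homotopic at one place induce the same map there. -/
lemma precomp_congr {n : ℤ} {f g : StrictMap K L n} {p : ℤ} (hf : (f + (-1 : A) • g).NullAt p)
    (q : ℤ) (h : p + n = q) (x : Coh L N q) : precomp f p q h x = precomp g p q h x := by
  have := precomp_eq_zero hf q h x
  rw [precomp_add, precomp_smul, neg_smul, one_smul, ← sub_eq_add_neg, sub_eq_zero] at this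
  exact this

lemma map_id (i : ℤ) (x : Coh K N i) : map LinearMap.id i x = x := by
  obtain ⟨a, rfl⟩ := mk_surjective i x
  rfl

lemma map_comp {N'' : Type u} [AddCommGroup N''] [Module A N''] (g : N →ₗ[A] N')
    (g' : N' →ₗ[A] N'') (i : ℤ) (x : Coh K N i) : map g' i (map g i x) = map (g' ∘ₗ g) i x := by
  obtain ⟨a, rfl⟩ := mk_surjective i x
  rfl

lemma map_smul_id (r : A) (i : ℤ) (x : Coh K N i) :
    map (r • LinearMap.id) i x = r • x := by
  obtain ⟨a, rfl⟩ := mk_surjective i x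
  rw [← _root_.map_smul]
  exact map_mk _ _ _ _ fun x => rfl

/-- Half-exactness in the coefficients. -/
lemma exists_map_eq (hK : ∀ i, Module.Free A (K.X i)) {N'' : Type u} [AddCommGroup N'']
    [Module A N''] (g : N →ₗ[A] N') (g' : N' →ₗ[A] N'') (hg : Function.Injective g)
    (hgg' : Function.Exact g g') (hg' : Function.Surjective g') (i : ℤ) (x : Coh K N' i)
    (hx : map g' i x = 0) : ∃ y : Coh K N i, map g i y = x := by
  obtain ⟨a, rfl⟩ := mk_surjective i x
  obtain ⟨b, hb, e⟩ := map_mk' g' i a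
  rw [e, mk_eq_zero_iff i (i + 1) rfl] at hx
  obtain ⟨t, ht⟩ := hx
  -- The image of `a` in `N''` is the coboundary of `t`. Lifting `t` to `t'` by freeness and
  -- subtracting `t'd` changes `a` within its class into a cocycle with values in `N`.
  have := hK (i + 1)
  obtain ⟨t', ht'⟩ := Module.projective_lifting_property g' t hg'
  let c : K.X i →ₗ[A] N' := a.1 - t' ∘ₗ (K.d i (i + 1)).hom
  have hc (x) : ∃ y, g y = c x := by
    refine (hgg' _).1 ?_
    have h1 : g' (t' ((K.d i (i + 1)).hom x)) = t ((K.d i (i + 1)).hom x) :=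
      LinearMap.congr_fun ht' _
    simp only [c, LinearMap.sub_apply, map_sub, LinearMap.comp_apply]
    rw [h1, ← ht, hb, sub_self]
  let e : N ≃ₗ[A] LinearMap.range g := LinearEquiv.ofInjective g hg
  let y : K.X i →ₗ[A] N := e.symm.toLinearMap ∘ₗ c.codRestrict (LinearMap.range g) hc
  have hy (x) : g (y x) = c x := congrArg Subtype.val (e.apply_symm_apply ⟨c x, hc x⟩)
  have hyc : y ∈ cocycles K N i := by
    refine (mem_cocycles i (i - 1) (by lia) _).2 fun x => hg ?_
    rw [hy, map_zero]
    have := (mem_cocycles i (i - 1) (by lia) _).1 a.2 x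
    simp [c, this, d_comp_d_apply]
  refine ⟨mk i ⟨y, hyc⟩, ?_⟩
  obtain ⟨z, hz, e'⟩ := map_mk' g i ⟨y, hyc⟩
  rw [e', ← sub_eq_zero, ← map_sub, mk_eq_zero_iff i (i + 1) rfl]
  refine ⟨-t', fun x => ?_⟩
  simp [hz, hy, c]

instance [IsNoetherianRing A] [Module.Finite A N] (i : ℤ) [Module.Finite A (K.X i)] :
    Module.Finite A (Coh K N i) := by
  have : IsNoetherian A (K.X i →ₗ[A] N) := by infer_instance
  exact inferInstanceAs (Module.Finite A
    (cocycles K N i ⧸ (coboundaries K N i).comap (cocycles K N i).subtype))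

end Coh

end Cohomology

end SymGrowth

end

noncomputable section

open CategoryTheory

namespace SymGrowth

/-! ### Total cohomology as a graded module over a polynomial ring. -/

section Total

open scoped DirectSum IsMulCommutative

variable {A : Type u} [CommRing A]

/-- Finitely many strict endomorphisms of positive degree, which commute up to homotopy. -/
structure CommSys (K : CochainComplex (ModuleCat.{u} A) ℤ) (ι : Type) where
  /-- The degrees of the endomorphisms. -/
  deg : ι → ℕ
  deg_pos (k : ι) : 0 < deg k
  /-- The endomorphisms. -/
  f (k : ι) : StrictMap K K (deg k)
  comm (k l : ι) (n : ℤ) (h : (deg k : ℤ) + deg l = n) (h' : (deg l : ℤ) + deg k = n) (p : ℤ) :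
    ((f k).comp (f l) n h + (-1 : A) • (f l).comp (f k) n h').NullAt p

variable {K : CochainComplex (ModuleCat.{u} A) ℤ} {ι : Type} (S : CommSys K ι)
  (N : Type u) [AddCommGroup N] [Module A N]

/-- The total cohomology of `Hom(K, N)`. -/
@[nolint unusedArguments]
def Tot (_S : CommSys K ι) (N : Type u) [AddCommGroup N] [Module A N] : Type u :=
  ⨁ i : ℤ, Coh K N i

namespace Tot

instance : AddCommGroup (Tot S N) := inferInstanceAs (AddCommGroup (⨁ i : ℤ, Coh K N i))

instance : Module A (Tot S N) := inferInstanceAs (Module A (⨁ i : ℤ, Coh K N i))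

/-- The inclusion of a homogeneous component. -/
def of (i : ℤ) : Coh K N i →ₗ[A] Tot S N := DirectSum.lof A ℤ (fun i => Coh K N i) i

/-- The projection to a homogeneous component. -/
def coeff (i : ℤ) : Tot S N →ₗ[A] Coh K N i := DirectSum.component A ℤ (fun i => Coh K N i) i

variable {S N}

lemma coeff_of_self (i : ℤ) (x : Coh K N i) : coeff S N i (of S N i x) = x :=
  DirectSum.component.lof_self A (ι := ℤ) (M := fun i => Coh K N i) i x

lemma coeff_of_ne (i j : ℤ) (h : i ≠ j) (x : Coh K N i) : coeff S N j (of S N i x) = 0 :=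
  DirectSum.of_eq_of_ne (β := fun i => Coh K N i) i j x h.symm

lemma ext {x y : Tot S N} (h : ∀ i, coeff S N i x = coeff S N i y) : x = y :=
  DirectSum.ext_component A (M := fun i => Coh K N i) h

lemma induction {motive : Tot S N → Prop} (x : Tot S N) (zero : motive 0)
    (of : ∀ i x, motive (of S N i x)) (add : ∀ x y, motive x → motive y → motive (x + y)) :
    motive x :=
  DirectSum.induction_on x zero of add

lemma mem_of_of_mem {W : Submodule A (Tot S N)} (x : Tot S N)
    (h : ∀ i, of S N i (coeff S N i x) ∈ W) : x ∈ W := by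
  classical
  have : x = ∑ i ∈ DFinsupp.support (show Π₀ i, Coh K N i from x), of S N i (coeff S N i x) :=
    (DirectSum.sum_support_of (show ⨁ i, Coh K N i from x)).symm
  rw [this]
  exact Submodule.sum_mem _ fun i _ => h i

variable (S N) in
/-- The operator on the total cohomology which is induced by an endomorphism. -/
def op (k : ι) : Module.End A (Tot S N) :=
  DirectSum.toModule A ℤ _ (fun q => of S N (q - S.deg k) ∘ₗ
    Coh.precomp (S.f k) (q - S.deg k) q (by lia))

lemma op_of (k : ι) (p q : ℤ) (h : p + S.deg k = q) (x : Coh K N q) :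
    op S N k (of S N q x) = of S N p (Coh.precomp (S.f k) p q h x) := by
  obtain rfl : p = q - S.deg k := by lia
  exact DirectSum.toModule_lof A (ι := ℤ) (M := fun i => Coh K N i) q x

lemma coeff_op (k : ι) (p q : ℤ) (h : p + S.deg k = q) (x : Tot S N) :
    coeff S N p (op S N k x) = Coh.precomp (S.f k) p q h (coeff S N q x) := by
  induction x using Tot.induction with
  | zero => simp
  | add x y hx hy => simp only [map_add, hx, hy]
  | of i x =>
    rw [op_of k (i - S.deg k) i (by lia)]
    by_cases hi : i = q
    · subst hi
      obtain rfl : p = i - S.deg k := by lia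
      rw [coeff_of_self, coeff_of_self]
    · rw [coeff_of_ne _ _ hi, coeff_of_ne _ _ (by lia), map_zero]

lemma op_comm (k l : ι) : op S N k * op S N l = op S N l * op S N k := by
  refine LinearMap.ext fun x => ext fun i => ?_
  change coeff S N i (op S N k (op S N l x)) = coeff S N i (op S N l (op S N k x))
  rw [coeff_op k i _ rfl, coeff_op l i _ rfl, coeff_op l (i + S.deg k) (i + S.deg k + S.deg l) rfl,
    coeff_op k (i + S.deg l) (i + S.deg k + S.deg l) (by lia),
    Coh.precomp_precomp _ _ rfl _ _ _ _ _ (by lia),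
    Coh.precomp_precomp _ _ (add_comm _ _) _ _ _ _ _ (by lia)]
  exact Coh.precomp_congr (S.comm k l _ _ _ _) _ _ _

variable (S N) in
lemma isMulCommutative_adjoin_op :
    IsMulCommutative (Algebra.adjoin A (Set.range (op S N))) :=
  Algebra.isMulCommutative_adjoin A (by
    rintro _ ⟨k, rfl⟩ _ ⟨l, rfl⟩
    exact op_comm k l)

variable (S N) in
/-- The action of the polynomial ring on the total cohomology. -/
def act : MvPolynomial ι A →ₐ[A] Module.End A (Tot S N) :=
  -- Evaluation of polynomials needs a commutative target, so it takes place in the subalgebra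
  -- generated by the operators, which commute because the endomorphisms do up to homotopy.
  haveI := isMulCommutative_adjoin_op S N
  (Algebra.adjoin A (Set.range (op S N))).val.comp
    (MvPolynomial.aeval fun k => ⟨op S N k, Algebra.subset_adjoin ⟨k, rfl⟩⟩)

lemma act_X (k : ι) : act S N (MvPolynomial.X k) = op S N k := by
  have := isMulCommutative_adjoin_op S N
  exact congrArg Subtype.val (MvPolynomial.aeval_X
    (fun k => (⟨op S N k, Algebra.subset_adjoin ⟨k, rfl⟩⟩ :
      Algebra.adjoin A (Set.range (op S N)))) k)

instance : Module (MvPolynomial ι A) (Tot S N) := Module.compHom _ (act S N).toRingHom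

lemma smul_def (p : MvPolynomial ι A) (x : Tot S N) : p • x = act S N p x := rfl

lemma X_smul (k : ι) (x : Tot S N) : (MvPolynomial.X k : MvPolynomial ι A) • x = op S N k x := by
  rw [smul_def, act_X]

instance : IsScalarTower A (MvPolynomial ι A) (Tot S N) where
  smul_assoc a p x := by
    rw [smul_def, smul_def, map_smul]
    rfl

lemma C_smul (a : A) (x : Tot S N) : (MvPolynomial.C a : MvPolynomial ι A) • x = a • x := by
  rw [← mul_one (MvPolynomial.C a), ← MvPolynomial.smul_eq_C_mul, smul_assoc, one_smul]

/-- An `A`-submodule which is stable under the endomorphisms is a submodule over the polynomial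
ring. -/
def ofStable (W : Submodule A (Tot S N)) (hW : ∀ k, ∀ x ∈ W, op S N k x ∈ W) :
    Submodule (MvPolynomial ι A) (Tot S N) where
  carrier := W
  zero_mem' := W.zero_mem
  add_mem' := W.add_mem
  smul_mem' p x hx := by
    change x ∈ W at hx
    change p • x ∈ W
    induction p using MvPolynomial.induction_on generalizing x with
    | C a => rw [C_smul]; exact W.smul_mem _ hx
    | add p q hp hq => rw [add_smul]; exact W.add_mem (hp x hx) (hq x hx)
    | mul_X p k hp => rw [mul_smul, X_smul]; exact hp _ (hW k x hx)

variable {N' : Type u} [AddCommGroup N'] [Module A N']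

lemma map_smul_of_op (g : Tot S N →ₗ[A] Tot S N')
    (hg : ∀ k x, g (op S N k x) = op S N' k (g x)) (p : MvPolynomial ι A) (x : Tot S N) :
    g (p • x) = p • g x := by
  induction p using MvPolynomial.induction_on generalizing x with
  | C a => rw [C_smul, C_smul, map_smul]
  | add p q hp hq => rw [add_smul, add_smul, map_add, hp, hq]
  | mul_X p k hp => rw [mul_smul, mul_smul, hp, X_smul, X_smul, hg]

variable (S) in
/-- Functoriality in the coefficients, over the base ring. -/
def mapA (g : N →ₗ[A] N') : Tot S N →ₗ[A] Tot S N' :=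
  DirectSum.toModule A ℤ _ (fun i => of S N' i ∘ₗ Coh.map g i)

lemma mapA_of (g : N →ₗ[A] N') (i : ℤ) (x : Coh K N i) :
    mapA S g (of S N i x) = of S N' i (Coh.map g i x) :=
  DirectSum.toModule_lof A (ι := ℤ) (M := fun i => Coh K N i) i x

lemma coeff_mapA (g : N →ₗ[A] N') (i : ℤ) (x : Tot S N) :
    coeff S N' i (mapA S g x) = Coh.map g i (coeff S N i x) := by
  induction x using Tot.induction with
  | zero => simp
  | add x y hx hy => simp only [map_add, hx, hy]
  | of j x =>
    rw [mapA_of]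
    by_cases hi : j = i
    · subst hi
      rw [coeff_of_self, coeff_of_self]
    · rw [coeff_of_ne _ _ hi, coeff_of_ne _ _ hi, map_zero]

variable (S) in
/-- Functoriality in the coefficients. -/
def map (g : N →ₗ[A] N') : Tot S N →ₗ[MvPolynomial ι A] Tot S N' where
  toFun := mapA S g
  map_add' := map_add _
  map_smul' := map_smul_of_op (mapA S g) (fun k x => ext fun i => by
    rw [coeff_mapA, coeff_op k i _ rfl, coeff_op k i _ rfl, coeff_mapA, Coh.map_precomp])

lemma coeff_map (g : N →ₗ[A] N') (i : ℤ) (x : Tot S N) :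
    coeff S N' i (map S g x) = Coh.map g i (coeff S N i x) := coeff_mapA g i x

variable (S N) in
/-- The part of the total cohomology at the places `Kⁱ`, `i ≤ 0`. -/
def nonpos : Submodule (MvPolynomial ι A) (Tot S N) :=
  ofStable (⨅ i : Set.Ioi (0 : ℤ), LinearMap.ker (coeff S N i)) (fun k x hx => by
    simp only [Submodule.mem_iInf, LinearMap.mem_ker, Subtype.forall, Set.mem_Ioi] at hx ⊢
    intro i hi
    rw [coeff_op k i _ rfl, hx _ (by lia), map_zero])

lemma mem_nonpos (x : Tot S N) : x ∈ nonpos S N ↔ ∀ i > 0, coeff S N i x = 0 := by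
  change x ∈ (⨅ i : Set.Ioi (0 : ℤ), LinearMap.ker (coeff S N i)) ↔ _
  simp

lemma of_mem_nonpos (i : ℤ) (hi : i ≤ 0) (x : Coh K N i) : of S N i x ∈ nonpos S N := by
  rw [mem_nonpos]
  intro j hj
  rw [coeff_of_ne _ _ (by lia)]

variable (S) in
/-- Functoriality of the part in nonpositive places. -/
def mapNonpos (g : N →ₗ[A] N') : nonpos S N →ₗ[MvPolynomial ι A] nonpos S N' :=
  (map S g).restrict (fun x hx => by
    rw [mem_nonpos] at hx ⊢
    intro i hi
    rw [coeff_map, hx i hi, map_zero])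

lemma mapNonpos_coe (g : N →ₗ[A] N') (x : nonpos S N) : (mapNonpos S g x : Tot S N') = map S g x :=
  rfl

lemma exists_map_eq (hK : ∀ i, Module.Free A (K.X i)) {N'' : Type u} [AddCommGroup N'']
    [Module A N''] (g : N →ₗ[A] N') (g' : N' →ₗ[A] N'') (hg : Function.Injective g)
    (hgg' : Function.Exact g g') (hg' : Function.Surjective g') (x : nonpos S N')
    (hx : mapNonpos S g' x = 0) : ∃ y : nonpos S N, mapNonpos S g y = x := by
  suffices h : x.1 ∈ ((nonpos S N).map (map S g)).restrictScalars A by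
    obtain ⟨y, hy, e⟩ := h
    exact ⟨⟨y, hy⟩, Subtype.ext e⟩
  refine mem_of_of_mem _ fun i => ?_
  by_cases hi : i ≤ 0
  · have h : Coh.map g' i (coeff S N' i x.1) = 0 := by
      rw [← coeff_map, ← mapNonpos_coe, hx]
      exact map_zero _
    obtain ⟨y, hy⟩ := Coh.exists_map_eq hK g g' hg hgg' hg' i _ h
    refine ⟨of S N i y, of_mem_nonpos i hi y, ?_⟩
    exact (mapA_of g i y).trans (by rw [hy])
  · rw [(mem_nonpos _).1 x.2 i (by lia), map_zero]
    exact Submodule.zero_mem _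

variable (S N) in
/-- The submodule generated by the components at the places `Kⁱ`, `-m ≤ i ≤ 0`. -/
def gen (m : ℕ) : Submodule (MvPolynomial ι A) (Tot S N) :=
  Submodule.span _ {x | ∃ i : ℤ, -m ≤ i ∧ i ≤ 0 ∧ ∃ y, x = of S N i y}

lemma gen_le_nonpos (m : ℕ) : gen S N m ≤ nonpos S N := by
  refine Submodule.span_le.2 ?_
  rintro _ ⟨i, _, hi, y, rfl⟩
  exact of_mem_nonpos i hi y

lemma gen_mono {m m' : ℕ} (h : m ≤ m') : gen S N m ≤ gen S N m' := by
  refine Submodule.span_mono ?_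
  rintro _ ⟨i, hi, hi', y, rfl⟩
  exact ⟨i, by lia, hi', y, rfl⟩

/-- A submodule generated by homogeneous elements is graded: the elements all of whose components
lie in `gen` form a stable submodule containing the generators. -/
lemma of_coeff_mem_gen (m : ℕ) (x : Tot S N) (hx : x ∈ gen S N m) (i : ℤ) :
    of S N i (coeff S N i x) ∈ gen S N m := by
  let W : Submodule A (Tot S N) :=
    ⨅ i, ((gen S N m).restrictScalars A).comap (of S N i ∘ₗ coeff S N i)
  have hW (x : Tot S N) : x ∈ W ↔ ∀ i, of S N i (coeff S N i x) ∈ gen S N m := by simp [W]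
  have h : gen S N m ≤ ofStable W (fun k x hx => by
      rw [hW] at hx ⊢
      intro i
      rw [coeff_op k i _ rfl, ← op_of, ← X_smul]
      exact Submodule.smul_mem _ _ (hx _)) := by
    refine Submodule.span_le.2 ?_
    rintro _ ⟨j, hj, hj', y, rfl⟩
    refine (hW _).2 fun i => ?_
    by_cases hi : j = i
    · subst hi
      rw [coeff_of_self]
      exact Submodule.subset_span ⟨j, hj, hj', y, rfl⟩
    · rw [coeff_of_ne _ _ hi, map_zero]
      exact Submodule.zero_mem _
  exact (hW x).1 (h hx) i

lemma gen_fg [IsNoetherianRing A] [Module.Finite A N] [∀ i, Module.Finite A (K.X i)] (m : ℕ) :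
    (gen S N m).FG := by
  have h (i : ℤ) : (Submodule.span (MvPolynomial ι A) (Set.range (of S N i))).FG := by
    obtain ⟨s, hs⟩ := (inferInstance : Module.Finite A (Coh K N i)).fg_top
    classical
    refine ⟨s.image (of S N i), le_antisymm (Submodule.span_mono (by simp)) ?_⟩
    refine Submodule.span_le.2 ?_
    rintro _ ⟨y, rfl⟩
    have : y ∈ Submodule.span A (s : Set (Coh K N i)) := hs ▸ trivial
    have h' := Submodule.mem_map_of_mem (f := of S N i) this
    rw [Submodule.map_span] at h'
    have := Submodule.span_le_restrictScalars A (MvPolynomial ι A) _ h'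
    simpa using this
  have : gen S N m = ⨆ i ∈ Finset.Icc (-(m : ℤ)) 0,
      Submodule.span (MvPolynomial ι A) (Set.range (of S N i)) := by
    refine le_antisymm (Submodule.span_le.2 ?_) (iSup₂_le fun i hi => Submodule.span_mono ?_)
    · rintro _ ⟨i, hi, hi', y, rfl⟩
      exact Submodule.mem_iSup_of_mem i (Submodule.mem_iSup_of_mem (by simp [hi, hi'])
        (Submodule.subset_span ⟨y, rfl⟩))
    · rintro _ ⟨y, rfl⟩
      rw [Finset.mem_Icc] at hi
      exact ⟨i, hi.1, hi.2, y, rfl⟩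
  rw [this]
  exact Submodule.fg_biSup _ _ fun i _ => h i

end Tot

end Total

end SymGrowth

end

noncomputable section

open CategoryTheory

namespace SymGrowth

/-! ### Dévissage of finitely generated modules over a Noetherian local ring. -/

section Devissage

variable {A : Type u} [CommRing A] [IsNoetherianRing A] [IsLocalRing A]

open IsLocalRing

/-- Such a module is a quotient of a finite power of the residue field, which is Artinian. -/
lemma isFiniteLength_of_maximalIdeal_smul_eq_zero (N : Type u) [AddCommGroup N] [Module A N]
    [Module.Finite A N] (h : ∀ a ∈ maximalIdeal A, ∀ x : N, a • x = 0) : IsFiniteLength A N := by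
  rw [isFiniteLength_iff_isNoetherian_isArtinian]
  refine ⟨inferInstance, ?_⟩
  obtain ⟨n, f, hf⟩ := Module.Finite.exists_fin' A N
  have : IsSimpleModule A (A ⧸ maximalIdeal A) :=
    isSimpleModule_iff_isCoatom.2 (maximalIdeal.isMaximal A).out
  let g (i : Fin n) : (A ⧸ maximalIdeal A) →ₗ[A] N :=
    (maximalIdeal A).liftQ (LinearMap.toSpanSingleton A N (f (Pi.single i 1)))
      (fun a ha => by simpa using h a ha _)
  let G : (Fin n → A ⧸ maximalIdeal A) →ₗ[A] N := LinearMap.lsum A _ A g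
  refine isArtinian_of_surjective _ G fun y => ?_
  obtain ⟨x, rfl⟩ := hf y
  refine ⟨fun i => Submodule.Quotient.mk (x i), ?_⟩
  have e : x = ∑ i, x i • Pi.single i (1 : A) := by
    ext j
    simp [Finset.sum_apply, Pi.single_apply]
  conv_rhs => rw [e]
  simp only [G, LinearMap.lsum_apply, LinearMap.sum_apply, LinearMap.comp_apply, map_sum,
    LinearMap.proj_apply, map_smul]
  rfl

/-- Dévissage of the finitely generated modules over a Noetherian local ring. -/
theorem devissage (Q : ∀ (N : Type u) [AddCommGroup N] [Module A N], Prop)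
    (zero : ∀ (N : Type u) [AddCommGroup N] [Module A N] [Subsingleton N], Q N)
    (equiv : ∀ (N N' : Type u) [AddCommGroup N] [Module A N] [AddCommGroup N'] [Module A N']
      (_ : N ≃ₗ[A] N'), Q N → Q N')
    (residue : Q (A ⧸ maximalIdeal A))
    (ext : ∀ (N : Type u) [AddCommGroup N] [Module A N] [Module.Finite A N] (N' : Submodule A N),
      Q N' → Q (N ⧸ N') → Q N)
    (regular : ∀ (N : Type u) [AddCommGroup N] [Module A N] [Module.Finite A N],
      ∀ y ∈ maximalIdeal A, (∀ x : N, y • x = 0 → x = 0) →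
        Q (N ⧸ LinearMap.range (y • LinearMap.id : N →ₗ[A] N)) → Q N)
    (N : Type u) [AddCommGroup N] [Module A N] [Module.Finite A N] : Q N := by
  -- Noetherian induction on an ideal `I` annihilating the module, from large ideals down to `⊥`.
  suffices h : ∀ (I : Ideal A) (N : Type u) [AddCommGroup N] [Module A N] [Module.Finite A N],
      (∀ a ∈ I, ∀ x : N, a • x = 0) → Q N from h ⊥ N (by simp)
  intro I
  induction I using WellFoundedGT.induction with
  | ind I ih =>
  have ih' (y : A) (hy : y ∉ I) (N : Type u) [AddCommGroup N] [Module A N] [Module.Finite A N]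
      (h : ∀ a ∈ I, ∀ x : N, a • x = 0) (h' : ∀ x : N, y • x = 0) : Q N := by
    refine ih (I ⊔ Ideal.span {y}) (lt_of_le_of_ne le_sup_left fun e => hy ?_) N ?_
    · rw [e]
      exact Ideal.mem_sup_right (Ideal.mem_span_singleton_self y)
    · intro a ha x
      obtain ⟨b, hb, c, hc, rfl⟩ := Submodule.mem_sup.1 ha
      obtain ⟨d, rfl⟩ := Ideal.mem_span_singleton'.1 hc
      rw [add_smul, h b hb, mul_smul, h', smul_zero, add_zero]
  intro N _ _ _ hN
  have hsub (N' : Submodule A N) : ∀ a ∈ I, ∀ x : N', a • x = 0 := fun a ha x =>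
    Subtype.ext (hN a ha x)
  have hquot (N' : Submodule A N) : ∀ a ∈ I, ∀ x : N ⧸ N', a • x = 0 := fun a ha x => by
    obtain ⟨x, rfl⟩ := N'.mkQ_surjective x
    rw [← map_smul, hN a ha, map_zero]
  by_cases hI : maximalIdeal A ≤ I
  · have hfl := isFiniteLength_of_maximalIdeal_smul_eq_zero N fun a ha => hN a (hI ha)
    clear hsub hquot
    induction hfl with
    | of_subsingleton => exact zero _
    | @of_simple_quotient M _ _ N hs hfin hQ =>
      have := (isFiniteLength_iff_isNoetherian_isArtinian.1 (hfin.of_simple_quotient)).1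
      refine ext M N (hQ fun a ha x => Subtype.ext (hN a ha x)) ?_
      obtain ⟨J, hJ, ⟨e⟩⟩ := isSimpleModule_iff_quot_maximal.1 hs
      obtain rfl := IsLocalRing.eq_maximalIdeal hJ
      exact equiv _ _ e.symm residue
  · obtain ⟨y, hym, hyI⟩ := SetLike.not_le_iff_exists.1 hI
    by_cases hpow : ∃ l, y ^ l ∈ I
    · classical
      -- With `l` minimal, `yN` is killed by `y ^ (l - 1)` and `N / yN` by `y`. Neither element lies
      -- in `I`, so both modules have strictly larger annihilating ideals.
      let l := Nat.find hpow
      have hl : y ^ l ∈ I := Nat.find_spec hpow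
      have h0 : l ≠ 0 := fun h => hyI (by
        rw [h, pow_zero] at hl
        simpa using I.mul_mem_left y hl)
      have hl' : y ^ (l - 1) ∉ I := Nat.find_min hpow (by change l - 1 < l; lia)
      refine ext N (LinearMap.range (y • LinearMap.id : N →ₗ[A] N)) ?_ ?_
      · refine ih' _ hl' _ (hsub _) ?_
        rintro ⟨_, x, rfl⟩
        refine Subtype.ext ?_
        change y ^ (l - 1) • (y • x) = 0
        rw [smul_smul, ← pow_succ, Nat.sub_add_cancel (by lia), hN _ hl]
      · refine ih' _ hyI _ (hquot _) ?_
        intro x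
        obtain ⟨x, rfl⟩ := Submodule.mkQ_surjective _ x
        rw [← map_smul]
        exact (Submodule.Quotient.mk_eq_zero _).2 ⟨x, rfl⟩
    -- No power of `y` lies in `I`. The `y`-power torsion is killed by one `y ^ l`, and `y` is
    -- regular on the quotient by it, so induction handles the torsion and the reduction modulo `y`
    -- of the quotient.
    · let T : ℕ →o Submodule A N :=
        ⟨fun l => LinearMap.ker (y ^ l • LinearMap.id : N →ₗ[A] N), fun l m h x hx => by
          obtain ⟨c, rfl⟩ := Nat.exists_eq_add_of_le' h
          change y ^ l • x = 0 at hx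
          change y ^ (c + l) • x = 0
          rw [pow_add, mul_smul, hx, smul_zero]⟩
      obtain ⟨l, hl⟩ := monotone_stabilizes_iff_noetherian.2 (inferInstance : IsNoetherian A N) T
      refine ext N (T l) (ih' (y ^ l) (fun h => hpow ⟨l, h⟩) _ (hsub _)
        fun x => Subtype.ext x.2) (regular _ y hym ?_ ?_)
      · intro x hx
        obtain ⟨x, rfl⟩ := (T l).mkQ_surjective x
        rw [← map_smul] at hx
        have h1 : y • x ∈ T l := (Submodule.Quotient.mk_eq_zero _).1 hx
        have h2 : x ∈ T (l + 1) := by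
          change y ^ l • y • x = 0 at h1
          change y ^ (l + 1) • x = 0
          rw [pow_succ, mul_smul, h1]
        rw [← hl (l + 1) (by lia)] at h2
        exact (Submodule.Quotient.mk_eq_zero _).2 h2
      · refine ih' _ hyI _ ?_ ?_
        · intro a ha x
          obtain ⟨x, rfl⟩ := Submodule.mkQ_surjective _ x
          rw [← map_smul, hquot _ a ha, map_zero]
        · intro x
          obtain ⟨x, rfl⟩ := Submodule.mkQ_surjective _ x
          rw [← map_smul]
          exact (Submodule.Quotient.mk_eq_zero _).2 ⟨x, rfl⟩

end Devissage

/-! ### Homogeneous polynomials act through endomorphisms of the complex. -/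

section Homogeneous

variable {A : Type u} [CommRing A] {K : CochainComplex (ModuleCat.{u} A) ℤ} {ι : Type}
  (S : CommSys K ι)

/-- A polynomial acts on the cohomology like an endomorphism of degree `n` of the complex. -/
def ActsAs (n : ℕ) (p : MvPolynomial ι A) (h : StrictMap K K n) : Prop :=
  ∀ (N : Type u) [AddCommGroup N] [Module A N] (x : Tot S N) (i j : ℤ) (hij : i + n = j),
    Tot.coeff S N i (p • x) = Coh.precomp h i j hij (Tot.coeff S N j x)

variable {S}

lemma ActsAs.mul {n m : ℕ} {p q : MvPolynomial ι A} {h : StrictMap K K n} {h' : StrictMap K K m}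
    (hp : ActsAs S n p h) (hq : ActsAs S m q h') :
    ActsAs S (n + m) (p * q) (h.comp h' _ (by simp)) := by
  intro N _ _ x i j hij
  rw [mul_smul, hp N _ i _ rfl, hq N _ _ j (by push_cast at hij; lia), Coh.precomp_precomp]

lemma ActsAs.C_mul {n : ℕ} {p : MvPolynomial ι A} {h : StrictMap K K n}
    (hp : ActsAs S n p h) (a : A) : ActsAs S n (MvPolynomial.C a * p) (a • h) := by
  intro N _ _ x i j hij
  rw [mul_smul, Tot.C_smul, map_smul, hp N _ i j hij, Coh.precomp_smul]

lemma ActsAs.add {n : ℕ} {p q : MvPolynomial ι A} {h h' : StrictMap K K n}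
    (hp : ActsAs S n p h) (hq : ActsAs S n q h') : ActsAs S n (p + q) (h + h') := by
  intro N _ _ x i j hij
  rw [add_smul, map_add, hp N _ i j hij, hq N _ i j hij, Coh.precomp_add]

lemma actsAs_zero (n : ℕ) : ActsAs S n 0 0 := by
  intro N _ _ x i j hij
  rw [zero_smul, map_zero, Coh.precomp_zero]

lemma actsAs_one : ActsAs S 0 1 (StrictMap.id K) := by
  intro N _ _ x i j hij
  obtain rfl : i = j := by simpa using hij
  rw [one_smul]
  exact (Coh.precomp_id _ _).symm

lemma actsAs_X (k : ι) : ActsAs S (S.deg k) (MvPolynomial.X k) (S.f k) := by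
  intro N _ _ x i j hij
  rw [Tot.X_smul, Tot.coeff_op k i j hij]

lemma exists_actsAs_monomial (d : ι →₀ ℕ) :
    ∃ n, Finsupp.weight S.deg d = n ∧ ∃ h, ActsAs S n (MvPolynomial.monomial d 1) h := by
  induction d using Finsupp.induction_linear with
  | zero => exact ⟨0, map_zero _, _, actsAs_one⟩
  | add d e hd he =>
    obtain ⟨n, hn, h, hd⟩ := hd
    obtain ⟨m, hm, h', he⟩ := he
    have := hd.mul he
    rw [MvPolynomial.monomial_mul, mul_one] at this
    exact ⟨n + m, by rw [map_add, hn, hm], _, this⟩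
  | single k m =>
    induction m with
    | zero => exact ⟨0, by simp, _, by simpa using actsAs_one⟩
    | succ m ih =>
      obtain ⟨n, hn, h, hh⟩ := ih
      have := hh.mul (actsAs_X k)
      rw [MvPolynomial.X, MvPolynomial.monomial_mul, mul_one, ← Finsupp.single_add] at this
      refine ⟨n + S.deg k, ?_, _, this⟩
      rw [← hn, Finsupp.weight_single, Finsupp.weight_single]
      simp only [smul_eq_mul]
      ring

lemma exists_actsAs {n : ℕ} {p : MvPolynomial ι A} (hp : p.IsWeightedHomogeneous S.deg n) :
    ∃ h, ActsAs S n p h := by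
  induction hp using MvPolynomial.IsWeightedHomogeneous.induction_on with
  | zero => exact ⟨0, actsAs_zero n⟩
  | add p q _ _ hp hq =>
    obtain ⟨h, hp⟩ := hp
    obtain ⟨h', hq⟩ := hq
    exact ⟨_, hp.add hq⟩
  | monomial d r hr =>
    obtain ⟨n, hn, h, hh⟩ := exists_actsAs_monomial (S := S) d
    obtain rfl := hn.symm.trans hr
    have := hh.C_mul r
    rw [MvPolynomial.C_mul_monomial, mul_one] at this
    exact ⟨_, this⟩

attribute [local instance] MvPolynomial.weightedGradedAlgebra

variable {N : Type u} [AddCommGroup N] [Module A N]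

lemma coeff_smul_of_eq_zero {n : ℕ} {p : MvPolynomial ι A}
    (hp : p.IsWeightedHomogeneous S.deg n) (i j : ℤ) (hij : i + n ≠ j) (x : Coh K N j) :
    Tot.coeff S N i (p • Tot.of S N j x) = 0 := by
  obtain ⟨h, hh⟩ := exists_actsAs hp
  rw [hh N _ i _ rfl, Tot.coeff_of_ne _ _ hij.symm, map_zero]

lemma of_coeff_smul_of {n : ℕ} {p : MvPolynomial ι A}
    (hp : p.IsWeightedHomogeneous S.deg n) (i j : ℤ) (hij : i + n = j) (x : Coh K N j) :
    Tot.of S N i (Tot.coeff S N i (p • Tot.of S N j x)) = p • Tot.of S N j x := by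
  refine Tot.ext fun l => ?_
  by_cases hl : i = l
  · subst hl
    rw [Tot.coeff_of_self]
  · rw [Tot.coeff_of_ne _ _ hl, coeff_smul_of_eq_zero hp _ _ (by lia)]

open MvPolynomial in
lemma coeff_smul_of (p : MvPolynomial ι A) (n : ℕ) (i j : ℤ) (hij : i + n = j) (x : Coh K N j) :
    Tot.coeff S N i (p • Tot.of S N j x) =
      Tot.coeff S N i ((weightedHomogeneousComponent S.deg n p) • Tot.of S N j x) := by
  induction p using DirectSum.Decomposition.inductionOn (weightedHomogeneousSubmodule A S.deg) with
  | zero => simp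
  | add p q hp hq => rw [add_smul, map_add, hp, hq, map_add, add_smul, map_add]
  | @homogeneous m p =>
    by_cases hm : m = n
    · subst hm
      rw [IsWeightedHomogeneous.weightedHomogeneousComponent_same p.2]
    · rw [IsWeightedHomogeneous.weightedHomogeneousComponent_ne _ p.2 (Ne.symm hm), zero_smul,
        map_zero]
      exact coeff_smul_of_eq_zero p.2 i j (by lia) x

open MvPolynomial in
/-- If all homogeneous components act by zero, then so does the polynomial. -/
lemma smul_eq_zero_of_component (p : MvPolynomial ι A) (x : Tot S N)
    (h : ∀ n, weightedHomogeneousComponent S.deg n p • x = 0) : p • x = 0 := by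
  rw [← sum_weightedHomogeneousComponent S.deg p,
    finsum_eq_sum _ (weightedHomogeneousComponent_finsupp p), Finset.sum_smul]
  exact Finset.sum_eq_zero fun n _ => h n

/-- A polynomial which annihilates the class of the projection onto the resolved module
annihilates the cohomology with arbitrary coefficients. -/
lemma smul_eq_zero_of_smul_proj {M : Type u} [AddCommGroup M] [Module A M]
    (R : CompleteResolution A M) {S : CommSys R.cx ι} (p : MvPolynomial ι A)
    (a : cocycles R.cx M 0) (ha : a.1 = R.proj)
    (h : p • Tot.of S M 0 (Coh.mk 0 a) = 0) (x : Tot S N) : p • x = 0 := by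
  refine smul_eq_zero_of_component p x fun n => ?_
  obtain ⟨f, hf⟩ := exists_actsAs
    (MvPolynomial.weightedHomogeneousComponent_isWeightedHomogeneous (w := S.deg) n p)
  -- At place `-n`, the product of `p` with the class of `proj` only involves the component of
  -- degree `n`, realized by `f`. Its vanishing says that `proj ∘ f` is a coboundary, so `f` is
  -- null-homotopic at every place.
  have h0 := coeff_smul_of (S := S) p n (-n) 0 (by lia) (Coh.mk 0 a)
  rw [h, map_zero, hf M _ (-n) 0 (by lia), Tot.coeff_of_self] at h0
  obtain ⟨b, hb, e⟩ := Coh.precomp_mk' f (-n) 0 (by lia) a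
  rw [e, eq_comm, Coh.mk_eq_zero_iff (-n) (-n + 1) rfl] at h0
  obtain ⟨t, ht⟩ := h0
  have hnull := R.nullAt_of_proj R.totallyAcyclic f (-n) (-n + 1) (by lia) rfl t (fun x => by
    rw [← ht, hb, ha])
  refine Tot.ext fun i => ?_
  rw [hf N _ i _ rfl, Coh.precomp_eq_zero (hnull i), map_zero]

end Homogeneous

end SymGrowth

end

noncomputable section

open CategoryTheory

namespace SymGrowth

/-! ### Noetherianity and nilpotence, carried from the residue field to all finitely generated
modules. -/

section Noetherian

variable {A : Type u} [CommRing A] {K : CochainComplex (ModuleCat.{u} A) ℤ}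
  {ι : Type} (S : CommSys K ι)

open MvPolynomial

lemma Coh.subsingleton (N : Type u) [AddCommGroup N] [Module A N] [Subsingleton N] (i : ℤ) :
    Subsingleton (Coh K N i) := by
  refine subsingleton_of_forall_eq 0 fun x => ?_
  obtain ⟨a, rfl⟩ := Coh.mk_surjective i x
  rw [Coh.mk_eq_zero_iff i (i + 1) rfl]
  exact ⟨0, fun x => Subsingleton.elim _ _⟩

lemma Tot.subsingleton (N : Type u) [AddCommGroup N] [Module A N] [Subsingleton N] :
    Subsingleton (Tot S N) :=
  subsingleton_of_forall_eq 0 fun _ => Tot.ext fun i =>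
    (Coh.subsingleton (K := K) N i).elim _ _

variable {S} in
lemma Tot.mapNonpos_surjective {N N' : Type u} [AddCommGroup N] [Module A N] [AddCommGroup N']
    [Module A N'] (e : N ≃ₗ[A] N') : Function.Surjective (Tot.mapNonpos S e.toLinearMap) := by
  intro x
  refine ⟨Tot.mapNonpos S e.symm.toLinearMap x, Subtype.ext (Tot.ext fun i => ?_)⟩
  rw [mapNonpos_coe, coeff_map, mapNonpos_coe, coeff_map, Coh.map_comp, e.comp_symm, Coh.map_id]

/-- By half-exactness for `0 → N → N → N/yN → 0`, a class that dies modulo `y` is `y` times a class.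
The images modulo `y` of the submodules `gen` become stationary at some `m`, and Nakayama's lemma
then shows that `gen m` is everything. The total module need not be finite over `A`, so Nakayama is
applied place by place. -/
lemma Tot.fg_nonpos_of_smul [IsNoetherianRing A] [IsLocalRing A]
    [∀ i, Module.Finite A (K.X i)] [Finite ι] (hK : ∀ i, Module.Free A (K.X i))
    (N : Type u) [AddCommGroup N] [Module A N] [Module.Finite A N]
    (y : A) (hy : y ∈ IsLocalRing.maximalIdeal A) (hreg : ∀ x : N, y • x = 0 → x = 0)
    (h : IsNoetherian (MvPolynomial ι A)
      (nonpos S (N ⧸ LinearMap.range (y • LinearMap.id : N →ₗ[A] N)))) :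
    (nonpos S N).FG ∧ ∀ x : nonpos S N,
      mapNonpos S (Submodule.mkQ (LinearMap.range (y • LinearMap.id : N →ₗ[A] N))) x = 0 →
      ∃ x' : nonpos S N, (x : Tot S N) = y • (x' : Tot S N) := by
  have hex (x : nonpos S N) (hx : mapNonpos S (Submodule.mkQ
      (LinearMap.range (y • LinearMap.id : N →ₗ[A] N))) x = 0) :
      ∃ x' : nonpos S N, (x : Tot S N) = y • (x' : Tot S N) := by
    obtain ⟨x', rfl⟩ := Tot.exists_map_eq hK (y • LinearMap.id : N →ₗ[A] N) (Submodule.mkQ _)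
      ((injective_iff_map_eq_zero _).2 hreg)
      (LinearMap.exact_iff.2 (by rw [Submodule.ker_mkQ])) (Submodule.mkQ_surjective _) x hx
    refine ⟨x', Tot.ext fun i => ?_⟩
    rw [mapNonpos_coe, coeff_map, Coh.map_smul_id, map_smul]
  refine ⟨?_, hex⟩
  let g := mapNonpos S (Submodule.mkQ (LinearMap.range (y • LinearMap.id : N →ₗ[A] N)))
  let W : ℕ →o Submodule (MvPolynomial ι A) (nonpos S N) :=
    ⟨fun m => (gen S N m).comap (nonpos S N).subtype,
      fun m m' hm => Submodule.comap_mono (gen_mono hm)⟩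
  let W' : ℕ →o Submodule (MvPolynomial ι A)
      (nonpos S (N ⧸ LinearMap.range (y • LinearMap.id : N →ₗ[A] N))) :=
    ⟨fun m => (W m).map g, fun m m' hm => Submodule.map_mono (W.2 hm)⟩
  obtain ⟨m, hm⟩ := monotone_stabilizes_iff_noetherian.2 h W'
  have hmem (i : ℤ) (hi : i ≤ 0) (x : Coh K N i) : of S N i x ∈ gen S N m := by
    let U : Submodule A (Coh K N i) := ((gen S N m).restrictScalars A).comap (of S N i)
    suffices hU : (⊤ : Submodule A (Coh K N i)) ≤ U from hU trivial
    -- A class `x` agrees modulo `y` with some `w` in `gen m`, so `x = w + y x'`; taking components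
    -- at place `i` stays in `gen m` because `gen m` is graded.
    refine Submodule.le_of_le_smul_of_le_jacobson_bot (I := Ideal.span {y})
      (Module.Finite.fg_top) ?_ (fun x _ => ?_)
    · rw [IsLocalRing.jacobson_eq_maximalIdeal _ bot_ne_top, Ideal.span_singleton_le_iff_mem]
      exact hy
    · let m' := max m (-i).toNat
      let z : nonpos S N := ⟨of S N i x, of_mem_nonpos i hi x⟩
      have h1 : g z ∈ W' m' := ⟨z, Submodule.subset_span ⟨i, by lia, hi, x, rfl⟩, rfl⟩
      rw [← hm m' (le_max_left _ _)] at h1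
      obtain ⟨w, hw, e⟩ := h1
      obtain ⟨x', hx'⟩ := hex (z - w) (by rw [map_sub]; exact sub_eq_zero.2 e.symm)
      have h2 : x = coeff S N i w + y • coeff S N i x' := by
        have h3 := congrArg (coeff S N i) hx'
        rw [map_smul, Submodule.coe_sub, map_sub] at h3
        rw [← h3, coeff_of_self, add_sub_cancel]
      rw [h2]
      refine Submodule.add_mem_sup ?_ (Submodule.smul_mem_smul
        (Ideal.mem_span_singleton_self y) trivial)
      exact of_coeff_mem_gen m _ hw i
  have : nonpos S N = gen S N m := by
    refine le_antisymm (fun x hx => ?_) (gen_le_nonpos m)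
    refine mem_of_of_mem (W := (gen S N m).restrictScalars A) x fun i => ?_
    by_cases hi : i ≤ 0
    · exact hmem i hi _
    · rw [(mem_nonpos x).1 hx i (by lia), map_zero]
      exact Submodule.zero_mem _
  rw [this]
  exact gen_fg m

/-- If `s` maps a finitely generated module into `y M`, then some power of `s` is congruent
modulo `y` to an element which annihilates the module. -/
lemma exists_pow_sub_mem_of_smul {P : Type*} [CommRing P] {E : Type*} [AddCommGroup E] [Module P E]
    [Module.Finite P E] (I : Ideal P) (s : P) (h : ∀ x : E, s • x ∈ (I • ⊤ : Submodule P E)) :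
    ∃ (n : ℕ) (s' : P), (∀ x : E, s' • x = 0) ∧ s ^ n - s' ∈ I := by
  -- Cayley–Hamilton: `s` satisfies on `E` a monic polynomial `p` whose lower coefficients lie in
  -- `I`. Take `s' = p(s)`.
  obtain ⟨p, hp, -, hpc, hp0⟩ :=
    LinearMap.exists_monic_and_natDegree_eq_and_coeff_mem_pow_and_aeval_eq_zero P
      (algebraMap P (Module.End P E) s) I (by rintro _ ⟨x, rfl⟩; exact h x)
  refine ⟨p.natDegree, p.eval s, fun x => ?_, ?_⟩
  · have := LinearMap.congr_fun hp0 x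
    rw [Polynomial.aeval_algebraMap_apply, Polynomial.coe_aeval_eq_eval] at this
    exact this
  · rw [Polynomial.eval_eq_sum_range, Finset.sum_range_succ, hp.coeff_natDegree, one_mul,
      sub_add_cancel_right]
    refine I.neg_mem (I.sum_mem fun k hk => I.mul_mem_right _ ?_)
    exact Ideal.pow_le_self (by have := Finset.mem_range.1 hk; lia) (hpc k)

variable [IsLocalRing A]

open IsLocalRing

/-- The cohomology with coefficients in `N` at the places `Kⁱ`, `i ≤ 0`, is Noetherian, and some
power of `q` annihilates it modulo the maximal ideal. -/
def NoethNilp (q : MvPolynomial ι A) (N : Type u) [AddCommGroup N] [Module A N] : Prop :=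
  IsNoetherian (MvPolynomial ι A) (Tot.nonpos S N) ∧ ∃ (n : ℕ) (s : MvPolynomial ι A),
    (∀ x ∈ Tot.nonpos S N, s • x = 0) ∧ q ^ n - s ∈ (maximalIdeal A).map C

variable {S} in
lemma NoethNilp.of_equiv {q : MvPolynomial ι A} {N N' : Type u} [AddCommGroup N] [Module A N]
    [AddCommGroup N'] [Module A N'] (e : N ≃ₗ[A] N') (hN : NoethNilp S q N) :
    NoethNilp S q N' := by
  obtain ⟨hN, n, s, hs, hsq⟩ := hN
  refine ⟨isNoetherian_of_surjective _
    (LinearMap.range_eq_top.2 (Tot.mapNonpos_surjective e)), n, s,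
    fun x hx => ?_, hsq⟩
  obtain ⟨y, hy⟩ := Tot.mapNonpos_surjective (S := S) e ⟨x, hx⟩
  obtain rfl : Tot.map S e.toLinearMap y = x := congrArg Subtype.val hy
  rw [← map_smul, hs _ y.2, map_zero]

variable {S} in
-- If `s` works for the submodule and `t` for the quotient, then `t` pushes the middle term into the
-- image of the submodule, where `s` kills it, and exponents add.
lemma NoethNilp.of_submodule (hK : ∀ i, Module.Free A (K.X i)) {q : MvPolynomial ι A}
    {N : Type u} [AddCommGroup N] [Module A N] (N' : Submodule A N)
    (h1 : NoethNilp S q N') (h2 : NoethNilp S q (N ⧸ N')) : NoethNilp S q N := by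
  obtain ⟨h1, n, s, hs, hsq⟩ := h1
  obtain ⟨h2, m, t, ht, htq⟩ := h2
  have hex (x : Tot.nonpos S N) (hx : Tot.mapNonpos S N'.mkQ x = 0) :
      ∃ y, Tot.mapNonpos S N'.subtype y = x :=
    Tot.exists_map_eq hK N'.subtype N'.mkQ N'.injective_subtype
      (LinearMap.exact_subtype_mkQ N') N'.mkQ_surjective x hx
  refine ⟨isNoetherian_of_range_eq_ker (Tot.mapNonpos S N'.subtype) (Tot.mapNonpos S N'.mkQ)
    ?_, n + m, s * t, ?_, ?_⟩
  · refine le_antisymm ?_ fun x hx => hex x hx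
    rintro _ ⟨x, rfl⟩
    refine Subtype.ext (Tot.ext fun i => ?_)
    rw [Tot.mapNonpos_coe, Tot.coeff_map, Tot.mapNonpos_coe, Tot.coeff_map, Coh.map_comp]
    obtain ⟨a, ha⟩ := Coh.mk_surjective i (Tot.coeff S N' i x)
    obtain ⟨b, hb, e⟩ := Coh.map_mk' (N'.mkQ ∘ₗ N'.subtype) i a
    rw [← ha, e]
    have : b = 0 := Subtype.ext (LinearMap.ext fun x => by simp [hb])
    rw [this, map_zero]
    exact (map_zero _).symm
  · intro x hx
    obtain ⟨y, hy⟩ := hex (t • ⟨x, hx⟩) (by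
      rw [map_smul]
      exact Subtype.ext (ht _ (Tot.mapNonpos S N'.mkQ ⟨x, hx⟩).2))
    have hy' : Tot.map S N'.subtype y = t • x := congrArg Subtype.val hy
    rw [mul_smul, ← hy', ← map_smul, hs _ y.2, map_zero]
  · have : q ^ (n + m) - s * t = q ^ n * (q ^ m - t) + (q ^ n - s) * t := by ring
    rw [this]
    exact Ideal.add_mem _ (Ideal.mul_mem_left _ _ htq) (Ideal.mul_mem_right _ _ hsq)

variable {S} in
-- An `s` killing the cohomology modulo `y` maps that of `N` into its `y`-multiples. Cayley–Hamilton
-- replaces a power of `s` by a true annihilator, congruent to it modulo `y`, which lies in the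
-- maximal ideal.
lemma NoethNilp.of_regular [IsNoetherianRing A] [∀ i, Module.Finite A (K.X i)] [Finite ι]
    (hK : ∀ i, Module.Free A (K.X i)) {q : MvPolynomial ι A}
    (N : Type u) [AddCommGroup N] [Module A N] [Module.Finite A N]
    (y : A) (hy : y ∈ maximalIdeal A) (hreg : ∀ x : N, y • x = 0 → x = 0)
    (hN : NoethNilp S q (N ⧸ LinearMap.range (y • LinearMap.id : N →ₗ[A] N))) :
    NoethNilp S q N := by
  obtain ⟨hN, n, s, hs, hsq⟩ := hN
  obtain ⟨hfg, hex⟩ := Tot.fg_nonpos_of_smul S hK N y hy hreg hN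
  have : Module.Finite (MvPolynomial ι A) (Tot.nonpos S N) := Module.Finite.iff_fg.2 hfg
  refine ⟨inferInstance, ?_⟩
  have hIm : Ideal.span {(C y : MvPolynomial ι A)} ≤ (maximalIdeal A).map C := by
    rw [Ideal.span_singleton_le_iff_mem]
    exact Ideal.mem_map_of_mem _ hy
  obtain ⟨m, t, ht, htq⟩ := exists_pow_sub_mem_of_smul (E := Tot.nonpos S N)
    (Ideal.span {(C y : MvPolynomial ι A)}) s (fun x => by
      obtain ⟨x', hx'⟩ := hex (s • x) (by
        rw [map_smul]
        exact Subtype.ext (hs _ (Tot.mapNonpos S _ x).2))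
      have : s • x = (C y : MvPolynomial ι A) • x' := Subtype.ext (by
        rw [hx']
        exact (Tot.C_smul y _).symm)
      rw [this]
      exact Submodule.smul_mem_smul (Ideal.mem_span_singleton_self _) trivial)
  refine ⟨n * m, t, fun x hx => congrArg Subtype.val (ht ⟨x, hx⟩), ?_⟩
  have : q ^ (n * m) - t = ((q ^ n) ^ m - s ^ m) + (s ^ m - t) := by ring
  rw [this]
  refine Ideal.add_mem _ ?_ (hIm htq)
  exact Ideal.mem_of_dvd _ (sub_dvd_pow_sub_pow _ _ _) hsq

lemma NoethNilp.of_subsingleton (q : MvPolynomial ι A) (N : Type u) [AddCommGroup N] [Module A N]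
    [Subsingleton N] : NoethNilp S q N := by
  have := Tot.subsingleton S N
  refine ⟨inferInstance, 0, 1, fun x _ => Subsingleton.elim _ _, ?_⟩
  rw [pow_zero, sub_self]
  exact Ideal.zero_mem _

variable {S} in
lemma NoethNilp.of_smul_eq_zero {q : MvPolynomial ι A} {N : Type u} [AddCommGroup N] [Module A N]
    (h : IsNoetherian (MvPolynomial ι A) (Tot.nonpos S N))
    (hq : ∀ x ∈ Tot.nonpos S N, q • x = 0) : NoethNilp S q N := by
  refine ⟨h, 1, q, hq, ?_⟩
  rw [pow_one, sub_self]
  exact Ideal.zero_mem _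

/-- Noetherianness and the comparison of supports pass from the residue field to all finitely
generated modules. -/
theorem noetherian_and_nilpotent [IsNoetherianRing A] [∀ i, Module.Finite A (K.X i)] [Finite ι]
    (hK : ∀ i, Module.Free A (K.X i))
    (k : Type u) [AddCommGroup k] [Module A k] (e : k ≃ₗ[A] A ⧸ maximalIdeal A)
    (h : IsNoetherian (MvPolynomial ι A) (Tot.nonpos S k))
    (q : MvPolynomial ι A) (hq : ∀ x ∈ Tot.nonpos S k, q • x = 0)
    (N : Type u) [AddCommGroup N] [Module A N] [Module.Finite A N] :
    NoethNilp S q N := by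
  have hk : NoethNilp S q k := NoethNilp.of_smul_eq_zero h hq
  have hk' : NoethNilp S q (A ⧸ maximalIdeal A) := hk.of_equiv e
  exact devissage (fun N _ _ => NoethNilp S q N)
    (fun N _ _ _ => NoethNilp.of_subsingleton S q N)
    (fun N N' _ _ _ _ e hN => hN.of_equiv e) hk'
    (fun N _ _ _ N' h1 h2 => NoethNilp.of_submodule hK N' h1 h2)
    (fun N _ _ _ y hy hreg hN => NoethNilp.of_regular hK N y hy hreg hN) N

end Noetherian

end SymGrowth

end

noncomputable section

open CategoryTheory

namespace SymGrowth

/-! ### Polynomial growth of functions on the integers. -/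

section Growth

open Filter

/-- The function `i ^ (t - 1)`, which is zero for `t = 0`. -/
def growthBound (t : ℕ) (i : ℤ) : ℕ := if t = 0 then 0 else i.toNat ^ (t - 1)

/-- Growth of polynomial rate at most `t - 1` in the positive direction. -/
def Growth (t : ℕ) (g : ℤ → ℕ∞) : Prop :=
  ∃ a : ℕ, ∀ᶠ i in atTop, g i ≤ ((a * growthBound t i : ℕ) : ℕ∞)

namespace Growth

variable {t : ℕ} {g h : ℤ → ℕ∞}

lemma mono (hg : Growth t g) (hh : ∀ᶠ i in atTop, h i ≤ g i) : Growth t h := by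
  obtain ⟨a, ha⟩ := hg
  exact ⟨a, by filter_upwards [ha, hh] with i h1 h2 using h2.trans h1⟩

lemma zero : Growth t (fun _ => 0) := ⟨0, by simp⟩

lemma add (hg : Growth t g) (hh : Growth t h) : Growth t (fun i => g i + h i) := by
  obtain ⟨a, ha⟩ := hg
  obtain ⟨b, hb⟩ := hh
  refine ⟨a + b, ?_⟩
  filter_upwards [ha, hb] with i h1 h2
  rw [add_mul, Nat.cast_add]
  exact add_le_add h1 h2

lemma sum {κ : Type*} (s : Finset κ) {g : κ → ℤ → ℕ∞} (hg : ∀ c ∈ s, Growth t (g c)) :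
    Growth t (fun i => ∑ c ∈ s, g c i) := by
  classical
  induction s using Finset.induction_on with
  | empty => simpa using zero
  | insert c s hc ih =>
    simp only [Finset.sum_insert hc]
    exact (hg c (by simp)).add (ih fun c hc => hg c (by simp [hc]))

lemma mul_const (hg : Growth t g) (c : ℕ) : Growth t (fun i => g i * c) := by
  obtain ⟨a, ha⟩ := hg
  refine ⟨a * c, ?_⟩
  filter_upwards [ha] with i h1
  rw [mul_right_comm, Nat.cast_mul]
  gcongr

lemma shift (hg : Growth t g) (c : ℤ) : Growth t (fun i => g (i + c)) := by
  obtain ⟨a, ha⟩ := hg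
  -- The factor comes from `i + c ≤ 2 * i` for `i ≥ |c|`.
  refine ⟨a * 2 ^ (t - 1), ?_⟩
  have h1 := (tendsto_atTop_add_const_right atTop c tendsto_id).eventually ha
  filter_upwards [h1, eventually_ge_atTop |c|] with i h1 h2
  refine h1.trans (Nat.cast_le.2 ?_)
  rw [mul_assoc]
  refine Nat.mul_le_mul_left _ ?_
  unfold growthBound
  split_ifs
  · simp
  · rw [← mul_pow]
    refine Nat.pow_le_pow_left ?_ _
    have := le_abs_self c
    simp only [id]
    lia

end Growth

end Growth

/-! ### Estimates of length. -/

section Length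

variable {A : Type u} [CommRing A]

/-- The kernel of `f` on `U` embeds into `U'` and its image into `W`. -/
lemma length_le_add {V V' : Type*} [AddCommGroup V] [Module A V] [AddCommGroup V'] [Module A V']
    (U U' : Submodule A V) (W : Submodule A V') (f : V →ₗ[A] V') (h : ∀ x ∈ U, f x ∈ W)
    (h' : ∀ x ∈ U, f x = 0 → x ∈ U') :
    Module.length A U ≤ Module.length A U' + Module.length A W := by
  let F : U →ₗ[A] W := f.restrict h
  rw [Module.length_eq_add_of_exact (LinearMap.ker F).subtype F.rangeRestrict
    (Submodule.subtype_injective _) F.surjective_rangeRestrict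
    (by rw [LinearMap.exact_iff, LinearMap.ker_rangeRestrict, Submodule.range_subtype])]
  refine add_le_add ?_ (Module.length_le_of_injective _ (Submodule.subtype_injective _))
  let G : LinearMap.ker F →ₗ[A] U' :=
    (U.subtype ∘ₗ (LinearMap.ker F).subtype).codRestrict U'
      (fun x => h' _ x.1.2 (congrArg Subtype.val x.2))
  refine Module.length_le_of_injective G fun x y hxy => ?_
  have h1 : (x : U).1 = (y : U).1 := congrArg (fun z : U' => z.1) hxy
  exact Subtype.ext (Subtype.ext h1)

/-- A module of finite length is generated by as many elements as its length. -/
lemma exists_finset_span_eq_top {X : Type*} [AddCommGroup X] [Module A X]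
    (hX : IsFiniteLength A X) :
    ∃ s : Finset X, (s.card : ℕ∞) ≤ Module.length A X ∧ Submodule.span A (s : Set X) = ⊤ := by
  classical
  induction hX with
  | of_subsingleton => exact ⟨∅, by simp, Subsingleton.elim _ _⟩
  | @of_simple_quotient M _ _ N hs _ ih =>
    obtain ⟨s, hs1, hs2⟩ := ih
    have hN : IsCoatom N := isSimpleModule_iff_isCoatom.1 hs
    obtain ⟨x, hx⟩ : ∃ x, x ∉ N := by
      by_contra! h
      exact hN.1 (eq_top_iff.2 fun x _ => h x)
    refine ⟨insert x (s.image N.subtype), ?_, ?_⟩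
    · rw [Module.length_eq_add_of_exact N.subtype N.mkQ N.injective_subtype N.mkQ_surjective
        (LinearMap.exact_subtype_mkQ N), Module.length_eq_one A (M ⧸ N)]
      refine le_trans ?_ (add_le_add hs1 le_rfl)
      have := (Finset.card_insert_le x (s.image N.subtype)).trans
        (Nat.succ_le_succ Finset.card_image_le)
      exact_mod_cast this
    · have h1 : N ≤ Submodule.span A (insert x (s.image N.subtype) : Finset M) := by
        have h2 : N = Submodule.span A (N.subtype '' s) := by
          rw [← Submodule.map_span, hs2, Submodule.map_top, Submodule.range_subtype]
        conv_lhs => rw [h2]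
        exact Submodule.span_mono (by simp)
      refine hN.2 _ (lt_of_le_of_ne h1 fun e => hx ?_)
      rw [e]
      exact Submodule.subset_span (by simp)

end Length

/-! ### Growth under nilpotent operators; detection of classes in a window of places. -/

section Comparison

variable {A : Type u} [CommRing A] {K : CochainComplex (ModuleCat.{u} A) ℤ} {ι : Type}
  (S : CommSys K ι) {k : Type u} [AddCommGroup k] [Module A k]

open MvPolynomial Filter

/-- The length of the component at the place `Kⁱ` of a submodule of the total cohomology. -/
def compLength (G : Submodule (MvPolynomial ι A) (Tot S k)) (i : ℤ) : ℕ∞ :=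
  Module.length A ((G.restrictScalars A).comap (Tot.of S k i))

variable {S}

/-- The multiplication by a homogeneous polynomial on the components. -/
def mulHom (q : MvPolynomial ι A) (i j : ℤ) : Coh K k i →ₗ[A] Coh K k j :=
  Tot.coeff S k j ∘ₗ ((LinearMap.lsmul (MvPolynomial ι A) (Tot S k) q).restrictScalars A) ∘ₗ
    Tot.of S k i

lemma mulHom_apply (q : MvPolynomial ι A) (i j : ℤ) (x : Coh K k i) :
    mulHom (S := S) q i j x = Tot.coeff S k j (q • Tot.of S k i x) := rfl

lemma of_mulHom {q : MvPolynomial ι A} {n : ℕ} (hq : q.IsWeightedHomogeneous S.deg n) (i j : ℤ)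
    (h : j + n = i) (x : Coh K k i) : Tot.of S k j (mulHom (S := S) q i j x) = q • Tot.of S k i x :=
  of_coeff_smul_of hq j i h x

/-- If a homogeneous polynomial is nilpotent on a submodule, then the growth of the submodule is
bounded by that of the kernel of the polynomial. -/
lemma growth_of_nilpotent {t : ℕ} {q : MvPolynomial ι A} {n L : ℕ}
    (hq : q.IsWeightedHomogeneous S.deg n) (G G' : Submodule (MvPolynomial ι A) (Tot S k))
    (hL : ∀ x ∈ G, q ^ L • x = 0) (hG : ∀ x ∈ G, q • x = 0 → x ∈ G')
    (h : Growth t (compLength S G')) : Growth t (compLength S G) := by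
  -- Filter `G` by the torsion of the powers of `q`. Multiplication by `q` carries the torsion of `q
  -- ^ (l + 1)` into that of `q ^ l`, at a place lower by `n`, with kernel inside `G'`.
  have key (l : ℕ) : Growth t (compLength S (G ⊓ Submodule.torsionBy _ _ (q ^ l))) := by
    induction l with
    | zero =>
      refine Growth.zero.mono (Eventually.of_forall fun i => le_of_eq ?_)
      refine Module.length_eq_zero_iff.2 (subsingleton_of_forall_eq 0 ?_)
      rintro ⟨x, -, hx⟩
      have hx : q ^ 0 • Tot.of S k i x = 0 := hx
      rw [pow_zero, one_smul] at hx
      have := congrArg (Tot.coeff S k i) hx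
      rw [Tot.coeff_of_self, map_zero] at this
      exact Subtype.ext this
    | succ l ih =>
      refine (h.add (ih.shift (-n))).mono (Eventually.of_forall fun i => ?_)
      refine length_le_add _ _ _ (mulHom (S := S) q i (i + -n)) ?_ ?_
      · rintro x ⟨hx, hx'⟩
        have hx' : q ^ (l + 1) • Tot.of S k i x = 0 := hx'
        change Tot.of S k _ _ ∈ G ⊓ Submodule.torsionBy _ _ (q ^ l)
        rw [of_mulHom hq _ _ (by lia)]
        refine ⟨G.smul_mem _ hx, ?_⟩
        change q ^ l • q • _ = (0 : Tot S k)
        rw [smul_smul, ← pow_succ, hx']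
      · rintro x ⟨hx, hx'⟩ h0
        refine hG _ hx ?_
        rw [← of_mulHom hq _ (i + -n) (by lia), h0, map_zero]
  have := key L
  rwa [inf_eq_left.2 fun x hx => hL x hx] at this

/-- An element at a place `Kⁱ`, `i > n₂ - D`, vanishes if all its multiples in a window do. -/
lemma eq_zero_of_window {n₂ D : ℤ} (hD : ∀ c, (S.deg c : ℤ) ≤ D)
    (hsoc : ∀ i > n₂, ∀ x : Coh K k i,
      (∀ c, Coh.precomp (S.f c) (i - S.deg c) i (by lia) x = 0) → x = 0)
    (i : ℤ) (hi : n₂ - D < i) (x : Coh K k i)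
    (hx : ∀ j, n₂ - D < j → j ≤ n₂ → ∀ m : ℕ, j + m = i → ∀ p : MvPolynomial ι A,
      p.IsWeightedHomogeneous S.deg m → mulHom (S := S) p i j x = 0) : x = 0 := by
  obtain ⟨n, hn⟩ : ∃ n : ℕ, i = n₂ - D + n := ⟨(i - (n₂ - D)).toNat, by lia⟩
  induction n using Nat.strong_induction_on generalizing i with
  | h n ih =>
  by_cases hi' : i ≤ n₂
  · have := hx i hi hi' 0 (by simp) 1 (isWeightedHomogeneous_one _ _)
    rwa [mulHom_apply, one_smul, Tot.coeff_of_self] at this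
  -- To the right of the window it suffices that the products of `x` with the variables vanish.
  -- Since the window is at least as wide as every degree `S.deg c`, no such product jumps over it,
  -- so induction on the distance applies.
  · refine hsoc i (by lia) x fun c => ?_
    have h1 := hD c
    have h2 := S.deg_pos c
    refine ih (n - S.deg c) (by lia) (i - S.deg c) (by lia) _ ?_ (by lia)
    intro j hj hj' m hm p hp
    have := hx j hj hj' (m + S.deg c) (by push_cast; lia) (p * X c)
      (hp.mul (isWeightedHomogeneous_X _ _ _))
    rw [mulHom_apply, mul_smul, Tot.X_smul, Tot.op_of c (i - S.deg c) i (by lia)] at this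
    exact this

/-- To the left of `-m`, every class comes from places strictly closer to `0`; these are still
nonpositive, as all degrees are at most `m`, so descent ends in the range from `-m` to `0`. -/
lemma gen_eq_nonpos [Fintype ι] {m : ℕ} (hm : ∀ c, S.deg c ≤ m)
    (hgen : ∀ i < -(m : ℤ), ∀ x : Coh K k i, ∃ y : ∀ c, Coh K k (i + S.deg c),
      x = ∑ c, Coh.precomp (S.f c) i _ rfl (y c)) : Tot.gen S k m = Tot.nonpos S k := by
  refine le_antisymm (Tot.gen_le_nonpos m) fun x hx => ?_
  refine Tot.mem_of_of_mem (W := (Tot.gen S k m).restrictScalars A) x fun i => ?_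
  by_cases hi : i ≤ 0
  · generalize Tot.coeff S k i x = x
    obtain ⟨n, hn⟩ : ∃ n : ℕ, i = -n := ⟨(-i).toNat, by lia⟩
    induction n using Nat.strong_induction_on generalizing i with
    | h n ih =>
    by_cases hi' : -(m : ℤ) ≤ i
    · exact Submodule.subset_span ⟨i, hi', hi, x, rfl⟩
    · obtain ⟨y, rfl⟩ := hgen i (by lia) x
      rw [map_sum]
      refine Submodule.sum_mem _ fun c _ => ?_
      have h1 := hm c
      have h2 := S.deg_pos c
      rw [← Tot.op_of c i _ rfl, ← Tot.X_smul]
      exact (Tot.gen S k m).smul_mem _ (ih (n - S.deg c) (by lia) _ (by lia) (y c) (by lia))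
  · rw [(Tot.mem_nonpos x).1 hx i (by lia), map_zero]
    exact Submodule.zero_mem _

end Comparison

end SymGrowth

end

noncomputable section

open CategoryTheory

namespace SymGrowth

/-! ### The growth on the right is bounded by the growth on the left. -/

section Comparison

variable {A : Type u} [CommRing A] {K : CochainComplex (ModuleCat.{u} A) ℤ} {ι : Type}
  {S : CommSys K ι} {k : Type u} [AddCommGroup k] [Module A k]

open MvPolynomial Filter IsLocalRing

lemma Coh.smul_eq_zero {N : Type u} [AddCommGroup N] [Module A N] {a : A}
    (h : ∀ x : N, a • x = 0) (i : ℤ) (x : Coh K N i) : a • x = 0 := by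
  have : a • (LinearMap.id : N →ₗ[A] N) = 0 := LinearMap.ext h
  rw [← Coh.map_smul_id, this]
  obtain ⟨b, rfl⟩ := Coh.mk_surjective i x
  rw [← map_zero (Coh.mk i)]
  exact Coh.map_mk _ _ _ _ fun x => rfl

lemma Tot.smul_eq_zero_of_mem_map {I : Ideal A} {N : Type u} [AddCommGroup N] [Module A N]
    (h : ∀ a ∈ I, ∀ x : N, a • x = 0) (p : MvPolynomial ι A) (hp : p ∈ I.map C) (x : Tot S N) :
    p • x = 0 := by
  have : I.map C ≤ Module.annihilator (MvPolynomial ι A) (Tot S N) := by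
    refine Ideal.map_le_iff_le_comap.2 fun a ha => Module.mem_annihilator.2 fun x => ?_
    rw [Tot.C_smul]
    refine Tot.ext fun i => ?_
    rw [map_smul, Coh.smul_eq_zero (h a ha), map_zero]
  exact Module.mem_annihilator.1 (this hp) x

/-- The homogeneous polynomials which annihilate the cohomology in nonpositive places. -/
def homogAnn (S : CommSys K ι) (k : Type u) [AddCommGroup k] [Module A k] :
    Set (MvPolynomial ι A) :=
  {q | (∃ n, q.IsWeightedHomogeneous S.deg n) ∧ ∀ x ∈ Tot.nonpos S k, q • x = 0}

/-- The homogeneous polynomials of degree `m` are spanned modulo those which annihilate the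
cohomology in nonpositive places by few elements. -/
lemma exists_finset_homogeneous {κ : Type*} [Fintype κ] (jγ : κ → ℤ) (γ : ∀ c, Coh K k (jγ c))
    (hγ : Tot.nonpos S k ≤
      Submodule.span (MvPolynomial ι A) (Set.range fun c => Tot.of S k (jγ c) (γ c)))
    (hfl : ∀ i, IsFiniteLength A (Coh K k i)) (m : ℕ) :
    ∃ s : Finset (MvPolynomial ι A),
      (s.card : ℕ∞) ≤ ∑ c, Module.length A (Coh K k (jγ c - m)) ∧
      (∀ p ∈ s, p.IsWeightedHomogeneous S.deg m) ∧
      ∀ p, p.IsWeightedHomogeneous S.deg m →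
        ∃ p' ∈ Submodule.span A (s : Set (MvPolynomial ι A)), p - p' ∈ homogAnn S k := by
  classical
  let Pm := weightedHomogeneousSubmodule A S.deg m
  -- Evaluation on generators of the nonpositive part. Its kernel annihilates that part, so modulo
  -- annihilators the polynomials of degree `m` number no more than the length of the target.
  let Θ : Pm →ₗ[A] (∀ c, Coh K k (jγ c - m)) :=
    { toFun := fun p c => Tot.coeff S k _ (p.1 • Tot.of S k (jγ c) (γ c))
      map_add' := fun p q => by ext c; simp [add_smul]
      map_smul' := fun a p => by ext c; simp [smul_assoc] }
  have hΘ (p : Pm) (hp : Θ p = 0) : p.1 ∈ homogAnn S k := by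
    refine ⟨⟨m, p.2⟩, fun x hx => ?_⟩
    have hle : Submodule.span (MvPolynomial ι A) (Set.range fun c => Tot.of S k (jγ c) (γ c)) ≤
        Submodule.torsionBy _ _ p.1 := by
      refine Submodule.span_le.2 ?_
      rintro _ ⟨c, rfl⟩
      change p.1 • Tot.of S k (jγ c) (γ c) = 0
      rw [← of_coeff_smul_of p.2 (jγ c - m) (jγ c) (by lia)]
      have : Tot.coeff S k (jγ c - m) (p.1 • Tot.of S k (jγ c) (γ c)) = 0 := congrFun hp c
      rw [this, map_zero]
    exact hle (hγ hx)
  have hflr : IsFiniteLength A (LinearMap.range Θ) := by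
    refine IsFiniteLength.of_injective ?_ (Submodule.subtype_injective _)
    rw [← Module.length_ne_top_iff, Module.length_pi_of_fintype]
    exact WithTop.sum_ne_top.2 fun c _ => Module.length_ne_top_iff.2 (hfl _)
  obtain ⟨s, hs, hs'⟩ := exists_finset_span_eq_top hflr
  choose g hg using fun y : LinearMap.range Θ => LinearMap.mem_range.1 y.2
  refine ⟨s.image fun y => (g y).1, ?_, ?_, ?_⟩
  · rw [← Module.length_pi_of_fintype]
    refine le_trans ?_ (Module.length_le_of_injective _ (Submodule.subtype_injective
      (LinearMap.range Θ)))
    exact le_trans (Nat.cast_le.2 Finset.card_image_le) hs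
  · intro p hp
    obtain ⟨y, -, rfl⟩ := Finset.mem_image.1 hp
    exact (g y).2
  · intro p hp
    have h1 : (⟨Θ ⟨p, hp⟩, LinearMap.mem_range_self _ _⟩ : LinearMap.range Θ) ∈
        Submodule.span A (s : Set _) :=
      hs' ▸ trivial
    have h2 : Submodule.span A (s : Set (LinearMap.range Θ)) ≤
        ((Submodule.span A ((s.image g : Finset Pm) : Set Pm)).map Θ).comap
          (LinearMap.range Θ).subtype := by
      refine Submodule.span_le.2 fun y hy => ?_
      refine ⟨g y, Submodule.subset_span
        (Finset.mem_coe.2 (Finset.mem_image.2 ⟨y, hy, rfl⟩)), hg y⟩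
    obtain ⟨p', hp', e⟩ := h2 h1
    refine ⟨p'.1, ?_, hΘ (⟨p, hp⟩ - p') (by rw [map_sub, e]; exact sub_self _)⟩
    have h3 := Submodule.mem_map_of_mem (f := Pm.subtype) hp'
    rw [Submodule.map_span] at h3
    refine Submodule.span_mono ?_ h3
    rintro _ ⟨y, hy, rfl⟩
    obtain ⟨z, hz, rfl⟩ := Finset.mem_image.1 (Finset.mem_coe.1 hy)
    exact Finset.mem_coe.2 (Finset.mem_image.2 ⟨z, hz, rfl⟩)

/-- The growth in the positive places of the elements which are annihilated by the annihilator
of the cohomology in nonpositive places. -/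
lemma growth_torsion [Fintype ι] {t : ℕ} {κ : Type*} [Fintype κ] (jγ : κ → ℤ)
    (γ : ∀ c, Coh K k (jγ c))
    (hγ : Tot.nonpos S k ≤
      Submodule.span (MvPolynomial ι A) (Set.range fun c => Tot.of S k (jγ c) (γ c)))
    (hfl : ∀ i, IsFiniteLength A (Coh K k i)) (n₂ : ℤ)
    (hsoc : ∀ i > n₂, ∀ x : Coh K k i,
      (∀ c, Coh.precomp (S.f c) (i - S.deg c) i (by lia) x = 0) → x = 0)
    (G : Submodule (MvPolynomial ι A) (Tot S k))
    (hG : ∀ q ∈ homogAnn S k, ∀ x ∈ G, q • x = 0)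
    (h : Growth t (fun i => Module.length A (Coh K k (-i)))) : Growth t (compLength S G) := by
  obtain ⟨D, hD⟩ : ∃ D : ℕ, ∀ c, S.deg c ≤ D :=
    ⟨Finset.univ.sup S.deg, fun c => Finset.le_sup (Finset.mem_univ c)⟩
  choose s hs hs' hs'' using exists_finset_homogeneous (S := S) jγ γ hγ hfl
  have hlen (j : ℤ) : ∃ c : ℕ, Module.length A (Coh K k j) = c :=
    ENat.ne_top_iff_exists.1 (Module.length_ne_top_iff.2 (hfl j)) |>.imp fun _ h => h.symm
  choose ℓ hℓ using hlen
  -- For each `j` in the window, the inner sum bounds the number of polynomials of degree `i - j`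
  -- that matter, and `ℓ j` is the length of the place in which the products land. The window is
  -- fixed, so only the inner sums vary; they are the left growth up to shifts.
  have hgr : Growth t (fun i => ∑ j ∈ Finset.Ioc (n₂ - D) n₂,
      (∑ c, Module.length A (Coh K k (jγ c - (i - j)))) * (ℓ j : ℕ∞)) := by
    refine Growth.sum _ fun j _ => Growth.mul_const (Growth.sum _ fun c _ => ?_) _
    have := h.shift (-(j + jγ c))
    refine this.mono (Eventually.of_forall fun i => le_of_eq ?_)
    have e : jγ c - (i - j) = -(i + -(j + jγ c)) := by ring
    rw [e]
  refine hgr.mono ?_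
  filter_upwards [eventually_gt_atTop n₂] with i hi
  let U := (G.restrictScalars A).comap (Tot.of S k i)
  -- All products of a class with the chosen polynomials that land in the window. On `U` this map is
  -- injective.
  let F : Coh K k i →ₗ[A] (∀ j : Finset.Ioc (n₂ - D) n₂, s (i - j).toNat → Coh K k j) :=
    LinearMap.pi fun j => LinearMap.pi fun p => mulHom (S := S) p.1 i j
  have hF (x : Coh K k i) (hx : x ∈ U) (h0 : F x = 0) : x = 0 := by
    refine eq_zero_of_window (S := S) (D := D) (fun c => by exact_mod_cast hD c) hsoc i (by lia) x
      fun j hj hj' m hm p hp => ?_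
    obtain ⟨p', hp', hq⟩ := hs'' m p hp
    -- An arbitrary `p` may be replaced by a combination `p'` of the chosen polynomials, because the
    -- difference annihilates the nonpositive part and hence kills `G`.
    have h1 : mulHom (S := S) (p - p') i j x = 0 := by
      rw [mulHom_apply, hG _ hq _ hx, map_zero]
    have h2 : mulHom (S := S) p' i j x = 0 := by
      refine Submodule.span_induction (p := fun p' _ => mulHom (S := S) p' i j x = 0)
        ?_ ?_ ?_ ?_ hp'
      · intro q hq
        obtain rfl : m = (i - j).toNat := by lia
        exact congrFun (congrFun h0 ⟨j, Finset.mem_Ioc.2 ⟨hj, hj'⟩⟩) ⟨q, hq⟩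
      · simp [mulHom_apply]
      · intro a b _ _ ha hb
        rw [mulHom_apply] at ha hb ⊢
        rw [add_smul, map_add, ha, hb, add_zero]
      · intro a b _ hb
        rw [mulHom_apply] at hb ⊢
        rw [smul_assoc, map_smul, hb, smul_zero]
    rw [mulHom_apply] at h1 h2 ⊢
    rw [sub_smul, map_sub, h2, sub_zero] at h1
    exact h1
  have hle := length_le_add U ⊥ ⊤ F (fun _ _ => trivial) (fun x hx h0 => hF x hx h0)
  rw [Module.length_bot, zero_add, Module.length_top] at hle
  refine hle.trans ?_
  rw [Module.length_pi_of_fintype]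
  rw [← Finset.sum_coe_sort (Finset.Ioc (n₂ - (D : ℤ)) n₂)]
  refine Finset.sum_le_sum fun j _ => ?_
  rw [Module.length_pi, ENat.card_eq_coe_fintype_card, Fintype.card_coe, hℓ]
  refine mul_le_mul_left ((hs _).trans (le_of_eq ?_)) _
  have hj := (Finset.mem_Ioc.1 j.2)
  refine Finset.sum_congr rfl fun c _ => ?_
  have : jγ c - ((i - (j : ℤ)).toNat : ℤ) = jγ c - (i - j) := by lia
  rw [this]

/-- The growth of the cohomology in the positive places is bounded by the growth in the negative
places. -/
theorem growth_comparison [IsNoetherianRing A] [IsLocalRing A] [Fintype ι]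
    {M : Type u} [AddCommGroup M] [Module A M] [Module.Finite A M] (R : CompleteResolution A M)
    (S : CommSys R.cx ι) (k : Type u) [AddCommGroup k] [Module A k]
    (e : k ≃ₗ[A] A ⧸ maximalIdeal A) {t : ℕ} (n₁ n₂ : ℤ)
    (hgen : ∀ i < n₁, ∀ x : Coh R.cx k i, ∃ y : ∀ c, Coh R.cx k (i + S.deg c),
      x = ∑ c, Coh.precomp (S.f c) i _ rfl (y c))
    (hsoc : ∀ i > n₂, ∀ x : Coh R.cx k i,
      (∀ c, Coh.precomp (S.f c) (i - S.deg c) i (by lia) x = 0) → x = 0)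
    (h : Growth t (fun i => Module.length A (Coh R.cx k (-i)))) :
    Growth t (fun i => Module.length A (Coh R.cx k i)) := by
  classical
  have hfin := fun i => R.finite i
  have hmk (a : A) (ha : a ∈ maximalIdeal A) (x : k) : a • x = 0 := by
    refine e.injective ?_
    rw [map_smul, map_zero]
    obtain ⟨y, hy⟩ := Ideal.Quotient.mk_surjective (e x)
    rw [← hy]
    exact (Ideal.Quotient.eq_zero_iff_mem).2 (Ideal.mul_mem_right _ _ ha)
  have hkfin : Module.Finite A k := Module.Finite.equiv e.symm
  have hfl (i : ℤ) : IsFiniteLength A (Coh R.cx k i) :=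
    isFiniteLength_of_maximalIdeal_smul_eq_zero _ fun a ha => Coh.smul_eq_zero (hmk a ha) i
  -- One bound for all degrees that also reaches into the range where generation is known.
  obtain ⟨m, hm, hm'⟩ : ∃ m : ℕ, (∀ c, S.deg c ≤ m) ∧ -(m : ℤ) ≤ n₁ :=
    ⟨Finset.univ.sup S.deg + n₁.natAbs,
      fun c => (Finset.le_sup (Finset.mem_univ c)).trans (Nat.le_add_right _ _), by lia⟩
  have hgn := gen_eq_nonpos hm fun i hi => hgen i (by lia)
  have hnoeth : IsNoetherian (MvPolynomial ι A) (Tot.nonpos S k) := by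
    have : Module.Finite (MvPolynomial ι A) (Tot.nonpos S k) :=
      Module.Finite.iff_fg.2 (hgn ▸ Tot.gen_fg m)
    exact isNoetherian_of_isNoetherianRing_of_finite _ _
  have hsp (j : ℤ) : ∃ s : Finset (Coh R.cx k j), Submodule.span A (s : Set (Coh R.cx k j)) = ⊤ :=
    (inferInstance : Module.Finite A (Coh R.cx k j)).fg_top
  choose s hs using hsp
  let γ (c : Σ j : Finset.Icc (-(m : ℤ)) 0, s j) : Coh R.cx k (c.1 : ℤ) := c.2.1
  have hγ : Tot.nonpos S k ≤ Submodule.span (MvPolynomial ι A)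
      (Set.range fun c => Tot.of S k (c.1 : ℤ) (γ c)) := by
    rw [← hgn]
    refine Submodule.span_le.2 ?_
    rintro _ ⟨j, hj, hj', y, rfl⟩
    have h1 : y ∈ Submodule.span A (s j : Set (Coh R.cx k j)) := hs j ▸ trivial
    have h2 := Submodule.mem_map_of_mem (f := Tot.of S k j) h1
    rw [Submodule.map_span] at h2
    refine Submodule.span_mono ?_ (Submodule.span_le_restrictScalars A (MvPolynomial ι A) _ h2)
    rintro _ ⟨z, hz, rfl⟩
    exact ⟨⟨⟨j, Finset.mem_Icc.2 ⟨hj, hj'⟩⟩, ⟨z, hz⟩⟩, rfl⟩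
  -- By Hilbert's basis theorem, finitely many of the homogeneous annihilators generate the whole
  -- ideal.
  obtain ⟨T, hT, hTJ⟩ := (Submodule.fg_span_iff_fg_span_finset_subset (homogAnn S k)).1
    (IsNoetherian.noetherian (Ideal.span (homogAnn S k)))
  let B (T : Finset (MvPolynomial ι A)) : Submodule (MvPolynomial ι A) (Tot S k) :=
    ⨅ q ∈ T, Submodule.torsionBy _ _ q
  have hB (T : Finset (MvPolynomial ι A)) (x : Tot S k) : x ∈ B T ↔ ∀ q ∈ T, q • x = 0 := by
    simp [B]
  -- Dévissage to the coefficients `M` gives `p` congruent to `q ^ n` modulo the maximal ideal and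
  -- killing the nonpositive part, which includes place `0` and thus the class of `proj`. So `p`
  -- kills cohomology with any coefficients, and with values in `k` the congruence becomes an
  -- equality of operators.
  have hnil (q : MvPolynomial ι A) (hq : ∀ x ∈ Tot.nonpos S k, q • x = 0) :
      ∃ n, ∀ x : Tot S k, q ^ n • x = 0 := by
    obtain ⟨-, n, p, hp, hpq⟩ := noetherian_and_nilpotent S R.free k e hnoeth q hq M
    refine ⟨n, fun x => ?_⟩
    have h1 := Tot.smul_eq_zero_of_mem_map hmk _ hpq x
    have hpr : R.proj ∈ cocycles R.cx M 0 :=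
      (mem_cocycles 0 (-1) (by lia) _).2 fun x => R.proj_d x
    have h2 := smul_eq_zero_of_smul_proj R p ⟨R.proj, hpr⟩ rfl
      (hp _ (Tot.of_mem_nonpos 0 le_rfl _)) x
    rwa [sub_smul, h2, sub_zero] at h1
  have hT0 : Growth t (compLength S (B T)) := by
    refine growth_torsion (fun c : Σ j : Finset.Icc (-(m : ℤ)) 0, s j => (c.1 : ℤ)) γ hγ hfl n₂ hsoc
      (B T) (fun q hq x hx => ?_) h
    have hle : Ideal.span (T : Set (MvPolynomial ι A)) ≤
        LinearMap.ker (LinearMap.toSpanSingleton (MvPolynomial ι A) (Tot S k) x) :=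
      Submodule.span_le.2 fun q hq => (hB T x).1 hx q hq
    refine hle ?_
    have : q ∈ Submodule.span (MvPolynomial ι A) (homogAnn S k) := Submodule.subset_span hq
    rwa [hTJ] at this
  -- Drop the annihilation conditions one at a time; each dropped generator is nilpotent, so the
  -- growth is still controlled by its kernel.
  have hall (U : Finset (MvPolynomial ι A)) (hU : (U : Set (MvPolynomial ι A)) ⊆ homogAnn S k) :
      Growth t (compLength S (B U)) → Growth t (compLength S (⊤ : Submodule _ (Tot S k))) := by
    induction U using Finset.induction_on with
    | empty =>
      have : B ∅ = ⊤ := by simp [B]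
      rw [this]
      exact id
    | insert q U hq ih =>
      intro h
      obtain ⟨⟨d, hd⟩, hq0⟩ := hU (Finset.mem_insert_self q U)
      obtain ⟨L, hL⟩ := hnil q hq0
      refine ih (fun x hx => hU (Finset.mem_insert_of_mem hx)) ?_
      refine growth_of_nilpotent hd (B U) (B (insert q U)) (fun x _ => hL x) (fun x hx h0 => ?_) h
      refine (hB _ _).2 fun q' hq' => ?_
      obtain rfl | h' := Finset.mem_insert.1 hq'
      · exact h0
      · exact (hB _ _).1 hx _ h'
  refine (hall T hT hT0).mono (Filter.Eventually.of_forall fun i => ?_)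
  exact Module.length_le_of_injective (LinearMap.id.codRestrict _ fun x => trivial)
    fun x y hxy => congrArg Subtype.val hxy

end Comparison

end SymGrowth

end

noncomputable section

open CategoryTheory

namespace SymGrowth

/-! ### Chain maps to a shifted module. -/

section ShiftSingle

variable {A : Type u} [CommRing A]

/-- The complex which is `N` in degree `0`. -/
abbrev sgl (N : ModuleCat.{u} A) : CochainComplex (ModuleCat.{u} A) ℤ :=
  (HomologicalComplex.single (ModuleCat.{u} A) (ComplexShape.up ℤ) 0).obj N

variable {F G : CochainComplex (ModuleCat.{u} A) ℤ} {N : ModuleCat.{u} A}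

lemma shift_sgl_d (j i k : ℤ) : ((sgl N)⟦j⟧).d i k = 0 := by
  rw [CochainComplex.shiftFunctor_obj_d', HomologicalComplex.single_obj_d]
  exact smul_zero (A := (sgl N).X (i + j) ⟶ (sgl N).X (k + j)) j.negOnePow

variable (N) in
/-- The shift of a module, in the degree where it lives. -/
def shiftSglIso (j i : ℤ) (h : i + j = 0) : ((sgl N)⟦j⟧).X i ≅ N :=
  HomologicalComplex.singleObjXIsoOfEq (ComplexShape.up ℤ) 0 N (i + j) h

/-- The only interesting component of a map to a shift of a module. -/
def compSgl {j : ℤ} (α : F ⟶ (sgl N)⟦j⟧) (i : ℤ) (h : i + j = 0) : F.X i ⟶ N :=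
  α.f i ≫ (shiftSglIso N j i h).hom

lemma compSgl_add {j : ℤ} (α β : F ⟶ (sgl N)⟦j⟧) (i : ℤ) (h : i + j = 0) :
    compSgl (α + β) i h = compSgl α i h + compSgl β i h := by
  unfold compSgl
  rw [← Preadditive.add_comp]
  rfl

lemma compSgl_neg {j : ℤ} (α : F ⟶ (sgl N)⟦j⟧) (i : ℤ) (h : i + j = 0) :
    compSgl (-α) i h = -compSgl α i h := by
  unfold compSgl
  rw [← Preadditive.neg_comp]
  rfl

lemma compSgl_precomp {j : ℤ} (f : G ⟶ F) (α : F ⟶ (sgl N)⟦j⟧) (i : ℤ) (h : i + j = 0) :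
    compSgl (f ≫ α) i h = f.f i ≫ compSgl α i h :=
  Category.assoc _ _ _

lemma d_compSgl {j : ℤ} (α : F ⟶ (sgl N)⟦j⟧) (i' i : ℤ) (h : i + j = 0) :
    F.d i' i ≫ compSgl α i h = 0 := by
  have h1 : F.d i' i ≫ α.f i = 0 := by
    rw [← α.comm i' i, shift_sgl_d, Limits.comp_zero]
  rw [compSgl, reassoc_of% h1, Limits.zero_comp]

/-- The map to a shift of a module with a given component. -/
def mkSgl {j : ℤ} (i : ℤ) (h : i + j = 0) (b : F.X i ⟶ N) (hb : F.d (i - 1) i ≫ b = 0) :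
    F ⟶ (sgl N)⟦j⟧ where
  f i' := if h' : i' = i then (F.XIsoOfEq h').hom ≫ b ≫
    (shiftSglIso N j i' (by lia)).inv else 0
  comm' i' k hik := by
    rw [shift_sgl_d, Limits.comp_zero]
    split_ifs with hk
    · subst hk
      obtain rfl : i' = k - 1 := by simp only [ComplexShape.up_Rel] at hik; lia
      simp only [HomologicalComplex.XIsoOfEq_rfl, Iso.refl_hom]
      rw [Category.id_comp, reassoc_of% hb]
      exact Limits.zero_comp.symm
    · exact Limits.comp_zero.symm

lemma compSgl_mkSgl {j : ℤ} (i : ℤ) (h : i + j = 0) (b : F.X i ⟶ N) (hb : F.d (i - 1) i ≫ b = 0) :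
    compSgl (mkSgl i h b hb) i h = b := by
  have e : (mkSgl i h b hb).f i = b ≫ (shiftSglIso N j i h).inv := by
    simp only [mkSgl, dif_pos, HomologicalComplex.XIsoOfEq_rfl, Iso.refl_hom]
    exact Category.id_comp _
  rw [compSgl, e, Category.assoc, Iso.inv_hom_id, Category.comp_id]

lemma compSgl_comp {n j k : ℤ} (g : F ⟶ G⟦n⟧) (α : G ⟶ (sgl N)⟦j⟧) (h : j + n = k) (i i' : ℤ)
    (hi : i + n = i') (hi' : i' + j = 0) (hk : i + k = 0) :
    compSgl (ShiftedHom.comp g α h) i hk =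
      (show F.X i ⟶ G.X (i + n) from g.f i) ≫ (G.XIsoOfEq hi).hom ≫ compSgl α i' hi' := by
  subst hi
  have e : (ShiftedHom.comp g α h).f i = g.f i ≫ α.f (i + n) ≫
      ((sgl N).XIsoOfEq (show i + n + j = i + k by lia)).hom := by
    refine (HomologicalComplex.comp_f _ _ i).trans (congrArg (fun t => g.f i ≫ t) ?_)
    refine (HomologicalComplex.comp_f _ _ i).trans ?_
    rw [CochainComplex.shiftFunctorAdd'_inv_app_f']
    rfl
  have e2 : (show ((sgl N)⟦j⟧).X (i + n) ⟶ ((sgl N)⟦k⟧).X i from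
      ((sgl N).XIsoOfEq (show i + n + j = i + k by lia)).hom) ≫ (shiftSglIso N k i hk).hom =
      (shiftSglIso N j (i + n) hi').hom := by
    exact eqToHom_trans (show (sgl N).X (i + n + j) = (sgl N).X (i + k) by
      congr 1; lia) (show (sgl N).X (i + k) = N from if_pos hk)
  have e3 : (G.XIsoOfEq (rfl : i + n = i + n)).hom = 𝟙 _ := rfl
  rw [e3, Category.id_comp, compSgl, compSgl, ← e2]
  exact (congrArg (fun t => t ≫ (shiftSglIso N k i hk).hom) e).trans
    ((Category.assoc _ _ _).trans (congrArg (fun t => g.f i ≫ t) (Category.assoc _ _ _)))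

end ShiftSingle

end SymGrowth

end

noncomputable section

open CategoryTheory

namespace SymGrowth

/-! ### Morphisms in the derived category out of K-projective complexes. -/

section Lifting

variable {C : Type*} [Category* C] [Abelian C] [HasDerivedCategory C]

/-- From a K-projective complex, morphisms in the derived category are homotopy classes of chain
maps. -/
lemma exists_Q_map_eq {F X : CochainComplex C ℤ} [F.IsKProjective]
    (φ : DerivedCategory.Q.obj F ⟶ DerivedCategory.Q.obj X) :
    ∃ α : F ⟶ X, DerivedCategory.Q.map α = φ := by
  obtain ⟨g, hg⟩ := (CochainComplex.IsKProjective.Qh_map_bijective F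
    ((HomotopyCategory.quotient _ _).obj X)).surjective
    ((DerivedCategory.quotientCompQhIso _).hom.app F ≫ φ ≫
      (DerivedCategory.quotientCompQhIso _).inv.app _)
  obtain ⟨α, rfl⟩ := (HomotopyCategory.quotient _ _).map_surjective g
  refine ⟨α, ?_⟩
  rw [← cancel_epi ((DerivedCategory.quotientCompQhIso _).hom.app F),
    ← DerivedCategory.quotientCompQhIso_hom_naturality, hg]
  simp

lemma exists_shiftedHom_map_eq {F X : CochainComplex C ℤ} [F.IsKProjective] {j : ℤ}
    (φ : ShiftedHom (DerivedCategory.Q.obj F) (DerivedCategory.Q.obj X) j) :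
    ∃ α : ShiftedHom F X j, α.map DerivedCategory.Q = φ := by
  obtain ⟨α, hα⟩ := exists_Q_map_eq (F := F) (X := X⟦j⟧)
    (φ ≫ (DerivedCategory.Q.commShiftIso j).inv.app X)
  refine ⟨α, ?_⟩
  rw [ShiftedHom.map, hα, Category.assoc, Iso.inv_hom_id_app]
  exact Category.comp_id _

lemma shiftedHom_map_neg {F X : CochainComplex C ℤ} {j : ℤ} (α : ShiftedHom F X j) :
    (-α).map DerivedCategory.Q = -α.map DerivedCategory.Q := by
  rw [ShiftedHom.map, Functor.map_neg, Preadditive.neg_comp]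
  rfl

lemma nonempty_homotopy_zero {F X : CochainComplex C ℤ} [F.IsKProjective] (α : F ⟶ X)
    (h : DerivedCategory.Q.map α = 0) : Nonempty (Homotopy α 0) := by
  have h4 : (HomotopyCategory.quotient _ _).map α = (HomotopyCategory.quotient _ _).map 0 := by
    refine (CochainComplex.IsKProjective.Qh_map_bijective F _).injective ?_
    rw [← cancel_mono ((DerivedCategory.quotientCompQhIso _).hom.app _),
      DerivedCategory.quotientCompQhIso_hom_naturality,
      DerivedCategory.quotientCompQhIso_hom_naturality, h, Functor.map_zero]
  exact ⟨HomotopyCategory.homotopyOfEq _ _ h4⟩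

end Lifting

/-! ### Cocycles on a complete resolution representing elements of `Ext`. -/

section Represents

variable {A : Type u} [CommRing A]
  {K L : CochainComplex (ModuleCat.{u} A) ℤ} {Y : Type u} [AddCommGroup Y] [Module A Y]
  {N : Type u} [AddCommGroup N] [Module A N]

/-- The part in degrees `≤ 0` of a complex, as a resolution of `Y`. -/
structure Trunc (K : CochainComplex (ModuleCat.{u} A) ℤ) (Y : Type u) [AddCommGroup Y]
    [Module A Y] (proj : K.X 0 →ₗ[A] Y) where
  /-- The truncation. -/
  F : CochainComplex (ModuleCat.{u} A) ℤ
  /-- The projection. -/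
  q : K ⟶ F
  /-- The augmentation. -/
  p : F ⟶ sgl (ModuleCat.of A Y)
  isIso (i : ℤ) (h : i ≤ 0) : IsIso (q.f i)
  isZero (i : ℤ) (h : 0 < i) : Limits.IsZero (F.X i)
  fac : q.f 0 ≫ p.f 0 ≫ (HomologicalComplex.singleObjXSelf (ComplexShape.up ℤ) 0
    (ModuleCat.of A Y)).hom = ModuleCat.ofHom proj
  quasiIso : QuasiIso p

namespace Trunc

variable {proj : K.X 0 →ₗ[A] Y} (T : Trunc K Y proj)

/-- The truncation is a bounded above complex of projectives: free modules in degrees `≤ 0` and zero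
beyond. -/
lemma isKProjective (hK : ∀ i, Module.Free A (K.X i)) : T.F.IsKProjective := by
  have h1 (i : ℤ) : Projective (T.F.X i) := by
    by_cases hi : i ≤ 0
    · have := T.isIso i hi
      have : Projective (K.X i) := by
        have := hK i
        exact ModuleCat.projective_of_free (Module.Free.chooseBasis A (K.X i))
      exact Projective.of_iso (asIso (T.q.f i)) inferInstance
    · have h0 := T.isZero i (by lia)
      constructor
      intro E X f e _
      exact ⟨0, h0.eq_of_src _ _⟩
  have : T.F.IsStrictlyLE 0 := by
    rw [CochainComplex.isStrictlyLE_iff]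
    exact fun i hi => T.isZero i hi
  exact CochainComplex.isKProjective_of_projective T.F 0

variable [HasDerivedCategory.{w} (ModuleCat.{u} A)]

/-- The truncation is isomorphic to the module in the derived category. -/
def pQ : DerivedCategory.Q.obj T.F ⟶ single A Y := DerivedCategory.Q.map T.p

instance : IsIso T.pQ := by
  have := T.quasiIso
  exact inferInstanceAs (IsIso (DerivedCategory.Q.map T.p))

/-- The map in the derived category which is induced by a map to the shift of a module. -/
def mapSgl {j : ℤ} (α : T.F ⟶ (sgl (ModuleCat.of A N))⟦j⟧) :
    DerivedCategory.Q.obj T.F ⟶ (single A N)⟦j⟧ :=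
  ShiftedHom.map α DerivedCategory.Q

/-- A map `a : Kⁱ ⟶ N`, `i + j = 0`, represents an element of `Extʲ(Y, N)`. -/
def Represents {j : ℤ} (i : ℤ) (h : i + j = 0) (a : K.X i →ₗ[A] N)
    (ξ : ShiftedHom (single A Y) (single A N) j) : Prop :=
  ∃ α : T.F ⟶ (sgl (ModuleCat.of A N))⟦j⟧, T.q.f i ≫ compSgl α i h = ModuleCat.ofHom a ∧
    T.pQ ≫ ξ = T.mapSgl α

variable {T} {j : ℤ} {i : ℤ} {h : i + j = 0} {a b : K.X i →ₗ[A] N}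
  {ξ ξ' : ShiftedHom (single A Y) (single A N) j}

lemma Represents.add (ha : T.Represents i h a ξ) (hb : T.Represents i h b ξ') :
    T.Represents i h (a + b) (ξ + ξ') := by
  obtain ⟨α, h1, h2⟩ := ha
  obtain ⟨β, h3, h4⟩ := hb
  refine ⟨α + β, ?_, ?_⟩
  · rw [compSgl_add, Preadditive.comp_add, h1, h3]
    rfl
  · rw [Preadditive.comp_add, h2, h4]
    exact (ShiftedHom.map_add _ _ _).symm

lemma Represents.neg (ha : T.Represents i h a ξ) : T.Represents i h (-a) (-ξ) := by
  obtain ⟨α, h1, h2⟩ := ha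
  refine ⟨-α, ?_, ?_⟩
  · rw [compSgl_neg, Preadditive.comp_neg, h1]
    rfl
  · rw [Preadditive.comp_neg, h2]
    exact (shiftedHom_map_neg _).symm

variable (T) in
lemma Represents.zero (i : ℤ) (h : i + j = 0) :
    T.Represents i h (0 : K.X i →ₗ[A] N) (0 : ShiftedHom (single A Y) (single A N) j) := by
  refine ⟨0, ?_, ?_⟩
  · rw [compSgl, HomologicalComplex.zero_f, Limits.zero_comp, Limits.comp_zero]
    rfl
  · rw [Limits.comp_zero]
    exact (ShiftedHom.map_zero _).symm

lemma Represents.sub (ha : T.Represents i h a ξ) (hb : T.Represents i h b ξ') :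
    T.Represents i h (a - b) (ξ - ξ') := by
  rw [sub_eq_add_neg, sub_eq_add_neg]
  exact ha.add hb.neg

lemma Represents.sum {κ : Type*} (s : Finset κ) {a : κ → (K.X i →ₗ[A] N)}
    {ξ : κ → ShiftedHom (single A Y) (single A N) j}
    (ha : ∀ c ∈ s, T.Represents i h (a c) (ξ c)) :
    T.Represents i h (∑ c ∈ s, a c) (∑ c ∈ s, ξ c) := by
  classical
  induction s using Finset.induction_on with
  | empty => simpa using Represents.zero T i h
  | insert c s hc ih =>
    rw [Finset.sum_insert hc, Finset.sum_insert hc]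
    exact (ha c (by simp)).add (ih fun c hc => ha c (by simp [hc]))

lemma Represents.mem_cocycles (ha : T.Represents i h a ξ) : a ∈ cocycles K N i := by
  obtain ⟨α, h1, -⟩ := ha
  refine (SymGrowth.mem_cocycles i (i - 1) (by lia) a).2 fun x => ?_
  have e : K.d (i - 1) i ≫ ModuleCat.ofHom a = 0 := by
    rw [← h1, ← T.q.comm_assoc, d_compSgl, Limits.comp_zero]
  exact LinearMap.congr_fun (congrArg ModuleCat.Hom.hom e) x

variable (T) in
lemma exists_represents (hi : i ≤ 0) (h : i + j = 0) (a : cocycles K N i) :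
    ∃ ξ : ShiftedHom (single A Y) (single A N) j, T.Represents i h a.1 ξ := by
  have h0 := T.isIso i hi
  have h1 := T.isIso (i - 1) (by lia)
  let b : T.F.X i ⟶ ModuleCat.of A N := inv (T.q.f i) ≫ ModuleCat.ofHom a.1
  have hb : T.F.d (i - 1) i ≫ b = 0 := by
    rw [← cancel_epi (T.q.f (i - 1)), T.q.comm_assoc, Limits.comp_zero]
    simp only [b]
    rw [IsIso.hom_inv_id_assoc]
    ext x
    exact (SymGrowth.mem_cocycles i (i - 1) (by lia) a.1).1 a.2 x
  refine ⟨inv T.pQ ≫ T.mapSgl (mkSgl i h b hb),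
    mkSgl i h b hb, ?_, IsIso.hom_inv_id_assoc _ _⟩
  rw [compSgl_mkSgl]
  exact IsIso.hom_inv_id_assoc _ _

variable (T) in
lemma exists_cocycle (hK : ∀ i, Module.Free A (K.X i)) (h : i + j = 0)
    (ξ : ShiftedHom (single A Y) (single A N) j) :
    ∃ a : cocycles K N i, T.Represents i h a.1 ξ := by
  have := T.isKProjective hK
  obtain ⟨α, hα⟩ := exists_shiftedHom_map_eq (F := T.F) (X := sgl (ModuleCat.of A N)) (j := j)
    (T.pQ ≫ ξ)
  have hr : T.Represents i h (T.q.f i ≫ compSgl α i h).hom ξ := ⟨α, rfl, hα.symm⟩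
  exact ⟨⟨_, hr.mem_cocycles⟩, hr⟩

/-- Representing zero means that the chain map is null-homotopic. The shifted module has zero
differential, so only the term of the homotopy that factors through the differential of `K`
survives. -/
lemma Represents.exists_coboundary (hK : ∀ i, Module.Free A (K.X i)) 
    (ha : T.Represents i h a 0) (i' : ℤ) (hi' : i + 1 = i') :
    ∃ t : K.X i' →ₗ[A] N, ∀ x, a x = t ((K.d i i').hom x) := by
  have := T.isKProjective hK
  obtain ⟨α, h1, h2⟩ := ha
  have h3 : DerivedCategory.Q.map α = 0 := by
    rw [← cancel_mono ((DerivedCategory.Q.commShiftIso j).hom.app _), Limits.zero_comp]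
    exact h2.symm.trans Limits.comp_zero
  obtain ⟨H⟩ := nonempty_homotopy_zero α h3
  have h5 := H.comm i
  rw [dNext_eq H.hom (show (ComplexShape.up ℤ).Rel i i' from hi'),
    prevD_eq H.hom (show (ComplexShape.up ℤ).Rel (i - 1) i by simp), shift_sgl_d,
    Limits.comp_zero, HomologicalComplex.zero_f, add_zero, add_zero] at h5
  refine ⟨(T.q.f i' ≫ H.hom i' i ≫ (shiftSglIso _ j i h).hom).hom, fun x => ?_⟩
  have e : ModuleCat.ofHom a = K.d i i' ≫ T.q.f i' ≫ H.hom i' i ≫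
      (shiftSglIso _ j i h).hom := by
    rw [← h1, compSgl, h5, ← T.q.comm_assoc, Category.assoc]
  exact LinearMap.congr_fun (congrArg ModuleCat.Hom.hom e) x

end Trunc

end Represents

end SymGrowth

end

noncomputable section

open CategoryTheory

namespace SymGrowth

/-! ### Existence of truncations; compatibility of representatives with composition and comparison.
-/

section Operations

variable {A : Type u} [CommRing A] {K L : CochainComplex (ModuleCat.{u} A) ℤ}
  {Y : Type u} [AddCommGroup Y] [Module A Y] {N : Type u} [AddCommGroup N] [Module A N]

lemma comp_shiftedHom_comp {D : Type*} [Category* D] [HasShift D ℤ] {X Y Z : D} {n j k : ℤ}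
    {p : X ⟶ Y} {θ : ShiftedHom Y Y n} {γ : ShiftedHom X X n} {ξ : ShiftedHom Y Z j}
    {δ : ShiftedHom X Z j} (hθ : p ≫ θ = γ ≫ p⟦n⟧') (hξ : p ≫ ξ = δ) (h : j + n = k) :
    p ≫ θ.comp ξ h = γ.comp δ h := by
  subst hξ
  rw [ShiftedHom.comp, ShiftedHom.comp, Functor.map_comp, Category.assoc, ← Category.assoc p, hθ,
    Category.assoc]

namespace Trunc

variable {proj : K.X 0 →ₗ[A] Y} {T : Trunc K Y proj}

lemma isIso_ofHom_mkQ {X : ModuleCat.{u} A} (W : Submodule A X) (h : W = ⊥) :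
    IsIso (ModuleCat.ofHom W.mkQ) := by
  subst h
  rw [ConcreteCategory.isIso_iff_bijective]
  refine ⟨fun x y hxy => ?_, Submodule.mkQ_surjective _⟩
  have := (Submodule.Quotient.eq (⊥ : Submodule A X)).1 hxy
  exact sub_eq_zero.1 this

lemma exists_of_exact (hexact : ∀ i < 0, Function.Exact (K.d (i - 1) i).hom (K.d i (i + 1)).hom)
    (hproj : Function.Surjective proj) (h0 : Function.Exact (K.d (-1) 0).hom proj) :
    Nonempty (Trunc K Y proj) := by
  -- Brutal truncation written as a quotient in every degree, by everything or by nothing, so that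
  -- the projection and the differentials need no case distinction.
  let W (i : ℤ) : Submodule A (K.X i) := if 0 < i then ⊤ else ⊥
  have hW (i : ℤ) (hi : i ≤ 0) : W i = ⊥ := if_neg (by lia)
  have hW' (i : ℤ) (hi : 0 < i) : W i = ⊤ := if_pos hi
  have hd (i j : ℤ) : W i ≤ (W j).comap (K.d i j).hom := by
    by_cases hij : i + 1 = j
    · by_cases hi : 0 < i
      · rw [hW' j (by lia), Submodule.comap_top]
        exact le_top
      · rw [hW i (by lia)]
        exact bot_le
    · intro x _
      rw [Submodule.mem_comap, K.shape i j hij]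
      exact Submodule.zero_mem _
  let F : CochainComplex (ModuleCat.{u} A) ℤ :=
    { X := fun i => ModuleCat.of A (K.X i ⧸ W i)
      d := fun i j => ModuleCat.ofHom (Submodule.mapQ (W i) (W j) (K.d i j).hom (hd i j))
      shape := fun i j hij => by
        ext x
        have := LinearMap.congr_fun (congrArg ModuleCat.Hom.hom (K.shape i j hij)) x
        exact congrArg (W j).mkQ this
      d_comp_d' := fun i j k _ _ => by
        ext x
        have := LinearMap.congr_fun (congrArg ModuleCat.Hom.hom (K.d_comp_d i j k)) x
        exact congrArg (W k).mkQ this }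
  let q : K ⟶ F :=
    { f := fun i => ModuleCat.ofHom (W i).mkQ
      comm' := fun i j _ => rfl }
  have hqs (i : ℤ) : Function.Surjective (q.f i).hom := Submodule.mkQ_surjective _
  have hqi (i : ℤ) (hi : i ≤ 0) : IsIso (q.f i) := isIso_ofHom_mkQ (X := K.X i) (W i) (hW i hi)
  have hqinj (i : ℤ) (hi : i ≤ 0) : Function.Injective (q.f i).hom :=
    ((ConcreteCategory.isIso_iff_bijective (q.f i)).1 (hqi i hi)).1
  have hFz (i : ℤ) (hi : 0 < i) : Limits.IsZero (F.X i) := by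
    have : Subsingleton (F.X i) := by
      change Subsingleton (K.X i ⧸ W i)
      rw [hW' i hi]
      infer_instance
    exact ModuleCat.isZero_of_subsingleton _
  let φ : F.X 0 ⟶ ModuleCat.of A Y := ModuleCat.ofHom ((W 0).liftQ proj (by
    rw [hW 0 le_rfl]
    exact bot_le))
  have hφ (i : ℤ) (hi : (ComplexShape.up ℤ).Rel i 0) : F.d i 0 ≫ φ = 0 := by
    obtain rfl : i = -1 := by simp only [ComplexShape.up_Rel] at hi; lia
    ext x
    exact h0.apply_apply_eq_zero x
  let p : F ⟶ sgl (ModuleCat.of A Y) := HomologicalComplex.mkHomToSingle φ hφ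
  have hp0 : p.f 0 ≫ (HomologicalComplex.singleObjXSelf (ComplexShape.up ℤ) 0
      (ModuleCat.of A Y)).hom = φ := by
    rw [HomologicalComplex.mkHomToSingle_f, Category.assoc, Iso.inv_hom_id, Category.comp_id]
  have hqp (i : ℤ) : QuasiIsoAt p i := by
    obtain hi | rfl | hi := lt_trichotomy i 0
    · rw [quasiIsoAt_iff_exactAt' p i (HomologicalComplex.exactAt_single_obj _ _ _ _ hi.ne),
        HomologicalComplex.exactAt_iff' F (i - 1) i (i + 1) (by simp) (by simp),
        ShortComplex.moduleCat_exact_iff]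
      intro x hx
      obtain ⟨x, rfl⟩ := hqs i x
      have h1 : (q.f (i + 1)).hom ((K.d i (i + 1)).hom x) = 0 := hx
      obtain ⟨y, hy⟩ := (hexact i hi x).1 (hqinj (i + 1) (by lia) (h1.trans (map_zero _).symm))
      exact ⟨(q.f (i - 1)).hom y, congrArg (q.f i).hom hy⟩
    · rw [quasiIsoAt_iff' p (-1) 0 1 (by simp) (by simp), ShortComplex.quasiIso_iff_of_zeros']
      · have e : p.f 0 = φ ≫ (HomologicalComplex.singleObjXSelf (ComplexShape.up ℤ) 0
            (ModuleCat.of A Y)).inv := by rw [← hp0, Category.assoc, Iso.hom_inv_id,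
              Category.comp_id]
        constructor
        · rw [ShortComplex.moduleCat_exact_iff]
          intro x hx
          obtain ⟨x, rfl⟩ := hqs 0 x
          have h1 : φ.hom ((q.f 0).hom x) = 0 := by
            rw [← hp0]
            exact (congrArg (HomologicalComplex.singleObjXSelf (ComplexShape.up ℤ) 0
              (ModuleCat.of A Y)).hom.hom hx).trans (map_zero _)
          obtain ⟨y, hy⟩ := (h0 x).1 h1
          exact ⟨(q.f (-1)).hom y, congrArg (q.f 0).hom hy⟩
        · have : Epi φ := by
            rw [ModuleCat.epi_iff_surjective]
            intro y
            obtain ⟨x, rfl⟩ := hproj y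
            exact ⟨(q.f 0).hom x, rfl⟩
          change Epi (p.f 0)
          rw [e]
          infer_instance
      · exact (hFz 1 (by lia)).eq_of_tgt _ _
      · rfl
      · rfl
    · rw [quasiIsoAt_iff_exactAt' p i (HomologicalComplex.exactAt_single_obj _ _ _ _ hi.ne')]
      exact ShortComplex.exact_of_isZero_X₂ _ (hFz i hi)
  refine ⟨⟨F, q, p, hqi, hFz, ?_, ⟨hqp⟩⟩⟩
  rw [hp0]
  rfl

variable [HasDerivedCategory.{w} (ModuleCat.{u} A)]

lemma Represents.comp {n j k : ℤ} {f : K ⟶ K⟦n⟧} {g : T.F ⟶ T.F⟦n⟧}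
    (hg : T.q ≫ g = f ≫ T.q⟦n⟧') {θ : ShiftedHom (single A Y) (single A Y) n}
    (hθ : T.pQ ≫ θ = ShiftedHom.map g DerivedCategory.Q ≫ T.pQ⟦n⟧') {i' : ℤ} {h' : i' + j = 0}
    {a : K.X i' →ₗ[A] N} {ξ : ShiftedHom (single A Y) (single A N) j}
    (hξ : T.Represents i' h' a ξ) (h : j + n = k) (i : ℤ) (hi : i + n = i') (hk : i + k = 0) :
    T.Represents i hk (a ∘ₗ (shiftComponent f i i' hi).hom) (θ.comp ξ h) := by
  obtain ⟨α, h1, h2⟩ := hξ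
  refine ⟨ShiftedHom.comp g α h, ?_, ?_⟩
  · subst hi
    rw [compSgl_comp g α h i _ rfl h' hk]
    have e1 : T.q.f i ≫ g.f i = f.f i ≫ (show (K⟦n⟧).X i ⟶ (T.F⟦n⟧).X i from T.q.f (i + n)) :=
      congrArg (fun t => HomologicalComplex.Hom.f t i) hg
    have e2 : (T.F.XIsoOfEq (rfl : i + n = i + n)).hom = 𝟙 _ := rfl
    have e3 : (shiftComponent f i (i + n) rfl) = f.f i := Category.comp_id _
    have e4 : ModuleCat.ofHom (a ∘ₗ (shiftComponent f i (i + n) rfl).hom) =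
      shiftComponent f i (i + n) rfl ≫ ModuleCat.ofHom a := rfl
    rw [e2, Category.id_comp, e4, e3, ← h1]
    exact (Category.assoc _ _ _).symm.trans ((congrArg (fun t => t ≫ compSgl α (i + n) h') e1).trans
      (Category.assoc _ _ _))
  · exact (comp_shiftedHom_comp hθ h2 h).trans (ShiftedHom.map_comp g α h DerivedCategory.Q).symm

/-- A comparison map over the identity of `Y` descends to a map of truncations over `Y`, by
inverting the projection in degrees `≤ 0`. Composing with it does not change the class in the
derived category. -/
lemma Represents.of_strictMap {proj' : L.X 0 →ₗ[A] Y} {T' : Trunc L Y proj'}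
    (u : StrictMap K L 0) (hu : ∀ x, proj' (u.app 0 0 rfl x) = proj x) {i j : ℤ} {h : i + j = 0}
    (hi : i ≤ 0) {a : L.X i →ₗ[A] N} {ξ : ShiftedHom (single A Y) (single A N) j}
    (hξ : T'.Represents i h a ξ) : T.Represents i h (a ∘ₗ u.app i i (add_zero i)) ξ := by
  classical
  let U (i : ℤ) : T.F.X i ⟶ T'.F.X i := if hi : i ≤ 0 then
    haveI := T.isIso i hi
    inv (T.q.f i) ≫ ModuleCat.ofHom (u.app i i (add_zero i)) ≫ T'.q.f i else 0
  have hU (i : ℤ) (hi : i ≤ 0) : T.q.f i ≫ U i =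
      ModuleCat.ofHom (u.app i i (add_zero i)) ≫ T'.q.f i := by
    have := T.isIso i hi
    simp only [U, dif_pos hi, IsIso.hom_inv_id_assoc]
  let U' : T.F ⟶ T'.F :=
    { f := U
      comm' := fun i i' hi' => by
        simp only [ComplexShape.up_Rel] at hi'
        by_cases h0 : 0 < i'
        · exact (T'.isZero i' h0).eq_of_tgt _ _
        · have := T.isIso i (by lia)
          rw [← cancel_epi (T.q.f i), ← Category.assoc, hU i (by lia), T.q.comm_assoc,
            hU i' (by lia), Category.assoc, T'.q.comm]
          have e : ModuleCat.ofHom (u.app i i (add_zero i)) ≫ L.d i i' =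
              K.d i i' ≫ ModuleCat.ofHom (u.app i' i' (add_zero i')) := by
            ext x
            exact u.comm i i i' i' _ _ hi' x
          rw [reassoc_of% e] }
  have hp : U' ≫ T'.p = T.p := by
    refine HomologicalComplex.to_single_hom_ext ?_
    have := T.isIso 0 le_rfl
    rw [← cancel_epi (T.q.f 0), HomologicalComplex.comp_f, ← Category.assoc, hU 0 le_rfl,
      ← cancel_mono (HomologicalComplex.singleObjXSelf (ComplexShape.up ℤ) 0
        (ModuleCat.of A Y)).hom, Category.assoc, Category.assoc, Category.assoc, T.fac, T'.fac]
    ext x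
    exact hu x
  obtain ⟨α, h1, h2⟩ := hξ
  refine ⟨U' ≫ α, ?_, ?_⟩
  · rw [compSgl_precomp, ← Category.assoc, hU i hi, Category.assoc, h1]
    rfl
  · have e : T.pQ = DerivedCategory.Q.map U' ≫ T'.pQ := by
      have := congrArg (fun t => DerivedCategory.Q.map t) hp
      exact this.symm.trans (Functor.map_comp _ _ _)
    rw [e, Category.assoc, h2]
    have e' : DerivedCategory.Q.map (U' ≫ α) = DerivedCategory.Q.map U' ≫ DerivedCategory.Q.map α :=
      Functor.map_comp _ _ _
    exact (Category.assoc _ _ _).symm.trans (congrArg (fun t => t ≫ _) e'.symm)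

variable (T) in
lemma represents_proj : T.Represents 0 (add_zero 0) proj
    (ShiftedHom.mk₀ (0 : ℤ) rfl (𝟙 (single A Y))) := by
  refine ⟨ShiftedHom.mk₀ (0 : ℤ) rfl T.p, ?_, ?_⟩
  · rw [← T.fac]
    refine congrArg (fun t => T.q.f 0 ≫ t) ?_
    have e : (ShiftedHom.mk₀ (0 : ℤ) rfl T.p).f 0 = T.p.f 0 ≫
        ((sgl (ModuleCat.of A Y)).XIsoOfEq (show (0 : ℤ) = 0 + 0 by lia)).hom := by
      refine (HomologicalComplex.comp_f _ _ 0).trans (congrArg (fun t => T.p.f 0 ≫ t) ?_)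
      rw [shiftFunctorZero', eqToIso_refl, Iso.refl_trans]
      exact CochainComplex.shiftFunctorZero_inv_app_f _ _
    exact (congrArg (fun t => t ≫ (shiftSglIso _ 0 0 (add_zero 0)).hom) e).trans
      (Category.comp_id _)
  · refine Eq.trans ?_ (ShiftedHom.map_mk₀ 0 rfl T.p DerivedCategory.Q).symm
    rw [ShiftedHom.mk₀, Category.id_comp]
    rfl

end Trunc

end Operations

end SymGrowth

end

noncomputable section

open CategoryTheory

namespace SymGrowth

namespace CentralAction

variable {C : Type*} [Category* C] [HasShift C ℤ]

/-! ### Turning left multiples by central elements into right multiples. -/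

section Center

variable {d : ℤ} (f : 𝟭 C ⟶ shiftFunctor C d)

/-- The functor `F` carries the components of `f` to multiples of components of `f`. -/
def Compatible (F : C ⥤ C) : Prop :=
  ∀ Y : C, ∃ e : (F.obj Y)⟦d⟧ ⟶ F.obj (Y⟦d⟧), F.map (f.app Y) = f.app (F.obj Y) ≫ e

variable {f}

lemma Compatible.of_iso {F G : C ⥤ C} (hF : Compatible f F) (α : F ≅ G) : Compatible f G := by
  intro Y
  obtain ⟨e, he⟩ := hF Y
  refine ⟨(α.inv.app Y)⟦d⟧' ≫ e ≫ α.hom.app _, ?_⟩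
  have h1 := f.naturality (α.inv.app Y)
  have h2 := α.hom.naturality (f.app Y)
  dsimp at h1 h2
  rw [← Category.assoc, ← h1, Category.assoc, ← Category.assoc (f.app _), ← he]
  have h3 : F.map (f.app Y) ≫ α.hom.app (Y⟦d⟧) = α.hom.app Y ≫ G.map (f.app Y) := h2
  rw [h3, Iso.inv_hom_id_app_assoc]

variable (f) in
lemma Compatible.id : Compatible f (𝟭 C) := fun _ => ⟨𝟙 _, (Category.comp_id _).symm⟩

lemma Compatible.comp {F G : C ⥤ C} (hF : Compatible f F) (hG : Compatible f G) :
    Compatible f (F ⋙ G) := by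
  intro Y
  obtain ⟨e, he⟩ := hF Y
  obtain ⟨e', he'⟩ := hG (F.obj Y)
  refine ⟨e' ≫ G.map e, ?_⟩
  have h1 : (F ⋙ G).map (f.app Y) = G.map (F.map (f.app Y)) := rfl
  rw [h1, he, Functor.map_comp, he', Category.assoc]
  rfl

variable [Preadditive C] [∀ n : ℤ, (shiftFunctor C n).Additive]

/-- The definition of the graded center only speaks of the shift by `1`. Compatibility passes to
composites and to isomorphic functors, and to the shift by `-1` because the shift by `1` is fully
faithful. Leaving the factor `e` unspecified absorbs all signs and coherence isomorphisms. -/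
lemma compatible_shift (hf : f ∈ gradedCenter C d) (m : ℤ) : Compatible f (shiftFunctor C m) := by
  have h1 : Compatible f (shiftFunctor C (1 : ℤ)) := by
    intro Y
    refine ⟨d.negOnePow • (shiftFunctorComm C d 1).inv.app Y, ?_⟩
    rw [hf Y, Linear.comp_units_smul, Linear.units_smul_comp, smul_smul, Int.units_mul_self,
      one_smul, Category.assoc, Iso.hom_inv_id_app]
    exact (Category.comp_id _).symm
  have h2 : Compatible f (shiftFunctor C (-1 : ℤ)) := by
    intro Y
    obtain ⟨e, he⟩ := (Compatible.id f).of_iso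
      (shiftFunctorCompIsoId C (-1 : ℤ) 1 (by lia)).symm Y
    have h3 := hf (Y⟦(-1 : ℤ)⟧)
    obtain ⟨e', he'⟩ := (shiftFunctor C (1 : ℤ)).map_surjective
      (d.negOnePow • ((shiftFunctorComm C d 1).hom.app (Y⟦(-1 : ℤ)⟧) ≫ e))
    refine ⟨e', (shiftFunctor C (1 : ℤ)).map_injective ?_⟩
    rw [Functor.map_comp, he', Linear.comp_units_smul, ← Category.assoc,
      ← Linear.units_smul_comp]
    refine Eq.trans he ?_
    exact congrArg (fun t => t ≫ e) h3
  induction m using Int.induction_on with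
  | zero => exact (Compatible.id f).of_iso (shiftFunctorZero C ℤ).symm
  | succ i ih => exact (ih.comp h1).of_iso (shiftFunctorAdd' C (i : ℤ) 1 _ rfl).symm
  | pred i ih => exact (ih.comp h2).of_iso (shiftFunctorAdd' C (-(i : ℤ)) (-1) _ rfl).symm

/-- Left multiples by a central element are right multiples. -/
lemma exists_comp_centerApp (f : gradedCenter C d) {X Y : C} {m n : ℤ} (y : ShiftedHom X Y m)
    (h : d + m = n) (h' : m + d = n) :
    ∃ y' : ShiftedHom X Y m, y.comp (centerApp f Y) h = (centerApp f X).comp y' h' := by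
  obtain ⟨e, he⟩ := compatible_shift f.2 m Y
  obtain ⟨y', hy'⟩ := (shiftFunctor C d).map_surjective (y⟦d⟧' ≫ e ≫
    (shiftFunctorAdd' C d m n h).inv.app Y ≫ (shiftFunctorAdd' C m d n h').hom.app Y)
  refine ⟨y', ?_⟩
  have h1 : y ≫ f.1.app (Y⟦m⟧) = f.1.app X ≫ y⟦d⟧' := f.1.naturality y
  have h2 : (centerApp f Y)⟦m⟧' = f.1.app (Y⟦m⟧) ≫ e := he
  rw [ShiftedHom.comp, ShiftedHom.comp, hy', h2]
  simp only [Category.assoc, Iso.hom_inv_id_app]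
  rw [← Category.assoc y, h1, Category.assoc, centerApp]
  erw [Category.comp_id]

end Center

variable [Preadditive C] [∀ n : ℤ, (shiftFunctor C n).Additive] {H : Type*} [Ring H]
  {𝓗 : ℕ → AddSubgroup H} [GradedRing 𝓗] (ζ : CentralAction C 𝓗)

section Commutation

lemma φ_mul (m n k : ℕ) (hk : m + n = k) (η : 𝓗 m) (θ : 𝓗 n) (h : (η : H) * θ ∈ 𝓗 k) (X : C) :
    ζ.φ X ⟨_, h⟩ = (ζ.φ X θ).comp (ζ.φ X η) (by rw [← hk, Nat.cast_add]) := by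
  subst hk
  exact ζ.map_mul m n η θ X

lemma φ_comp_comm {m n : ℕ} (η : 𝓗 m) (θ : 𝓗 n) (h : (η : H) * θ = θ * η) (X : C) (k : ℤ)
    (hk : (m : ℤ) + n = k) (hk' : (n : ℤ) + m = k) :
    (ζ.φ X θ).comp (ζ.φ X η) hk = (ζ.φ X η).comp (ζ.φ X θ) hk' := by
  obtain rfl : k = ((m + n : ℕ) : ℤ) := by rw [← hk, Nat.cast_add]
  have h1 : (η : H) * θ ∈ 𝓗 (m + n) := SetLike.mul_mem_graded η.2 θ.2
  have h2 : (θ : H) * η ∈ 𝓗 (m + n) := h ▸ h1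
  rw [← ζ.φ_mul m n _ rfl η θ h1 X, ← ζ.φ_mul n m _ (add_comm _ _) θ η h2 X]
  exact congrArg (fun t => ζ.φ X t) (Subtype.ext h)

end Commutation

/-! ### Finitely many generators of positive even degree. -/

section Generators

variable {X Y : C}

lemma extComponent_smul_extOf (h : H) (m n : ℤ) (e : ℕ) (he : (e : ℤ) + m = n)
    (θ : ζ.ExtDeg X Y m) :
    ζ.extComponent X Y n (h • ζ.extOf X Y m θ) =
      ζ.mulLeft X Y e m n he (DirectSum.decompose 𝓗 h e) θ := by
  induction h using DirectSum.Decomposition.inductionOn 𝓗 with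
  | zero => simp
  | add a b ha hb =>
    rw [add_smul, map_add, ha, hb, DirectSum.decompose_add, DirectSum.add_apply, map_add]
    rfl
  | homogeneous a =>
    rename_i d
    rw [ζ.smul_extOf X Y a m _ rfl]
    by_cases hd : d = e
    · subst hd
      obtain rfl := he
      rw [extComponent_extOf_self, DirectSum.decompose_coe, DirectSum.of_eq_same]
    · rw [ζ.extComponent_extOf_ne _ _ _ _ (by lia), DirectSum.decompose_coe,
        DirectSum.of_eq_of_ne _ _ _ (Ne.symm hd), map_zero]
      rfl

/-- A homogeneous element in the span of finitely many homogeneous elements of smaller degree is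
a combination with homogeneous coefficients. -/
lemma exists_homogeneous_coefficients {κ : Type*} [Fintype κ] (m : κ → ℤ)
    (ξ : ∀ c, ζ.ExtDeg X Y (m c)) {n : ℤ} (hn : ∀ c, m c ≤ n) (θ : ζ.ExtDeg X Y n)
    (h : ζ.extOf X Y n θ ∈ Submodule.span H (Set.range fun c => ζ.extOf X Y (m c) (ξ c))) :
    ∃ η : ∀ c, 𝓗 (n - m c).toNat,
      ζ.extOf X Y n θ = ∑ c, (η c : H) • ζ.extOf X Y (m c) (ξ c) := by
  obtain ⟨a, ha⟩ := (Submodule.mem_span_range_iff_exists_fun H).1 h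
  have he (c : κ) : ((n - m c).toNat : ℤ) + m c = n := by have := hn c; lia
  refine ⟨fun c => DirectSum.decompose 𝓗 (a c) (n - m c).toNat, ?_⟩
  have h1 := congrArg (fun t => ζ.extOf X Y n (ζ.extComponent X Y n t)) ha
  simp only [map_sum, extComponent_extOf_self] at h1
  rw [← h1]
  refine Finset.sum_congr rfl fun c _ => ?_
  rw [ζ.extComponent_smul_extOf _ _ _ _ (he c), ζ.smul_extOf X Y _ _ _ (he c)]

/-- The multiples of homogeneous elements of degree at least `n₀` by homogeneous elements whose
degree lies in `D`. -/
def multiples (ζ : CentralAction C 𝓗) (X Y : C) (n₀ : ℤ) (D : Set ℕ) : Set (ζ.ExtTotal X Y) :=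
  {x | ∃ d ∈ D, ∃ η : 𝓗 d, ∃ n ≥ n₀, ∃ θ : ζ.ExtDeg X Y n, x = (η : H) • ζ.extOf X Y n θ}

/-- No finiteness of `H` itself is available, so the elements of `H` are extracted from the
Noetherian module: a span inside it is generated by finitely many members of the spanning set, and
each of these displays its multiplier. -/
lemma exists_finite_multiples (n₀ : ℤ) [IsNoetherian H (ζ.extGE X Y n₀)] (D : Set ℕ) :
    ∃ (r : ℕ) (d : Fin r → ℕ) (η : ∀ c, 𝓗 (d c)) (m : Fin r → ℤ) (ξ : ∀ c, ζ.ExtDeg X Y (m c)),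
      (∀ c, d c ∈ D) ∧ (∀ c, n₀ ≤ m c) ∧
      Submodule.span H (ζ.multiples X Y n₀ D) =
        Submodule.span H (Set.range fun c => ζ.extOf X Y (d c + m c)
          (ζ.mulLeft X Y (d c) (m c) _ rfl (η c) (ξ c))) := by
  have hle : Submodule.span H (ζ.multiples X Y n₀ D) ≤ ζ.extGE X Y n₀ := by
    refine Submodule.span_le.2 ?_
    rintro _ ⟨d, -, η, n, hn, θ, rfl⟩
    refine (ζ.extGE X Y n₀).smul_mem _ fun k hk => ?_
    exact ζ.extComponent_extOf_ne X Y _ _ (by lia) _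
  have hfg := isNoetherian_submodule.1 ‹IsNoetherian H (ζ.extGE X Y n₀)› _ hle
  obtain ⟨t, ht, hspan⟩ := (Submodule.fg_span_iff_fg_span_finset_subset _).1 hfg
  choose d hd η m hm ξ hx using fun c : Fin t.card => ht (t.equivFin.symm c).2
  refine ⟨t.card, d, η, m, ξ, hd, hm, hspan.trans (congrArg _ ?_)⟩
  ext x
  constructor
  · intro hxt
    refine ⟨t.equivFin ⟨x, hxt⟩, ?_⟩
    have := hx (t.equivFin ⟨x, hxt⟩)
    rw [Equiv.symm_apply_apply, ζ.smul_extOf X Y _ _ _ rfl] at this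
    exact this.symm
  · rintro ⟨c, rfl⟩
    have := hx c
    rw [ζ.smul_extOf X Y _ _ _ rfl] at this
    change ζ.extOf X Y _ _ ∈ t
    rw [← this]
    exact (t.equivFin.symm c).2

/-- If `Ext(X, Y)` is eventually Noetherian, then finitely many elements of positive even degree
generate the high degrees in terms of the lower ones. -/
lemma exists_even_generators
    (hcomm : ∀ (m n : ℕ), ∀ η ∈ 𝓗 m, ∀ θ ∈ 𝓗 n, η * θ = (-1) ^ (m * n) * (θ * η))
    (h : ζ.IsNoethFL X Y) :
    ∃ (r : ℕ) (d : Fin r → ℕ) (η : ∀ c, 𝓗 (d c)) (n₁ : ℤ), (∀ c, 0 < d c ∧ Even (d c)) ∧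
      ∀ n ≥ n₁, ∀ θ : ShiftedHom X Y n, ∃ y : ∀ c, ShiftedHom X Y (n - d c),
        θ = ∑ c, (y c).comp (ζ.φ Y (η c)) (by lia) := by
  obtain ⟨n₀, hN, -⟩ := h
  have bound {r : ℕ} (m : Fin r → ℤ) : ∃ b : ℤ, ∀ c, m c < b := by
    obtain ⟨b, hb⟩ := (Set.finite_range m).bddAbove
    exact ⟨b + 1, fun c => Int.lt_add_one_of_le (hb ⟨c, rfl⟩)⟩
  let E : Set ℕ := {d | 0 < d ∧ Even d}
  obtain ⟨r₀, d₀, η₀, m₀, ξ₀, hd₀, hm₀, hs₀⟩ := ζ.exists_finite_multiples (X := X) (Y := Y) n₀ {0}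
  obtain ⟨r₁, d₁, η₁, m₁, ξ₁, hd₁, hm₁, hs₁⟩ :=
    ζ.exists_finite_multiples (X := X) (Y := Y) n₀ {d | 0 < d}
  obtain ⟨r, d, η, m, ξ, hd, hm, hs⟩ := ζ.exists_finite_multiples (X := X) (Y := Y) n₀ E
  obtain ⟨b₀, hb₀⟩ := bound fun c => d₀ c + m₀ c
  obtain ⟨b₁, hb₁⟩ := bound fun c => d₁ c + m₁ c
  obtain ⟨b, hb⟩ := bound fun c => d c + m c
  refine ⟨r, d, η, max (max b₀ b₁) (max b n₀), hd, fun n hn θ => ?_⟩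
  have hn0 : b₀ ≤ n := by lia
  have hn1 : b₁ ≤ n := by lia
  have hn2 : b ≤ n := by lia
  have hn3 : n₀ ≤ n := by lia
  -- The trivial multiple `1 • θ`: the generators found for degree `0` span everything from `n₀` on.
  -- As they all have degree below `n`, the coefficients in the resulting expansion of `θ` have
  -- positive degree.
  have mem₀ : ζ.extOf X Y n θ ∈ Submodule.span H (ζ.multiples X Y n₀ {0}) := by
    refine Submodule.subset_span ⟨0, rfl, ⟨1, SetLike.one_mem_graded 𝓗⟩, n, hn3, θ, ?_⟩
    exact (one_smul H _).symm
  rw [hs₀] at mem₀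
  obtain ⟨a, ha⟩ := ζ.exists_homogeneous_coefficients _ _
    (fun c => ((hb₀ c).trans_le hn0).le) θ mem₀
  have mem₁ : ζ.extOf X Y n θ ∈ Submodule.span H (ζ.multiples X Y n₀ {d | 0 < d}) := by
    rw [ha]
    refine Submodule.sum_mem _ fun c _ => Submodule.subset_span
      ⟨_, ?_, a c, _, ?_, _, rfl⟩
    · have := hb₀ c
      change 0 < _
      lia
    · have := hm₀ c
      lia
  rw [hs₁] at mem₁
  obtain ⟨a, ha⟩ := ζ.exists_homogeneous_coefficients _ _
    (fun c => ((hb₁ c).trans_le hn1).le) θ mem₁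
  -- A second expansion presents `θ` by products of two elements of positive degree. One of the two
  -- is even, or else both are odd and their product is even.
  have mem₂ : ζ.extOf X Y n θ ∈ Submodule.span H (ζ.multiples X Y n₀ E) := by
    rw [ha]
    refine Submodule.sum_mem _ fun c _ => ?_
    have h1 := hb₁ c
    have h2 := hm₁ c
    have h3 : 0 < d₁ c := hd₁ c
    by_cases he : Even (n - (d₁ c + m₁ c)).toNat
    · exact Submodule.subset_span ⟨_, ⟨by lia, he⟩, a c, _, by lia, _, rfl⟩
    · rw [← ζ.smul_extOf X Y (η₁ c) _ _ rfl]
      by_cases ho : Even (d₁ c)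
      · exact Submodule.smul_mem _ _ (Submodule.subset_span ⟨_, ⟨h3, ho⟩, η₁ c, _, h2, _, rfl⟩)
      · rw [smul_smul]
        refine Submodule.subset_span ⟨_, ⟨by lia, ?_⟩,
          ⟨_, SetLike.mul_mem_graded (a c).2 (η₁ c).2⟩, _, h2, _, rfl⟩
        rw [Nat.not_even_iff_odd] at he ho
        exact he.add_odd ho
  rw [hs] at mem₂
  obtain ⟨a, ha⟩ := ζ.exists_homogeneous_coefficients _ _
    (fun c => ((hb c).trans_le hn2).le) θ mem₂
  have hdeg (c : Fin r) : ((n - (d c + m c)).toNat : ℤ) + m c = n - d c := by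
    have := hb c
    lia
  refine ⟨fun c => ζ.mulLeft X Y _ (m c) (n - d c) (hdeg c) (a c) (ξ c), ?_⟩
  have h1 := congrArg (ζ.extComponent X Y n) ha
  rw [map_sum] at h1
  refine (ζ.extComponent_extOf_self X Y n θ).symm.trans
    (h1.trans (Finset.sum_congr rfl fun c _ => ?_))
  -- Evenness of `d c` removes the sign, so `η c` can be moved to the outside.
  have hc : (a c : H) * η c = η c * a c := by
    rw [hcomm _ _ _ (a c).2 _ (η c).2, Even.neg_one_pow ((hd c).2.mul_left _), one_mul]
  rw [← ζ.smul_extOf X Y (η c) _ _ rfl, smul_smul, hc, ← smul_smul,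
    ζ.smul_extOf X Y _ _ _ (hdeg c), ζ.smul_extOf X Y _ _ n (by lia), extComponent_extOf_self]
  rfl

/-- The same generators, with respect to the action from the other side. -/
lemma exists_right_generators {r : ℕ} {d : Fin r → ℕ} {η : ∀ c, 𝓗 (d c)} {n₁ : ℤ}
    (h : ∀ n ≥ n₁, ∀ θ : ShiftedHom X Y n, ∃ y : ∀ c, ShiftedHom X Y (n - d c),
        θ = ∑ c, (y c).comp (ζ.φ Y (η c)) (by lia))
    {X' : C} (i : X' ⟶ X) (p : X ⟶ X') (hip : i ≫ p = 𝟙 X') (n : ℤ) (hn : n ≥ n₁)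
    (θ : ShiftedHom X' Y n) :
    ∃ y : ∀ c, ShiftedHom X' Y (n - d c), θ = ∑ c, (ζ.φ X' (η c)).comp (y c) (by lia) := by
  -- Expand the pullback of `θ` along the retraction, move the central elements to the other side,
  -- and restrict along `i`; naturality turns the action on `X` into the one on `X'`.
  obtain ⟨y, hy⟩ := h n hn (p ≫ θ)
  choose y' hy' using fun c => exists_comp_centerApp (ζ.hom _ (η c)) (y c)
    (show (d c : ℤ) + (n - d c) = n by lia) (by lia)
  refine ⟨fun c => i ≫ y' c, ?_⟩
  have h1 : θ = i ≫ p ≫ θ := by rw [← Category.assoc, hip, Category.id_comp]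
  have h2 : p ≫ θ = ∑ c, (ζ.φ X (η c)).comp (y' c) (by lia) :=
    hy.trans (Finset.sum_congr rfl fun c _ => hy' c)
  rw [h1, h2]
  refine (Preadditive.comp_sum _ _ _).trans (Finset.sum_congr rfl fun c _ => ?_)
  have h3 : i ≫ ζ.φ X (η c) = ζ.φ X' (η c) ≫ i⟦(d c : ℤ)⟧' := (ζ.hom _ (η c)).1.naturality i
  rw [ShiftedHom.comp, ShiftedHom.comp, Functor.map_comp, ← Category.assoc, h3, Category.assoc,
    Category.assoc]

end Generators

end CentralAction

end SymGrowth

end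

noncomputable section

open CategoryTheory

namespace SymGrowth

/-! ### Chain maps of even degree as strict maps. -/

section OfHom

variable {A : Type u} [CommRing A] {K : CochainComplex (ModuleCat.{u} A) ℤ} {n : ℤ}

/-- A chain map to an even shift, as a strict map. -/
def StrictMap.ofHom (hn : n.negOnePow = 1) (f : K ⟶ K⟦n⟧) : StrictMap K K n where
  app p q h := (shiftComponent f p q h).hom
  comm p q p' q' h h' _ x := by
    have e := shiftComponent_comp_d f p q p' q' h h'
    rw [hn, one_smul] at e
    exact LinearMap.congr_fun (congrArg ModuleCat.Hom.hom e) x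

lemma StrictMap.ofHom_dualMap (hn : n.negOnePow = 1) (f : K ⟶ K⟦n⟧) :
    StrictMap.ofHom hn (dualMap f) = (StrictMap.ofHom hn f).dual := by
  refine StrictMap.ext ?_
  funext p q h
  subst h
  exact congrArg ModuleCat.Hom.hom (Category.comp_id _)

end OfHom

/-! ### Endomorphisms of a complete resolution which realize elements of `Ext(M, M)`. -/

section Models

variable {A : Type u} [CommRing A] {M : Type u} [AddCommGroup M] [Module A M]

lemma CompleteResolution.nonempty_trunc (R : CompleteResolution A M) :
    Nonempty (Trunc R.cx M R.proj) := by
  refine Trunc.exists_of_exact (fun i _ => R.exact i) R.proj_surjective fun x => ?_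
  rw [← R.d_eq_zero_iff]
  exact R.exact 0 x

variable [HasDerivedCategory.{w} (ModuleCat.{u} A)]

lemma Corresponds.exists_trunc {K : CochainComplex (ModuleCat.{u} A) ℤ} {proj : K.X 0 →ₗ[A] M}
    {n : ℤ} {f : K ⟶ K⟦n⟧} {θ : ShiftedHom (single A M) (single A M) n}
    (h : Corresponds K M proj n f θ) :
    ∃ (T : Trunc K M proj) (g : T.F ⟶ T.F⟦n⟧), T.q ≫ g = f ≫ T.q⟦n⟧' ∧
      T.pQ ≫ θ = ShiftedHom.map g DerivedCategory.Q ≫ T.pQ⟦n⟧' := by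
  obtain ⟨F, q, p, g, h1, h2, h3, h4, h5, h6⟩ := h
  exact ⟨⟨F, q, p, h1, h2, h3, h4⟩, g, h5, h6⟩

/-- The endomorphism `F` of a complete resolution induces the multiplication by `θ`. -/
def CompleteResolution.Models (R : CompleteResolution A M) {n : ℤ} (F : StrictMap R.cx R.cx n)
    (θ : ShiftedHom (single A M) (single A M) n) : Prop :=
  ∀ (T : Trunc R.cx M R.proj) (N : Type u) [AddCommGroup N] [Module A N] (j i' : ℤ)
    (h' : i' + j = 0), i' ≤ 0 → ∀ (a : R.cx.X i' →ₗ[A] N)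
    (ξ : ShiftedHom (single A M) (single A N) j), T.Represents i' h' a ξ →
    ∀ (k : ℤ) (h : j + n = k) (i : ℤ) (hi : i + n = i') (hk : i + k = 0),
    T.Represents i hk (a ∘ₗ F.app i i' hi) (θ.comp ξ h)

/-- Conjugating by comparison maps over the identity of `M` transports the chain map from the
resolution where it is given to any other one. -/
lemma Corresponds.models {R : CompleteResolution A M} {n : ℤ} (hn : n.negOnePow = 1)
    (hn0 : 0 ≤ n) {f : R.cx ⟶ R.cx⟦n⟧} {θ : ShiftedHom (single A M) (single A M) n}
    (h : Corresponds R.cx M R.proj n f θ) {S : CompleteResolution A M}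
    {u : StrictMap S.cx R.cx 0} (hu : ∀ x, R.proj (u.app 0 0 rfl x) = S.proj x)
    {v : StrictMap R.cx S.cx 0} (hv : ∀ x, S.proj (v.app 0 0 rfl x) = R.proj x)
    (G : StrictMap S.cx S.cx n)
    (hG : ∀ i i' hi, G.app i i' hi =
      v.app i' i' (add_zero i') ∘ₗ (StrictMap.ofHom hn f).app i i' hi ∘ₗ u.app i i (add_zero i)) :
    S.Models G θ := by
  intro T N _ _ j i' h' hi0 a ξ hξ k hk i hi hik
  obtain ⟨T', g, hg, hθ⟩ := h.exists_trunc
  have h1 := Trunc.Represents.of_strictMap (T := T') v hv hi0 hξ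
  have h2 := Trunc.Represents.comp hg hθ h1 hk i hi hik
  have h3 := Trunc.Represents.of_strictMap (T := T) u hu (by lia) h2
  rw [hG]
  exact h3

/-- The transposes of the comparison maps are comparison maps for the dual resolutions in the
opposite direction, so a single conjugation transports a chain map and its transpose together. -/
lemma IsDualExt.exists_models {n : ℤ} (hn : n.negOnePow = 1) (hn0 : 0 ≤ n)
    {θ : ShiftedHom (single A M) (single A M) n}
    {θ' : ShiftedHom (single A (Module.Dual A M)) (single A (Module.Dual A M)) n}
    (h : IsDualExt M θ θ') (S : CompleteResolution A M) :
    ∃ F : StrictMap S.cx S.cx n, S.Models F θ ∧ S.dual.Models F.dual θ' := by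
  obtain ⟨R, f, h1, h2⟩ := h
  obtain ⟨u, hu⟩ := S.exists_strictMap R LinearMap.id
  obtain ⟨v, hv⟩ := R.exists_strictMap S LinearMap.id
  have e (i i' : ℤ) (hi : i + n = i') :
      (u.comp ((StrictMap.ofHom hn f).comp v n (add_zero n)) n (zero_add n)).app i i' hi =
      v.app i' i' (add_zero i') ∘ₗ (StrictMap.ofHom hn f).app i i' hi ∘ₗ
        u.app i i (add_zero i) := by
    rw [StrictMap.comp_app _ _ _ _ i i i' (add_zero i) hi,
      StrictMap.comp_app _ _ _ _ i i' i' hi (add_zero i')]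
    rfl
  refine ⟨u.comp ((StrictMap.ofHom hn f).comp v n (add_zero n)) n (zero_add n),
    h1.models hn hn0 hu hv _ e, ?_⟩
  refine Corresponds.models (R := R.dual) (S := S.dual) hn hn0 h2 (u := v.dual) (v := u.dual)
    (v.dual_proj hv) (u.dual_proj hu) _ fun i i' hi => ?_
  have e' := StrictMap.ofHom_dualMap hn f
  have e'' := congrArg LinearMap.dualMap (e (1 - i') (1 - i) (by lia))
  refine e''.trans ?_
  have e3 : (StrictMap.ofHom hn (dualMap f)).app i i' hi =
      ((StrictMap.ofHom hn f).app (1 - i') (1 - i) (by lia)).dualMap := by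
    rw [e']
    rfl
  refine Eq.trans ?_ (congrArg (fun t => u.dual.app i' i' (add_zero i') ∘ₗ t ∘ₗ
    v.dual.app i i (add_zero i)) e3.symm)
  rfl

namespace CompleteResolution

variable {R : CompleteResolution A M}

lemma Models.proj {n : ℤ} {F : StrictMap R.cx R.cx n}
    {θ : ShiftedHom (single A M) (single A M) n} (h : R.Models F θ) (T : Trunc R.cx M R.proj)
    (i : ℤ) (hi : i + n = 0) : T.Represents i hi (R.proj ∘ₗ F.app i 0 hi) θ := by
  have := h T M 0 0 (add_zero 0) le_rfl _ _ T.represents_proj n (zero_add n) i hi hi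
  rwa [ShiftedHom.comp_mk₀_id] at this

/-- Commuting elements are modelled by maps which commute up to homotopy. -/
lemma Models.comm {n m k : ℤ} {F : StrictMap R.cx R.cx n} {G : StrictMap R.cx R.cx m}
    {θ : ShiftedHom (single A M) (single A M) n} {ψ : ShiftedHom (single A M) (single A M) m}
    (hF : R.Models F θ) (hG : R.Models G ψ) (hn : 0 ≤ n) (hm : 0 ≤ m) (h : n + m = k)
    (h' : m + n = k) (hθ : ψ.comp θ h = θ.comp ψ h') (p : ℤ) :
    (F.comp G k h + (-1 : A) • G.comp F k h').NullAt p := by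
  obtain ⟨T⟩ := R.nonempty_trunc
  have h1 := hF T M m (-m) (by lia) (by lia) _ _ (hG.proj T (-m) (by lia)) k (by lia) (-k) (by lia)
    (by lia)
  have h2 := hG T M n (-n) (by lia) (by lia) _ _ (hF.proj T (-n) (by lia)) k (by lia) (-k) (by lia)
    (by lia)
  -- Composed with `proj`, the two products of endomorphisms represent the same class, so their
  -- difference is a coboundary; for a map into a complete resolution this already gives a
  -- null-homotopy.
  have h3 := h1.sub h2
  rw [hθ, sub_self] at h3
  obtain ⟨t, ht⟩ := h3.exists_coboundary R.free (-k + 1) rfl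
  refine R.nullAt_of_proj R.totallyAcyclic _ (-k) (-k + 1) (by lia) rfl t (fun x => ?_) p
  rw [← ht, StrictMap.add_app, StrictMap.smul_app,
    StrictMap.comp_app F G k h (-k) (-m) 0 (by lia) (by lia),
    StrictMap.comp_app G F k h' (-k) (-n) 0 (by lia) (by lia)]
  simp only [LinearMap.add_apply, LinearMap.smul_apply, LinearMap.comp_apply, LinearMap.sub_apply,
    map_add, map_smul]
  rw [neg_smul, one_smul, sub_eq_add_neg]

/-- Generation of `Ext(M, N)` in high degrees, on the level of cocycles. -/
lemma exists_eq_sum_precomp {r : ℕ} {d : Fin r → ℕ}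
    {F : ∀ c, StrictMap R.cx R.cx (d c)} {θ : ∀ c, ShiftedHom (single A M) (single A M) (d c : ℤ)}
    (hF : ∀ c, R.Models (F c) (θ c)) {N : Type u} [AddCommGroup N] [Module A N] {n₁ : ℤ}
    (hgen : ∀ n ≥ n₁, ∀ ξ : ShiftedHom (single A M) (single A N) n,
      ∃ y : ∀ c, ShiftedHom (single A M) (single A N) (n - d c),
        ξ = ∑ c, (θ c).comp (y c) (by lia)) :
    ∃ n₂ : ℤ, ∀ i < n₂, ∀ x : Coh R.cx N i, ∃ y : ∀ c, Coh R.cx N (i + d c),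
      x = ∑ c, Coh.precomp (F c) i _ rfl (y c) := by
  obtain ⟨T⟩ := R.nonempty_trunc
  obtain ⟨b, hb⟩ : ∃ b : ℤ, ∀ c, (d c : ℤ) ≤ b := by
    obtain ⟨b, hb⟩ := (Set.finite_range fun c => (d c : ℤ)).bddAbove
    exact ⟨b, fun c => hb ⟨c, rfl⟩⟩
  -- The bound `-b` keeps the places `i + d c` nonpositive, where `Models` applies; `-n₁` puts the
  -- degree `-i` in the range of generation.
  refine ⟨min (min 0 (-n₁)) (-b), fun i hi x => ?_⟩
  obtain ⟨a, rfl⟩ := Coh.mk_surjective i x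
  obtain ⟨ξ, hξ⟩ := T.exists_represents (j := -i) (by lia) (by lia) a
  obtain ⟨y, hy⟩ := hgen (-i) (by lia) ξ
  choose z hz using fun c => T.exists_cocycle R.free (i := i + d c) (j := -i - d c) (by lia) (y c)
  have h1 (c : Fin r) : T.Represents i (by lia) ((z c).1 ∘ₗ (F c).app i (i + d c) rfl)
      ((θ c).comp (y c) (show (-i - (d c : ℤ)) + d c = -i by lia)) := by
    have := hb c
    exact hF c T N _ _ (by lia) (by lia) _ _ (hz c) _ _ i rfl (by lia)
  have h2 := hξ.sub (Trunc.Represents.sum Finset.univ fun c _ => h1 c)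
  rw [← hy, sub_self] at h2
  obtain ⟨t, ht⟩ := h2.exists_coboundary R.free (i + 1) rfl
  refine ⟨fun c => Coh.mk _ (z c), ?_⟩
  choose w hw hw' using fun c => Coh.precomp_mk' (F c) i (i + d c) rfl (z c)
  simp only [hw']
  rw [← map_sum, ← sub_eq_zero, ← map_sub, Coh.mk_eq_zero_iff i (i + 1) rfl]
  refine ⟨t, fun x => ?_⟩
  rw [← ht]
  simp only [AddSubgroupClass.coe_sub, AddSubmonoidClass.coe_finsetSum, LinearMap.sub_apply,
    LinearMap.sum_apply, LinearMap.comp_apply, hw]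

end CompleteResolution

end Models

end SymGrowth

end

noncomputable section

open CategoryTheory

namespace SymGrowth

/-! ### Passage to the derived category of all modules. -/

section MapShiftedHom

variable {C D : Type*} [Category* C] [Category* D] [HasShift C ℤ] [HasShift D ℤ]
  (F : C ⥤ D) [F.CommShift ℤ]

lemma shiftedHom_map_surjective [F.Full] {X Y : C} {n : ℤ}
    (φ : ShiftedHom (F.obj X) (F.obj Y) n) : ∃ ξ : ShiftedHom X Y n, ξ.map F = φ := by
  obtain ⟨ξ, hξ⟩ := F.map_surjective (φ ≫ (F.commShiftIso n).inv.app Y)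
  refine ⟨ξ, ?_⟩
  rw [ShiftedHom.map, hξ, Category.assoc, Iso.inv_hom_id_app]
  exact Category.comp_id _

lemma shiftedHom_map_sum [Preadditive C] [Preadditive D] [F.Additive] {X Y : C} {n : ℤ}
    {κ : Type*} (s : Finset κ) (ξ : κ → ShiftedHom X Y n) :
    ShiftedHom.map (∑ c ∈ s, ξ c) F = ∑ c ∈ s, (ξ c).map F :=
  map_sum (AddMonoidHom.mk' (fun ξ : ShiftedHom X Y n => ξ.map F)
    (fun a b => ShiftedHom.map_add a b F)) ξ s

lemma units_smul_comp_units_smul [Preadditive C] [∀ n : ℤ, (shiftFunctor C n).Additive]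
    {X Y Z : C} {a b c : ℤ} (ε ε' : ℤˣ) (f : ShiftedHom X Y a) (g : ShiftedHom Y Z b)
    (h : b + a = c) : (ε • f).comp (ε' • g) h = (ε * ε') • f.comp g h := by
  obtain rfl | rfl := Int.units_eq_one_or ε <;> obtain rfl | rfl := Int.units_eq_one_or ε' <;>
    simp [Units.neg_smul, ShiftedHom.neg_comp, ShiftedHom.comp_neg]

end MapShiftedHom

section Generators

variable {A : Type u} [CommRing A] [HasDerivedCategory.{w} (ModuleCat.{u} A)]

/-- The functoriality of `dbOf`. -/
lemma exists_retraction_dbOf {M N : Type u} [AddCommGroup M] [Module A M] [Module.Finite A M]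
    [AddCommGroup N] [Module A N] [Module.Finite A N] (f : M →ₗ[A] N) (g : N →ₗ[A] M)
    (h : g ∘ₗ f = LinearMap.id) : ∃ (i : dbOf A M ⟶ dbOf A N) (p : dbOf A N ⟶ dbOf A M),
      i ≫ p = 𝟙 _ := by
  obtain ⟨i, hi⟩ := (boundedFG A).ι.map_surjective (X := dbOf A M) (Y := dbOf A N)
    ((DerivedCategory.singleFunctor (ModuleCat.{u} A) 0).map (ModuleCat.ofHom f))
  obtain ⟨p, hp⟩ := (boundedFG A).ι.map_surjective (X := dbOf A N) (Y := dbOf A M)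
    ((DerivedCategory.singleFunctor (ModuleCat.{u} A) 0).map (ModuleCat.ofHom g))
  refine ⟨i, p, (boundedFG A).ι.map_injective ?_⟩
  have e : ModuleCat.ofHom f ≫ ModuleCat.ofHom g = 𝟙 (ModuleCat.of A M) := by
    rw [← ModuleCat.ofHom_comp, h]
    rfl
  have e' := congrArg (DerivedCategory.singleFunctor (ModuleCat.{u} A) 0).map e
  rw [Functor.map_comp, ← hi, ← hp] at e'
  exact (Functor.map_comp _ _ _).trans (e'.trans (CategoryTheory.Functor.map_id _ _))

variable {H : Type v} [Ring H] {𝓗 : ℕ → AddSubgroup H} [GradedRing 𝓗]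
  (ζ : CentralAction (Db A) 𝓗)

/-- The element of `Ext(M, M)` in the derived category of all modules which is induced by a
central element, up to a sign. -/
def centralExt (M : Type u) [AddCommGroup M] [Module A M] [Module.Finite A M] {n : ℕ} (ε : ℤˣ)
    (η : 𝓗 n) : ShiftedHom (single A M) (single A M) (n : ℤ) :=
  ε • (ζ.φ (dbOf A M) η).map (boundedFG A).ι

lemma centralExt_comm
    (hcomm : ∀ (m n : ℕ), ∀ η ∈ 𝓗 m, ∀ θ ∈ 𝓗 n, η * θ = (-1) ^ (m * n) * (θ * η))
    (M : Type u) [AddCommGroup M] [Module A M] [Module.Finite A M] {m n : ℕ} (hm : Even m)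
    (ε ε' : ℤˣ) (η : 𝓗 m) (θ : 𝓗 n) (k : ℤ) (h : (m : ℤ) + n = k) (h' : (n : ℤ) + m = k) :
    (centralExt ζ M ε' θ).comp (centralExt ζ M ε η) h =
      (centralExt ζ M ε η).comp (centralExt ζ M ε' θ) h' := by
  have e : (η : H) * θ = θ * η := by
    rw [hcomm _ _ _ η.2 _ θ.2, Even.neg_one_pow (hm.mul_right _), one_mul]
  refine (units_smul_comp_units_smul _ _ _ _ h).trans
    (Eq.trans ?_ (units_smul_comp_units_smul _ _ _ _ h').symm)
  refine congrArg₂ (· • ·) (mul_comm _ _) ?_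
  refine (ShiftedHom.map_comp _ _ h _).symm.trans (Eq.trans ?_ (ShiftedHom.map_comp _ _ h' _))
  rw [ζ.φ_comp_comm η θ e (dbOf A M) k h h']

/-- Fullness of the inclusion moves the expansion to the derived category, and `M` is a retract of
`X`, which will be `M ⊕ M*`. The signs are absorbed by the coefficients, as they square to `1`. -/
lemma exists_centralExt_generators {M N X : Type u} [AddCommGroup M] [Module A M]
    [Module.Finite A M] [AddCommGroup N] [Module A N] [Module.Finite A N] [AddCommGroup X]
    [Module A X] [Module.Finite A X] {r : ℕ} {d : Fin r → ℕ} {η : ∀ c, 𝓗 (d c)} {n₁ : ℤ}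
    (h : ∀ n ≥ n₁, ∀ θ : ShiftedHom (dbOf A X) (dbOf A N) n,
      ∃ y : ∀ c, ShiftedHom (dbOf A X) (dbOf A N) (n - d c),
        θ = ∑ c, (y c).comp (ζ.φ (dbOf A N) (η c)) (by lia))
    (f : M →ₗ[A] X) (g : X →ₗ[A] M) (hfg : g ∘ₗ f = LinearMap.id) (ε : Fin r → ℤˣ) (n : ℤ)
    (hn : n ≥ n₁) (ξ : ShiftedHom (single A M) (single A N) n) :
    ∃ y : ∀ c, ShiftedHom (single A M) (single A N) (n - d c),
      ξ = ∑ c, (centralExt ζ M (ε c) (η c)).comp (y c) (by lia) := by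
  obtain ⟨i, p, hip⟩ := exists_retraction_dbOf f g hfg
  obtain ⟨θ, rfl⟩ := shiftedHom_map_surjective (boundedFG A).ι (X := dbOf A M) (Y := dbOf A N) ξ
  obtain ⟨y, rfl⟩ := ζ.exists_right_generators h i p hip n hn θ
  refine ⟨fun c => ε c • (y c).map (boundedFG A).ι, ?_⟩
  refine (shiftedHom_map_sum _ _ _).trans (Finset.sum_congr rfl fun c _ => ?_)
  refine (ShiftedHom.map_comp _ _ _ _).trans
    (Eq.trans ?_ (units_smul_comp_units_smul (ε c) (ε c) _ _ _).symm)
  rw [Int.units_mul_self, one_smul]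
  rfl

end Generators

/-! ### The action of `H` on a complete resolution and on its dual. -/

section Systems

variable {A : Type u} [CommRing A] [IsNoetherianRing A] [HasDerivedCategory.{w} (ModuleCat.{u} A)]
  {M : Type u} [AddCommGroup M] [Module A M] [Module.Finite A M]

/-- The action of `H` is given by commuting endomorphisms of any complete resolution, which
generate the cohomology far to the left, both of the complete resolution and of its dual. -/
lemma exists_commSys {H : Type v} [Ring H] {𝓗 : ℕ → AddSubgroup H} [GradedRing 𝓗]
    (hcomm : ∀ (m n : ℕ), ∀ η ∈ 𝓗 m, ∀ θ ∈ 𝓗 n, η * θ = (-1) ^ (m * n) * (θ * η))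
    (ζ : CentralAction (Db A) 𝓗) (k : Type u) [AddCommGroup k] [Module A k] [Module.Finite A k]
    (hnoeth : ζ.IsNoethFL (dbOf A (M × Module.Dual A M)) (dbOf A k))
    (σ : ℕ → ℤˣ) (hdual : CommutesWithDualization M ζ σ) (R : CompleteResolution A M) :
    ∃ (r : ℕ) (d : Fin r → ℕ) (F : ∀ c, StrictMap R.cx R.cx (d c)), (∀ c, 0 < d c) ∧
      (∀ c c' (n : ℤ) (h : (d c : ℤ) + d c' = n) (h' : (d c' : ℤ) + d c = n) (p : ℤ),
        ((F c).comp (F c') n h + (-1 : A) • (F c').comp (F c) n h').NullAt p) ∧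
      (∀ c c' (n : ℤ) (h : (d c : ℤ) + d c' = n) (h' : (d c' : ℤ) + d c = n) (p : ℤ),
        ((F c).dual.comp (F c').dual n h + (-1 : A) • (F c').dual.comp (F c).dual n h').NullAt p) ∧
      (∃ n : ℤ, ∀ i < n, ∀ x : Coh R.cx k i, ∃ y : ∀ c, Coh R.cx k (i + d c),
        x = ∑ c, Coh.precomp (F c) i _ rfl (y c)) ∧
      (∃ n : ℤ, ∀ i < n, ∀ x : Coh (dualCx R.cx) k i, ∃ y : ∀ c, Coh (dualCx R.cx) k (i + d c),
        x = ∑ c, Coh.precomp (F c).dual i _ rfl (y c)) := by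
  -- The same elements serve `M` and `M*`, because they are extracted from `Ext` of the direct sum.
  obtain ⟨r, d, η, n₁, hd, hgen⟩ := ζ.exists_even_generators hcomm hnoeth
  have hev (c : Fin r) : ((d c : ℕ) : ℤ).negOnePow = 1 := by
    rw [Int.negOnePow_even]
    exact_mod_cast (hd c).2
  have hdu (c : Fin r) : IsDualExt M (centralExt ζ M 1 (η c))
      (centralExt ζ (Module.Dual A M) (σ (d c)) (η c)) := by
    rw [centralExt, one_smul]
    exact hdual (d c) (η c)
  choose F hF hF' using fun c => (hdu c).exists_models (hev c) (Int.natCast_nonneg _) R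
  refine ⟨r, d, F, fun c => (hd c).1, fun c c' n h h' p => ?_, fun c c' n h h' p => ?_, ?_, ?_⟩
  · exact (hF c).comm (hF c') (Int.natCast_nonneg _) (Int.natCast_nonneg _) h h'
      (centralExt_comm ζ hcomm M (hd c).2 _ _ _ _ n h h') p
  · exact (hF' c).comm (hF' c') (Int.natCast_nonneg _) (Int.natCast_nonneg _) h h'
      (centralExt_comm ζ hcomm _ (hd c).2 _ _ _ _ n h h') p
  · exact CompleteResolution.exists_eq_sum_precomp hF fun n hn ξ =>
      exists_centralExt_generators ζ hgen (LinearMap.inl A M (Module.Dual A M))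
        (LinearMap.fst A M (Module.Dual A M)) (LinearMap.fst_comp_inl ..)
        (fun _ => 1) n hn ξ
  · exact CompleteResolution.exists_eq_sum_precomp hF' fun n hn ξ =>
      exists_centralExt_generators ζ hgen (LinearMap.inr A M (Module.Dual A M))
        (LinearMap.snd A M (Module.Dual A M)) (LinearMap.ext fun _ => rfl)
        (fun c => σ (d c)) n hn ξ

end Systems

end SymGrowth

end

noncomputable section

open CategoryTheory

namespace SymGrowth

/-! ### Finite free modules modulo the maximal ideal. -/

section Residue

lemma mem_smul_top_dual_iff {A : Type u} [CommRing A] {V : Type u} [AddCommGroup V] [Module A V]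
    [Module.Free A V] [Module.Finite A V] (I : Ideal A) (g : Module.Dual A V) :
    g ∈ (I • ⊤ : Submodule A (Module.Dual A V)) ↔ ∀ x, g x ∈ I := by
  rw [mem_ideal_smul_top_iff]
  refine ⟨fun h x => h (Module.Dual.eval A V x), fun h φ => ?_⟩
  obtain ⟨x, rfl⟩ := (Module.evalEquiv A V).surjective φ
  exact h x

open IsLocalRing

variable {A : Type u} [CommRing A] [IsLocalRing A] {k : Type u} [AddCommGroup k] [Module A k]
  {V : Type u} [AddCommGroup V] [Module A V]

/-- The projection to a module which is isomorphic to the residue field. -/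
def toResidue (e : k ≃ₗ[A] A ⧸ maximalIdeal A) : A →ₗ[A] k :=
  e.symm.toLinearMap ∘ₗ (maximalIdeal A).mkQ

lemma toResidue_surjective (e : k ≃ₗ[A] A ⧸ maximalIdeal A) : Function.Surjective (toResidue e) :=
  e.symm.surjective.comp (Submodule.mkQ_surjective _)

lemma toResidue_eq_zero_iff (e : k ≃ₗ[A] A ⧸ maximalIdeal A) (a : A) :
    toResidue e a = 0 ↔ a ∈ maximalIdeal A :=
  e.symm.map_eq_zero_iff.trans (Submodule.Quotient.mk_eq_zero _)

lemma apply_eq_zero_of_mem (e : k ≃ₗ[A] A ⧸ maximalIdeal A) (a : V →ₗ[A] k) {x : V}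
    (hx : x ∈ (maximalIdeal A • ⊤ : Submodule A V)) :
    a x = 0 := by
  have h : (maximalIdeal A • ⊤ : Submodule A V) ≤ LinearMap.ker a := by
    refine Submodule.smul_le.2 fun r hr y _ => ?_
    obtain ⟨b, hb⟩ := toResidue_surjective e (a y)
    rw [LinearMap.mem_ker, map_smul, ← hb, ← map_smul, toResidue_eq_zero_iff]
    exact Ideal.mul_mem_right _ _ hr
  exact h hx

variable [Module.Free A V] [Module.Finite A V]

lemma mem_of_forall_apply_eq_zero (e : k ≃ₗ[A] A ⧸ maximalIdeal A) {x : V}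
    (h : ∀ φ : V →ₗ[A] k, φ x = 0) :
    x ∈ (maximalIdeal A • ⊤ : Submodule A V) :=
  (mem_ideal_smul_top_iff _ _).2 fun ψ => (toResidue_eq_zero_iff e _).1 (h (toResidue e ∘ₗ ψ))

lemma exists_eq_toResidue_apply (e : k ≃ₗ[A] A ⧸ maximalIdeal A)
    (a : Module.Dual A V →ₗ[A] k) :
    ∃ z : V, ∀ g, a g = toResidue e (g z) := by
  obtain ⟨b, hb⟩ := Module.projective_lifting_property (toResidue e) a (toResidue_surjective e)
  obtain ⟨z, rfl⟩ := (Module.evalEquiv A V).surjective b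
  exact ⟨z, fun g => (LinearMap.congr_fun hb g).symm⟩

lemma length_hom (e : k ≃ₗ[A] A ⧸ maximalIdeal A) :
    Module.length A (V →ₗ[A] k) = Module.finrank A V := by
  have h1 : Module.length A k = 1 := by
    have : IsSimpleModule A (A ⧸ maximalIdeal A) :=
      isSimpleModule_iff_isCoatom.2 (maximalIdeal.isMaximal A).out
    rw [e.length_eq]
    exact Module.length_eq_one A _
  let b := Module.finBasis A V
  rw [(b.constr A (M' := k)).symm.length_eq, Module.length_pi_of_fintype]
  simp [h1]

end Residue

/-! ### Minimality, and the transposition of generation. -/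

section Minimal

open IsLocalRing

variable {A : Type u} [CommRing A] [IsLocalRing A] {k : Type u} [AddCommGroup k] [Module A k]
  {K : CochainComplex (ModuleCat.{u} A) ℤ}

/-- The differential which starts at the place `Kⁱ` is minimal. -/
def MinimalAt (K : CochainComplex (ModuleCat.{u} A) ℤ) (i : ℤ) : Prop :=
  ∀ x, (K.d i (i + 1)).hom x ∈ (maximalIdeal A • ⊤ : Submodule A (K.X (i + 1)))

lemma CompleteResolution.IsAlmostMinimal.minimalAt {M : Type u} [AddCommGroup M] [Module A M]
    {R : CompleteResolution A M} (hR : R.IsAlmostMinimal) {i : ℤ} (hi : i ≠ 0) :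
    MinimalAt R.cx i := by
  have h : ∀ i' j', i' = i → j' = i + 1 → LinearMap.range (R.cx.d i' j').hom ≤
      maximalIdeal A • ⊤ → MinimalAt R.cx i := by
    rintro _ _ rfl rfl h x
    exact h ⟨x, rfl⟩
  exact h _ _ (by lia) (by lia) (hR (-i - 1) (by lia))

lemma MinimalAt.mem_cocycles (e : k ≃ₗ[A] A ⧸ maximalIdeal A) {i : ℤ} (h : MinimalAt K (i - 1))
    (a : K.X i →ₗ[A] k) : a ∈ cocycles K k i := by
  refine (SymGrowth.mem_cocycles i (i - 1) (by lia) a).2 fun x => ?_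
  have key : ∀ j, j = i - 1 + 1 → ∀ a : K.X j →ₗ[A] k, a ((K.d (i - 1) j).hom x) = 0 := by
    rintro _ rfl a
    exact apply_eq_zero_of_mem e a (h x)
  exact key i (by lia) a

lemma MinimalAt.eq_zero (e : k ≃ₗ[A] A ⧸ maximalIdeal A) {i : ℤ} (h : MinimalAt K i)
    {a : cocycles K k i} (ha : Coh.mk i a = 0) (x : K.X i) : a.1 x = 0 := by
  obtain ⟨t, ht⟩ := (Coh.mk_eq_zero_iff i (i + 1) rfl a).1 ha
  rw [ht]
  exact apply_eq_zero_of_mem e t (h x)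

/-- Minimality on both sides makes the differentials of `Hom(K, k)` vanish there: every map is a
cocycle and only zero is a coboundary. -/
lemma length_coh_eq_finrank (e : k ≃ₗ[A] A ⧸ maximalIdeal A) {i : ℤ} [Module.Free A (K.X i)]
    [Module.Finite A (K.X i)] (h : MinimalAt K (i - 1)) (h' : MinimalAt K i) :
    Module.length A (Coh K k i) = Module.finrank A (K.X i) := by
  rw [← length_hom e]
  let f : (K.X i →ₗ[A] k) →ₗ[A] Coh K k i :=
    Coh.mk i ∘ₗ LinearMap.id.codRestrict (cocycles K k i) fun a => h.mem_cocycles e a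
  refine (LinearEquiv.ofBijective f ⟨?_, ?_⟩).length_eq.symm
  · rw [← LinearMap.ker_eq_bot, LinearMap.ker_eq_bot']
    intro a ha
    exact LinearMap.ext fun x => h'.eq_zero e ha x
  · intro x
    obtain ⟨a, rfl⟩ := Coh.mk_surjective i x
    exact ⟨a.1, rfl⟩

/-- At a minimal place, equality of classes is equality of maps. -/
lemma exists_eq_sum_apply (e : k ≃ₗ[A] A ⧸ maximalIdeal A) {r : ℕ} {d : Fin r → ℕ}
    {F : ∀ c, StrictMap K K (d c)} {i : ℤ} (h : MinimalAt K (i - 1)) (h' : MinimalAt K i)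
    (hgen : ∀ x : Coh K k i, ∃ y : ∀ c, Coh K k (i + d c),
      x = ∑ c, Coh.precomp (F c) i _ rfl (y c)) (φ : K.X i →ₗ[A] k) :
    ∃ ψ : ∀ c, K.X (i + d c) →ₗ[A] k, ∀ x, φ x = ∑ c, ψ c ((F c).app i _ rfl x) := by
  obtain ⟨y, hy⟩ := hgen (Coh.mk i ⟨φ, h.mem_cocycles e φ⟩)
  choose z hz using fun c => Coh.mk_surjective _ (y c)
  choose w hw hw' using fun c => Coh.precomp_mk' (F c) i (i + d c) rfl (z c)
  refine ⟨fun c => (z c).1, fun x => ?_⟩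
  simp only [← hz, hw'] at hy
  rw [← map_sum, ← sub_eq_zero, ← map_sub] at hy
  have := h'.eq_zero e hy x
  simp only [AddSubgroupClass.coe_sub, AddSubmonoidClass.coe_finsetSum, LinearMap.sub_apply,
    LinearMap.sum_apply, hw] at this
  exact sub_eq_zero.1 this

lemma precomp_eq_zero_apply (e : k ≃ₗ[A] A ⧸ maximalIdeal A) {L : CochainComplex (ModuleCat.{u} A) ℤ}
    {n : ℤ} (F : StrictMap K L n) {p q : ℤ} (hpq : p + n = q) (h : MinimalAt K p)
    (a : cocycles L k q) (ha : Coh.precomp F p q hpq (Coh.mk q a) = 0) (x : K.X p) :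
    a.1 (F.app p q hpq x) = 0 := by
  obtain ⟨b, hb, hb'⟩ := Coh.precomp_mk' F p q hpq a
  rw [hb'] at ha
  rw [← hb]
  exact h.eq_zero e ha x

variable [∀ i, Module.Free A (K.X i)] [∀ i, Module.Finite A (K.X i)] {r : ℕ} {d : Fin r → ℕ}
  {F : ∀ c, StrictMap K K (d c)}

/-- Generation for the dual complex implies that no cohomology class is annihilated by the
endomorphisms. -/
lemma eq_zero_of_dual_generation (e : k ≃ₗ[A] A ⧸ maximalIdeal A) (p : ℤ)
    (h : MinimalAt (dualCx K) (p - 1)) (h' : MinimalAt (dualCx K) p)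
    (hgen : ∀ x : Coh (dualCx K) k p, ∃ y : ∀ c, Coh (dualCx K) k (p + d c),
      x = ∑ c, Coh.precomp (F c).dual p _ rfl (y c))
    (hK : ∀ c q, q + d c = 1 - p → MinimalAt K q) (x : Coh K k (1 - p))
    (hx : ∀ c q (hq : q + d c = 1 - p), Coh.precomp (F c) q (1 - p) hq x = 0) : x = 0 := by
  obtain ⟨a, rfl⟩ := Coh.mk_surjective _ x
  -- It suffices that the lift `b` lies in the maximal ideal times the dual, which is tested by maps
  -- `φ` to `k`. Generation expresses `φ` through the transposes of the `F c`, and these send `b` to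
  -- `b ∘ F c`, whose reduction `a ∘ F c` vanishes.
  obtain ⟨b, hb⟩ := Module.projective_lifting_property (toResidue e) a.1 (toResidue_surjective e)
  have : Module.Free A ((dualCx K).X p) :=
    inferInstanceAs (Module.Free A (Module.Dual A (K.X (1 - p))))
  have : Module.Finite A ((dualCx K).X p) :=
    inferInstanceAs (Module.Finite A (Module.Dual A (K.X (1 - p))))
  have h1 : (b : Module.Dual A (K.X (1 - p))) ∈
      (maximalIdeal A • ⊤ : Submodule A (Module.Dual A (K.X (1 - p)))) := by
    refine mem_of_forall_apply_eq_zero e fun φ => ?_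
    obtain ⟨ψ, hψ⟩ := exists_eq_sum_apply (K := dualCx K) e h h' hgen φ
    refine (hψ b).trans (Finset.sum_eq_zero fun c _ => ?_)
    refine apply_eq_zero_of_mem e (V := Module.Dual A (K.X (1 - (p + d c)))) (ψ c) ?_
    refine (mem_smul_top_dual_iff _ _).2 fun y => (toResidue_eq_zero_iff e _).1 ?_
    have hpd : 1 - (p + d c) + (d c : ℤ) = 1 - p := by ring
    have h3 : a.1 ((F c).app (1 - (p + d c)) (1 - p) hpd y) = 0 :=
      precomp_eq_zero_apply e (F c) hpd (hK c _ hpd) a (hx c _ hpd) y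
    exact (LinearMap.congr_fun hb _).trans h3
  have h2 : a = 0 := by
    refine Subtype.ext (LinearMap.ext fun y => ?_)
    refine (LinearMap.congr_fun hb y).symm.trans ?_
    exact (toResidue_eq_zero_iff e _).2 ((mem_smul_top_dual_iff _ _).1 h1 y)
  rw [h2, map_zero]

/-- Generation implies that no cohomology class of the dual complex is annihilated by the
endomorphisms. -/
lemma eq_zero_of_generation (e : k ≃ₗ[A] A ⧸ maximalIdeal A) (i : ℤ)
    (h : MinimalAt K (1 - i - 1)) (h' : MinimalAt K (1 - i))
    (hgen : ∀ x : Coh K k (1 - i), ∃ y : ∀ c, Coh K k (1 - i + d c),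
      x = ∑ c, Coh.precomp (F c) (1 - i) _ rfl (y c))
    (hK : ∀ c q, q + d c = i → MinimalAt (dualCx K) q) (x : Coh (dualCx K) k i)
    (hx : ∀ c q (hq : q + d c = i), Coh.precomp (F c).dual q i hq x = 0) : x = 0 := by
  obtain ⟨a, rfl⟩ := Coh.mk_surjective _ x
  -- By reflexivity the cocycle is evaluation at a vector `z`, taken modulo the maximal ideal. It
  -- vanishes if `z` reduces to zero, which generation for `K` tests through the vectors `F c z`.
  obtain ⟨z, hz⟩ := exists_eq_toResidue_apply (V := K.X (1 - i)) e a.1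
  have h1 : z ∈ (maximalIdeal A • ⊤ : Submodule A (K.X (1 - i))) := by
    refine mem_of_forall_apply_eq_zero e fun φ => ?_
    obtain ⟨ψ, hψ⟩ := exists_eq_sum_apply e h h' hgen φ
    rw [hψ]
    refine Finset.sum_eq_zero fun c _ => apply_eq_zero_of_mem e (ψ c) ?_
    have key : ∀ q, q + d c = i → ∀ q', q' = 1 - q → ∀ hq,
        (F c).app (1 - i) q' hq z ∈ (maximalIdeal A • ⊤ : Submodule A (K.X q')) := by
      rintro q hq _ rfl hq'
      refine (mem_ideal_smul_top_iff _ _).2 fun g => (toResidue_eq_zero_iff e _).1 ?_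
      have h2 := precomp_eq_zero_apply e (F c).dual hq (hK c q hq) a (hx c q hq) g
      exact (hz _).symm.trans h2
    exact key (i - d c) (by lia) _ (by lia) _
  have h2 : a = 0 := by
    refine Subtype.ext (LinearMap.ext fun g => ?_)
    refine (hz g).trans ((toResidue_eq_zero_iff e _).2 ?_)
    exact (mem_ideal_smul_top_iff _ _).1 h1 g
  rw [h2, map_zero]

end Minimal

/-! ### Independence of the complete resolution. -/

section Invariance

variable {A : Type u} [CommRing A] {M : Type u} [AddCommGroup M] [Module A M] {N : Type u}
  [AddCommGroup N] [Module A N]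

/-- The composite of comparison maps in the two directions lifts the identity, hence is homotopic to
it, so one of them is injective on cohomology. Exchanging `R` and `S` gives equality. -/
lemma length_coh_le (R S : CompleteResolution A M) (i : ℤ) :
    Module.length A (Coh R.cx N i) ≤ Module.length A (Coh S.cx N i) := by
  obtain ⟨u, hu⟩ := R.exists_strictMap S LinearMap.id
  obtain ⟨v, hv⟩ := S.exists_strictMap R LinearMap.id
  refine Module.length_le_of_injective (Coh.precomp v i i (add_zero i)) ?_
  refine Function.LeftInverse.injective (g := Coh.precomp u i i (add_zero i)) fun x => ?_
  rw [Coh.precomp_precomp u v (add_zero 0) i i i _ _ (add_zero i)]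
  refine Eq.trans (Coh.precomp_congr (g := StrictMap.id R.cx) ?_ _ _ x) (Coh.precomp_id i x)
  refine R.nullAt_of_proj R.totallyAcyclic _ 0 1 rfl rfl 0 (fun x => ?_) i
  rw [StrictMap.add_app, StrictMap.smul_app, StrictMap.comp_app u v 0 (add_zero 0) 0 0 0 rfl rfl,
    LinearMap.add_apply, map_add, LinearMap.comp_apply, hv, hu, LinearMap.smul_apply, map_smul,
    neg_smul, one_smul, LinearMap.zero_apply]
  exact add_neg_cancel _

end Invariance

end SymGrowth

end

noncomputable section

open CategoryTheory

namespace SymGrowth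

/-! ### Complexity in terms of growth. -/

section Complexity

open Filter

lemma growth_iff_pos (β : ℤ → ℕ) (t : ℕ) :
    (∃ a : ℝ, ∀ᶠ n : ℤ in atTop, (β n : ℝ) ≤ a * (n : ℝ) ^ ((t : ℤ) - 1)) ↔
      Growth t (fun n => (β n : ℕ∞)) := by
  obtain rfl | ⟨s, rfl⟩ : t = 0 ∨ ∃ s, t = s + 1 := by
    cases t with
    | zero => exact Or.inl rfl
    | succ s => exact Or.inr ⟨s, rfl⟩
  · constructor
    · rintro ⟨a, ha⟩
      refine ⟨0, ?_⟩
      filter_upwards [ha, eventually_gt_atTop ⌈a⌉, eventually_gt_atTop 0] with n h1 h2 h3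
      have h3' : (0 : ℝ) < n := by exact_mod_cast h3
      have h2' : a < n := (Int.le_ceil a).trans_lt (by exact_mod_cast h2)
      -- For `t = 0` the bound is `a / n`, eventually below `1`, so an integer sequence obeying it
      -- is eventually zero. This is why `growthBound` vanishes for `t = 0`.
      have h4 : (β n : ℝ) < 1 := by
        refine h1.trans_lt ?_
        rw [Nat.cast_zero, zero_sub, zpow_neg_one, ← div_eq_mul_inv, div_lt_one h3']
        exact h2'
      have h5 : β n < 1 := by exact_mod_cast h4
      have h6 : β n = 0 := by omega
      simp [h6]
    · rintro ⟨a, ha⟩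
      refine ⟨0, ?_⟩
      filter_upwards [ha] with n h1
      have h2 : β n ≤ a * growthBound 0 n := by exact_mod_cast h1
      have h3 : β n = 0 := by simpa [growthBound] using h2
      simp [h3]
  · have e (n : ℤ) : ((s + 1 : ℕ) : ℤ) - 1 = (s : ℤ) := by push_cast; ring
    have e' (n : ℤ) (hn : 0 ≤ n) : ((growthBound (s + 1) n : ℕ) : ℝ) = (n : ℝ) ^ s := by
      have : ((n.toNat : ℕ) : ℝ) = n := by exact_mod_cast Int.toNat_of_nonneg hn
      simp [growthBound, this]
    constructor
    · rintro ⟨a, ha⟩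
      refine ⟨⌈a⌉₊, ?_⟩
      filter_upwards [ha, eventually_ge_atTop 0] with n h1 h2
      rw [e n, zpow_natCast, ← e' n h2] at h1
      have h3 : (β n : ℝ) ≤ ⌈a⌉₊ * (growthBound (s + 1) n : ℕ) :=
        h1.trans (mul_le_mul_of_nonneg_right (Nat.le_ceil a) (Nat.cast_nonneg _))
      exact_mod_cast h3
    · rintro ⟨a, ha⟩
      refine ⟨a, ?_⟩
      filter_upwards [ha, eventually_ge_atTop 0] with n h1 h2
      rw [e n, zpow_natCast, ← e' n h2]
      exact_mod_cast h1

lemma growth_iff_neg (β : ℤ → ℕ) (t : ℕ) :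
    (∃ a : ℝ, ∀ᶠ n : ℤ in atBot, (β n : ℝ) ≤ a * (-(n : ℝ)) ^ ((t : ℤ) - 1)) ↔
      Growth t (fun n => (β (-n) : ℕ∞)) := by
  rw [← growth_iff_pos (fun n => β (-n))]
  refine exists_congr fun a => ?_
  rw [← map_neg_atTop, eventually_map]
  simp

variable (A : Type u) [CommRing A] [IsLocalRing A] (M : Type u) [AddCommGroup M] [Module A M]

lemma posComplexity_eq : posComplexity A M =
    ⨅ t ∈ {t : ℕ | Growth t (fun n => (bettiNumber A M n : ℕ∞))}, (t : ℕ∞) := by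
  simp only [posComplexity, growth_iff_pos]

lemma negComplexity_eq : negComplexity A M =
    ⨅ t ∈ {t : ℕ | Growth t (fun n => (bettiNumber A M (-n) : ℕ∞))}, (t : ℕ∞) := by
  simp only [negComplexity, growth_iff_neg]

end Complexity

/-! ### Symmetry of growth and the conclusion. -/

section Symmetry

open Filter IsLocalRing

variable {A : Type u} [CommRing A] [IsLocalRing A] {M : Type u} [AddCommGroup M] [Module A M]
  {k : Type u} [AddCommGroup k] [Module A k]

/-- The excluded degrees are the two ends of `C₀ → C₋₁`, the only differential which need not be
minimal. Cohomology does not depend on the resolution, so the one chosen in the definition may be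
replaced by `R`. -/
lemma bettiNumber_eq_length (e : k ≃ₗ[A] A ⧸ maximalIdeal A) {R : CompleteResolution A M}
    (hR : R.IsAlmostMinimal) {n : ℤ} (hn : n ≠ 0) (hn' : n ≠ -1) :
    (bettiNumber A M n : ℕ∞) = Module.length A (Coh R.cx k (-n)) := by
  have h : ∃ R : CompleteResolution A M, R.IsAlmostMinimal := ⟨R, hR⟩
  have := h.choose.free
  have := h.choose.finite
  rw [bettiNumber, dif_pos h, ← length_coh_eq_finrank e
    (h.choose_spec.minimalAt (by lia)) (h.choose_spec.minimalAt (by lia))]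
  exact le_antisymm (length_coh_le _ _ _) (length_coh_le _ _ _)

lemma length_coh_dual (e : k ≃ₗ[A] A ⧸ maximalIdeal A) {R : CompleteResolution A M}
    (hR : R.IsAlmostMinimal) {i : ℤ} (hi : i ≠ 0) (hi' : i ≠ 1) :
    Module.length A (Coh R.dual.cx k i) = Module.length A (Coh R.cx k (1 - i)) := by
  have := R.free
  have := R.finite
  have := R.dual.free
  have := R.dual.finite
  rw [length_coh_eq_finrank e (hR.minimalAt (by lia)) (hR.minimalAt (by lia)),
    length_coh_eq_finrank e (hR.dual.minimalAt (by lia)) (hR.dual.minimalAt (by lia))]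
  exact congrArg _ (Module.finrank_linearMap_self A A (R.cx.X (1 - i)))

lemma not_exists_isAlmostMinimal_dual [Module.IsReflexive A M]
    (h : ¬ ∃ R : CompleteResolution A M, R.IsAlmostMinimal) :
    ¬ ∃ R : CompleteResolution A (Module.Dual A M), R.IsAlmostMinimal := by
  rintro ⟨R, hR⟩
  exact h ⟨R.dual.ofEquiv (Module.evalEquiv A M).symm, hR.dual⟩

/-- The growth in both directions of the cohomology of an almost minimal complete resolution and
of its dual, in the presence of homotopy commutative endomorphisms which generate. -/
lemma growth_symmetry [IsNoetherianRing A] [Module.Finite A M] (e : k ≃ₗ[A] A ⧸ maximalIdeal A)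
    {R : CompleteResolution A M} (hR : R.IsAlmostMinimal) {r : ℕ} {d : Fin r → ℕ}
    {F : ∀ c, StrictMap R.cx R.cx (d c)} (hd : ∀ c, 0 < d c)
    (hF : ∀ c c' (n : ℤ) (h : (d c : ℤ) + d c' = n) (h' : (d c' : ℤ) + d c = n) (p : ℤ),
      ((F c).comp (F c') n h + (-1 : A) • (F c').comp (F c) n h').NullAt p)
    (hF' : ∀ c c' (n : ℤ) (h : (d c : ℤ) + d c' = n) (h' : (d c' : ℤ) + d c = n) (p : ℤ),
      ((F c).dual.comp (F c').dual n h + (-1 : A) • (F c').dual.comp (F c).dual n h').NullAt p)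
    (hgen : ∃ n : ℤ, ∀ i < n, ∀ x : Coh R.cx k i, ∃ y : ∀ c, Coh R.cx k (i + d c),
      x = ∑ c, Coh.precomp (F c) i _ rfl (y c))
    (hgen' : ∃ n : ℤ, ∀ i < n, ∀ x : Coh (dualCx R.cx) k i,
      ∃ y : ∀ c, Coh (dualCx R.cx) k (i + d c),
      x = ∑ c, Coh.precomp (F c).dual i _ rfl (y c)) (t : ℕ) :
    (Growth t (fun i => Module.length A (Coh R.cx k (-i))) →
      Growth t (fun i => Module.length A (Coh R.cx k i))) ∧
    (Growth t (fun i => Module.length A (Coh R.dual.cx k (-i))) →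
      Growth t (fun i => Module.length A (Coh R.dual.cx k i))) := by
  have := R.free
  have := R.finite
  obtain ⟨n₁, hgen⟩ := hgen
  obtain ⟨n₂, hgen'⟩ := hgen'
  obtain ⟨b, hb⟩ : ∃ b : ℤ, ∀ c, (d c : ℤ) ≤ b := by
    obtain ⟨b, hb⟩ := (Set.finite_range fun c => (d c : ℤ)).bddAbove
    exact ⟨b, fun c => hb ⟨c, rfl⟩⟩
  have hdual : Module.Finite A (Module.Dual A M) := inferInstance
  constructor
  -- Beyond `max 1 b`, all places involved avoid the non-minimal differential, also after
  -- subtracting a degree `d c`; beyond `1 - n₂`, the reflected place `1 - i` lies where the dual is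
  -- generated.
  · refine growth_comparison R ⟨d, hd, F, hF⟩ k e n₁ (max (max 1 b) (1 - n₂)) hgen ?_
    intro i hi x hx
    obtain ⟨p, rfl⟩ : ∃ p, i = 1 - p := ⟨1 - i, by ring⟩
    refine eq_zero_of_dual_generation (F := F) e p (hR.dual.minimalAt (by omega))
      (hR.dual.minimalAt (by omega)) (hgen' p (by omega)) (fun c q hq => hR.minimalAt ?_) x
      fun c q hq => ?_
    · have := hb c
      omega
    · obtain rfl : q = 1 - p - d c := by omega
      exact hx c
  · refine growth_comparison R.dual ⟨d, hd, fun c => (F c).dual, hF'⟩ k e n₂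
      (max (max 1 b) (1 - n₁)) hgen' ?_
    intro i hi x hx
    refine eq_zero_of_generation (F := F) e i (hR.minimalAt (by omega))
      (hR.minimalAt (by omega)) (hgen (1 - i) (by omega)) (fun c q hq => hR.dual.minimalAt ?_) x
      fun c q hq => ?_
    · have := hb c
      omega
    · obtain rfl : q = i - d c := by omega
      exact hx c

/-- The complexities of a reflexive module and its dual are governed by the cohomology of an
almost minimal complete resolution. -/
lemma complexity_eq_of_growth (e : k ≃ₗ[A] A ⧸ maximalIdeal A) {R : CompleteResolution A M}
    (hR : R.IsAlmostMinimal)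
    (h : ∀ t, (Growth t (fun i => Module.length A (Coh R.cx k (-i))) →
        Growth t (fun i => Module.length A (Coh R.cx k i))) ∧
      (Growth t (fun i => Module.length A (Coh R.dual.cx k (-i))) →
        Growth t (fun i => Module.length A (Coh R.dual.cx k i)))) :
    posComplexity A M = negComplexity A M ∧
      negComplexity A M = posComplexity A (Module.Dual A M) ∧
      posComplexity A (Module.Dual A M) = negComplexity A (Module.Dual A M) := by
  have hc {t : ℕ} {f g : ℤ → ℕ∞} (hfg : ∀ n > 1, f n = g n) : Growth t f ↔ Growth t g :=
    ⟨fun hf => hf.mono ((eventually_gt_atTop 1).mono fun n hn => (hfg n hn).ge),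
      fun hg => hg.mono ((eventually_gt_atTop 1).mono fun n hn => (hfg n hn).le)⟩
  have h1 (t : ℕ) : Growth t (fun n => (bettiNumber A M n : ℕ∞)) ↔
      Growth t (fun i => Module.length A (Coh R.cx k (-i))) :=
    hc fun n hn => bettiNumber_eq_length e hR (by omega) (by omega)
  have h2 (t : ℕ) : Growth t (fun n => (bettiNumber A M (-n) : ℕ∞)) ↔
      Growth t (fun i => Module.length A (Coh R.cx k i)) :=
    hc fun n hn => by rw [bettiNumber_eq_length e hR (by omega) (by omega), neg_neg]
  have h3 (t : ℕ) : Growth t (fun n => (bettiNumber A (Module.Dual A M) n : ℕ∞)) ↔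
      Growth t (fun i => Module.length A (Coh R.dual.cx k (-i))) :=
    hc fun n hn => bettiNumber_eq_length e hR.dual (by omega) (by omega)
  have h4 (t : ℕ) : Growth t (fun n => (bettiNumber A (Module.Dual A M) (-n) : ℕ∞)) ↔
      Growth t (fun i => Module.length A (Coh R.dual.cx k i)) :=
    hc fun n hn => by rw [bettiNumber_eq_length e hR.dual (by omega) (by omega), neg_neg]
  have h5 (t : ℕ) : Growth t (fun i => Module.length A (Coh R.dual.cx k (-i))) ↔
      Growth t (fun i => Module.length A (Coh R.cx k i)) := by
    rw [hc (g := fun i => Module.length A (Coh R.cx k (i + 1))) fun n hn => by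
      rw [length_coh_dual e hR (by omega) (by omega), sub_neg_eq_add, add_comm]]
    refine ⟨fun hg => (hg.shift (-1)).mono (Eventually.of_forall fun n => ?_),
      fun hg => hg.shift 1⟩
    have : n + -1 + 1 = n := by ring
    rw [this]
  have h6 (t : ℕ) : Growth t (fun i => Module.length A (Coh R.dual.cx k i)) ↔
      Growth t (fun i => Module.length A (Coh R.cx k (-i))) := by
    rw [hc (g := fun i => Module.length A (Coh R.cx k (-(i + -1)))) fun n hn => by
      rw [length_coh_dual e hR (by omega) (by omega), neg_add, neg_neg, neg_add_eq_sub]]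
    refine ⟨fun hg => (hg.shift 1).mono (Eventually.of_forall fun n => ?_),
      fun hg => hg.shift (-1)⟩
    have : n + 1 + -1 = n := by ring
    rw [this]
  simp only [posComplexity_eq, negComplexity_eq, h1, h2, h3, h4, h5, h6]
  -- One direction is the comparison for the resolution; the other is the comparison for the dual,
  -- read through the reflection of places.
  have key (t : ℕ) : Growth t (fun i => Module.length A (Coh R.cx k (-i))) ↔
      Growth t (fun i => Module.length A (Coh R.cx k i)) :=
    ⟨(h t).1, fun hg => (h6 t).1 ((h t).2 ((h5 t).2 hg))⟩
  simp only [key, and_self]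

end Symmetry

end SymGrowth

end

theorem corollary3p5 {A : Type u} [CommRing A] [IsNoetherianRing A] [IsLocalRing A]
    [HasDerivedCategory.{w} (ModuleCat.{u} A)]
    (M : Type u) [AddCommGroup M] [Module A M] [Module.Finite A M]
    (hM : SymGrowth.IsGDimZero A M)
    {H : Type v} [Ring H] (𝓗 : ℕ → AddSubgroup H) [GradedRing 𝓗]
    (hcomm : ∀ (m n : ℕ), ∀ η ∈ 𝓗 m, ∀ θ ∈ 𝓗 n, η * θ = (-1) ^ (m * n) * (θ * η))
    (ζ : SymGrowth.CentralAction (SymGrowth.Db A) 𝓗)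
    (hnoeth : ζ.IsNoethFL (SymGrowth.dbOf A (M × Module.Dual A M))
      (SymGrowth.dbOf A (IsLocalRing.ResidueField A)))
    (σ : ℕ → ℤˣ) (hdual : SymGrowth.CommutesWithDualization M ζ σ) :
    SymGrowth.posComplexity A M = SymGrowth.negComplexity A M ∧
      SymGrowth.negComplexity A M = SymGrowth.posComplexity A (Module.Dual A M) ∧
      SymGrowth.posComplexity A (Module.Dual A M) = SymGrowth.negComplexity A (Module.Dual A M) := by
  by_cases h : ∃ R : SymGrowth.CompleteResolution A M, R.IsAlmostMinimal
  · obtain ⟨R, hR⟩ := h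
    let e : IsLocalRing.ResidueField A ≃ₗ[A] A ⧸ IsLocalRing.maximalIdeal A :=
      { toFun := fun x => x
        invFun := fun x => x
        left_inv := fun _ => rfl
        right_inv := fun _ => rfl
        map_add' := fun _ _ => rfl
        map_smul' := fun _ _ => rfl }
    obtain ⟨r, d, F, hd, hF, hF', hgen, hgen'⟩ :=
      SymGrowth.exists_commSys hcomm ζ (IsLocalRing.ResidueField A) hnoeth σ hdual R
    exact SymGrowth.complexity_eq_of_growth e hR
      (SymGrowth.growth_symmetry e hR hd hF hF' hgen hgen')
  -- Such a resolution always exists; where `bettiNumber` allows for its absence, all ranks are zero.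
  · have := hM.reflexive
    have h' := SymGrowth.not_exists_isAlmostMinimal_dual h
    have h1 (n : ℤ) : SymGrowth.bettiNumber A M n = 0 := by
      rw [SymGrowth.bettiNumber, dif_neg h]
    have h2 (n : ℤ) : SymGrowth.bettiNumber A (Module.Dual A M) n = 0 := by
      rw [SymGrowth.bettiNumber, dif_neg h']
    simp only [SymGrowth.posComplexity_eq, SymGrowth.negComplexity_eq, h1, h2, and_self]
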